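/- Let $m\ge 0$, $n\ge m+1$, $\mathbf r=(r_1,\dots,r_n)$ with all $r_i>0$, and $\Lambda=\frac1{m+1}\sum_i r_i$. *Conventions.* On a unitary orbit of Hermitian matrices the Kostant–Kirillov form is $\omega_{KK}(X)([\xi,X],[\eta,X])=\operatorname{Im}\operatorname{Tr}(X[\xi,\eta])$ ($\xi,\eta$ skew-Hermitian); the Lie–Poisson bracket is $\{f,g\}(X)=\operatorname{Im}\operatorname{Tr}(X[\nabla f(X),\nabla g(X)])$, where $\operatorname{Im}\operatorname{Tr}(\nabla f(X)Y)=df_X(Y)$ for Hermitian $Y$. *Polygons.* Let $\mathcal O_{\rho}=\{\rho\,ww^*: w\in\mathbb C^{m+1},\|w\|=1\}$, $\widetilde N_{\mathbf r}=\prod_i\mathcal O_{r_i}$, $\widetilde M_{\mathbf r}=\{e\in\widetilde N_{\mathbf r}:\sum_i e_i=\Lambda I\}$ and $M_{\mathbf r}=\widetilde M_{\mathbf r}/U(m+1)$ (simultaneous conjugation), the symplectic quotient of $\widetilde N_{\mathbf r}$ with the product of the forms $\omega_{KK}$. A polygon $e\in\widetilde M_{\mathbf r}$ is decomposable if $\mathbb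 C^{m+1}$ is an orthogonal direct sum of two nonzero subspaces such that every $e_i$ acts in one of them. Let $\lambda_{i1}\ge\dots\ge\lambda_{i,m+1}$ be the eigenvalues of $A_i=e_1+\dots+e_{i+1}$, $0\le i\le n-1$ (bending Hamiltonians). *Grassmannian.* Let $\mathcal O_\Lambda$ (the Grassmannian $G(m+1,\mathbb C^n)$) be the $U(n)$-orbit of $\operatorname{diag}(\Lambda,\dots,\Lambda,0,\dots,0)$ with $m+1$ entries $\Lambda$, and let $\mathcal M_\Lambda=\{X\in\mathcal O_\Lambda: X_{jj}=r_j \text{ for all } j\}/T$ be its quotient at level $\mathbf r$ by the torus $T$ of diagonal unitary $n\times n$ matrices acting by conjugation. Let $\gamma_{k1}\ge\dots\ge\gamma_{kk}$ be the eigenvalues of the principal upper left $k\times k$ block of $X$ (Gel'fand–Tsetlin Hamiltonians). *Matrices.* On complex $(m+1)\times n$ matrices $N$, with columns $C_1,\dots,C_n$, take the symplectic form $\Omega(X,Y)=2\operatorname{Im}\operatorname{Tr}(Y^*X)$. Let $\mathcal M_{\mathbf r,\Lambda}=\{N:\|C_j\|^2=r_j\ (1\le j\le n),\ NN^*=\Lambda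 I\}$, with the maps $\pi_1(N)=[(C_1C_1^*,\dots,C_nC_n^*)]\in M_{\mathbf r}$ and $\pi_2(N)=[N^*N]\in\mathcal M_\Lambda$. *Smooth structure.* On either quotient (possibly singular), a function is smooth if its pullback to the level set is the restriction of an invariant smooth function on the ambient space of ($n$-tuples of) matrices; the Poisson bracket of two smooth functions is induced by the Lie–Poisson bracket of any such invariant extensions. If the orbit form is multiplied by $\varepsilon$, the bracket is multiplied by $\varepsilon^{-1}$. A homeomorphism is called a symplectomorphism if it and its inverse preserve smooth functions, it preserves Poisson brackets (in particular these do not depend on the extensions chosen), and it pulls the reduced symplectic form back to the reduced symplectic form at every class of an indecomposable polygon (the reduced forms being evaluated on velocities of curves in the quotients that are represented by smooth curves in the level sets). **Proposition (Gel'fand–MacPherson duality).** 1. The map $N\mapsto(C_jC_j^*)_j$ from $\{\|C_j\|^2=r_j\}$ to $\widetilde N_{\mathbf r}$ is a quotient map whose fibres are the $T$-orbits, and on vectors tangent to this level set it pulls the sum of the forms $\omega_{KK}$ of the factors back to $\Omega$. The map $N\mapsto N^*N$ from $\{NN^*=\Lambda I\}$ to $\mathcal O_\Lambda$ is a quotient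 map whose fibres are the $U(m+1)$-orbits, and on vectors tangent to this level set it pulls $-\omega_{KK}$ back to $\Omega$. The maps $\pi_1,\pi_2$ are surjective. 2. There is a homeomorphism $\Phi:M_{\mathbf r}\to\mathcal M_\Lambda$ with $\Phi(\pi_1(N))=\pi_2(N)$ for all $N\in\mathcal M_{\mathbf r,\Lambda}$, and it is a symplectomorphism when $\mathcal M_\Lambda$ carries the structure reduced from the form $-\omega_{KK}$ on $\mathcal O_\Lambda$ (the form obtained from $\Omega$ by reduction). Moreover $\Phi^*\gamma_{i+1,j}=\lambda_{ij}$ for $0\le i\le n-1$, $1\le j\le\min(i+1,m+1)$, while $\gamma_{i+1,j}=0$ on $\mathcal M_\Lambda$ for $m+1<j\le i+1$ and $\lambda_{ij}=0$ on $M_{\mathbf r}$ for $i+1<j\le m+1$. 3. There is a homeomorphism $\Psi:M_{\mathbf r}\to\mathcal M_\Lambda$ with $\Psi(\pi_1(N))=\pi_2(\overline N)=[\overline{N^*N}]$ for all $N\in\mathcal M_{\mathbf r,\Lambda}$, and it is a symplectomorphism when $\mathcal M_\Lambda$ carries the structure reduced from $\omega_{KK}$ on $\mathcal O_\Lambda$;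 also $\Psi^*\gamma_{i+1,j}=\lambda_{ij}$ for the same indices. -/

import Mathlib

open scoped ContDiff Matrix

namespace PolygonDuality

noncomputable section

/-- Complex `k × k` matrices. -/
abbrev Mat (k : ℕ) : Type := Matrix (Fin k) (Fin k) ℂ

/-- The unitary group `U(k)`. -/
abbrev U (k : ℕ) : Type := Matrix.unitaryGroup (Fin k) ℂ

/-- Conjugation `X ↦ g X g^*`. -/
def conjBy {k : ℕ} (g X : Mat k) : Mat k := g * X * gᴴ

/-- The diagonal unitary matrix given by a point of the torus `T = (S^1)^n`. -/
def torusMat {n : ℕ} (t : Fin n → Circle) : Mat n := Matrix.diagonal fun i => (t i : ℂ)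

lemma conjBy_one {k : ℕ} (X : Mat k) : conjBy 1 X = X := by simp [conjBy]

lemma conjBy_conjBy {k : ℕ} (g h X : Mat k) : conjBy g (conjBy h X) = conjBy (g * h) X := by
  simp [conjBy, Matrix.conjTranspose_mul, Matrix.mul_assoc]

lemma torusMat_one {n : ℕ} : torusMat (1 : Fin n → Circle) = 1 := by
  simp [torusMat]

lemma torusMat_mul {n : ℕ} (s t : Fin n → Circle) :
    torusMat (s * t) = torusMat s * torusMat t := by
  simp [torusMat]

lemma unitary_mul_conjTranspose {k : ℕ} (g : U k) : (g : Mat k) * (g : Mat k)ᴴ = 1 :=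
  Matrix.mem_unitaryGroup_iff.mp g.2

lemma unitary_conjTranspose_mul {k : ℕ} (g : U k) : (g : Mat k)ᴴ * (g : Mat k) = 1 :=
  Matrix.mem_unitaryGroup_iff'.mp g.2

/-! ### The Kostant–Kirillov form and the Lie–Poisson bracket on Hermitian matrices -/

open Classical in
/-- The Kostant–Kirillov form at `X` on vectors tangent to the unitary orbit of `X`:
`ω(X)([ξ, X], [η, X]) = Im Tr (X [ξ, η])` for skew-Hermitian `ξ, η`
(independent of the choice of `ξ, η`, see `kkForm_lie`). -/
def kkForm {k : ℕ} (X v w : Mat k) : ℝ :=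
  if h : ∃ p : Mat k × Mat k, p.1 ∈ skewAdjoint (Mat k) ∧ p.2 ∈ skewAdjoint (Mat k) ∧
      v = ⁅p.1, X⁆ ∧ w = ⁅p.2, X⁆
  then (X * ⁅h.choose.1, h.choose.2⁆).trace.im else 0

lemma trace_mul_lie_left {k : ℕ} (X ξ η : Mat k) :
    (X * ⁅ξ, η⁆).trace = -(⁅ξ, X⁆ * η).trace := by
  simp only [Ring.lie_def, mul_sub, sub_mul, Matrix.trace_sub]
  rw [show (X * (η * ξ)).trace = (ξ * X * η).trace by
    rw [← Matrix.mul_assoc, Matrix.trace_mul_comm, Matrix.mul_assoc], Matrix.mul_assoc X ξ η]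
  ring

lemma trace_mul_lie_right {k : ℕ} (X ξ η : Mat k) :
    (X * ⁅ξ, η⁆).trace = (ξ * ⁅η, X⁆).trace := by
  simp only [Ring.lie_def, mul_sub, Matrix.trace_sub]
  rw [show (X * (ξ * η)).trace = (ξ * (η * X)).trace by
      rw [Matrix.trace_mul_comm, Matrix.mul_assoc],
    show (X * (η * ξ)).trace = (ξ * (X * η)).trace by
      rw [← Matrix.mul_assoc, Matrix.trace_mul_comm]]

lemma kkForm_lie {k : ℕ} (X ξ η : Mat k) (hξ : ξ ∈ skewAdjoint (Mat k))
    (hη : η ∈ skewAdjoint (Mat k)) :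
    kkForm X ⁅ξ, X⁆ ⁅η, X⁆ = (X * ⁅ξ, η⁆).trace.im := by
  have h : ∃ p : Mat k × Mat k, p.1 ∈ skewAdjoint (Mat k) ∧ p.2 ∈ skewAdjoint (Mat k) ∧
      ⁅ξ, X⁆ = ⁅p.1, X⁆ ∧ ⁅η, X⁆ = ⁅p.2, X⁆ := ⟨(ξ, η), hξ, hη, rfl, rfl⟩
  unfold kkForm
  rw [dif_pos h]
  obtain ⟨-, -, h1, h2⟩ := h.choose_spec
  rw [trace_mul_lie_right, ← h2, ← trace_mul_lie_right, trace_mul_lie_left, ← h1,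
    ← trace_mul_lie_left]

/-- The skew-Hermitian gradient of a real linear functional `L` on Hermitian matrices for the
pairing `⟨ξ, Y⟩ = Im Tr (ξ Y)`; it is characterised by `grad_spec`. -/
def grad {k : ℕ} (L : Mat k →ₗ[ℝ] ℝ) : Mat k :=
  Complex.I • Matrix.of fun a b =>
    (1 / 2 : ℂ) * ((L (Matrix.single a b 1 + Matrix.single b a 1) : ℝ) +
      Complex.I * (L (Matrix.single a b Complex.I - Matrix.single b a Complex.I) : ℝ))

lemma grad_mem {k : ℕ} (L : Mat k →ₗ[ℝ] ℝ) : grad L ∈ skewAdjoint (Mat k) := by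
  rw [skewAdjoint.mem_iff]
  ext a b
  have h : Matrix.single b a Complex.I - Matrix.single a b Complex.I
      = -(Matrix.single a b Complex.I - Matrix.single b a Complex.I) := by abel
  simp only [grad, Matrix.star_apply, Matrix.smul_apply, Matrix.of_apply, Matrix.neg_apply,
    smul_eq_mul, RCLike.star_def, map_mul, map_add, Complex.conj_ofReal, Complex.conj_I]
  have h2 : (starRingEnd ℂ) (1 / 2 : ℂ) = 1 / 2 := by
    rw [map_div₀, map_one, Complex.conj_ofNat]
  rw [h, map_neg, h2]
  simp only [map_sub]
  push_cast
  ring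

lemma grad_spec {k : ℕ} (L : Mat k →ₗ[ℝ] ℝ) (Y : Mat k) (hY : Y.IsHermitian) :
    (grad L * Y).trace.im = L Y := by
  have hdec : Y = (1 / 2 : ℝ) • ∑ a, ∑ b,
      ((Y a b).re • (Matrix.single a b (1 : ℂ) + Matrix.single b a 1) +
        (Y a b).im • (Matrix.single a b Complex.I - Matrix.single b a Complex.I)) := by
    have h1 : Y = ∑ a, ∑ b, Matrix.single a b (Y a b) := Matrix.matrix_eq_sum_single Y
    have h2 : Y = ∑ a, ∑ b, Matrix.single b a (star (Y a b)) := by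
      rw [Finset.sum_comm]
      conv_lhs => rw [h1]
      exact Finset.sum_congr rfl fun a _ => Finset.sum_congr rfl fun b _ => by rw [hY.apply]
    have h3 : Y = (1 / 2 : ℝ) • (Y + Y) := by
      rw [← two_smul ℝ Y, smul_smul]; norm_num
    conv_lhs => rw [h3]
    congr 1
    conv_lhs => rw [h1]
    conv_lhs =>
      enter [2]
      rw [← h1, h2]
    simp only [← Finset.sum_add_distrib]
    refine Finset.sum_congr rfl fun a _ => Finset.sum_congr rfl fun b _ => ?_
    have e1 : Y a b = (Y a b).re * 1 + (Y a b).im * Complex.I := by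
      simp
    have e2 : star (Y a b) = (Y a b).re * 1 - (Y a b).im * Complex.I := by
      apply Complex.ext <;> simp
    ext i j
    simp only [Matrix.add_apply, Matrix.sub_apply, Matrix.smul_apply, Matrix.single_apply,
      Complex.real_smul]
    rw [e2]
    split_ifs <;> apply Complex.ext <;> simp; ring
  conv_rhs => rw [hdec]
  simp only [map_smul, map_sum, map_add, smul_eq_mul]
  rw [Matrix.trace]
  simp only [Matrix.diag_apply, Matrix.mul_apply, Complex.im_sum]
  rw [Finset.mul_sum]
  refine Finset.sum_congr rfl fun a _ => ?_
  rw [Finset.mul_sum]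
  refine Finset.sum_congr rfl fun b _ => ?_
  rw [← hY.apply b a]
  simp only [grad, Matrix.smul_apply, Matrix.of_apply, smul_eq_mul, map_add, map_sub]
  simp
  ring

section smooth

-- Smoothness does not depend on the norm chosen on a finite-dimensional space.
attribute [local instance] Matrix.normedAddCommGroup Matrix.normedSpace

/-- The Lie–Poisson bracket `{F, G}(X) = Im Tr (X [∇F(X), ∇G(X)])` on `k × k` Hermitian matrices;
`F` and `G` are given on all matrices, but only their derivatives in Hermitian directions enter. -/
def lieBracket {k : ℕ} (F G : Mat k → ℝ) (X : Mat k) : ℝ :=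
  (X * ⁅grad (fderiv ℝ F X).toLinearMap, grad (fderiv ℝ G X).toLinearMap⁆).trace.im

/-- The partial gradient of `F` with respect to the `i`-th of `n` Hermitian matrices. -/
def partialGrad {k n : ℕ} (F : (Fin n → Mat k) → ℝ) (e : Fin n → Mat k) (i : Fin n) : Mat k :=
  grad ((fderiv ℝ F e).toLinearMap ∘ₗ LinearMap.single ℝ (fun _ : Fin n => Mat k) i)

/-- The product Lie–Poisson bracket on `n`-tuples of Hermitian matrices. -/
def prodLieBracket {k n : ℕ} (F G : (Fin n → Mat k) → ℝ) (e : Fin n → Mat k) : ℝ :=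
  ∑ i, (e i * ⁅partialGrad F e i, partialGrad G e i⁆).trace.im

end smooth

/-! ### Eigenvalues -/

open Classical in
/-- The `j`-th eigenvalue (`1 ≤ j ≤ k`) of a Hermitian `k × k` matrix, the eigenvalues being
listed with multiplicity in nonincreasing order. -/
def nthEigenvalue {k : ℕ} (A : Mat k) (j : ℕ) : ℝ :=
  if h : A.IsHermitian ∧ 1 ≤ j ∧ j ≤ k then
    h.1.eigenvalues₀ ⟨j - 1, by rw [Fintype.card_fin]; omega⟩ else 0

/-! ### Polygons in Hermitian matrices -/

/-- The orbit `O_ρ` of matrices `ρ w w^*`, `w` a unit vector of `ℂ^(m+1)`. -/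
def rankOneOrbit (m : ℕ) (ρ : ℝ) : Set (Mat (m + 1)) :=
  {X | ∃ w : Fin (m + 1) → ℂ, ∑ i, ‖w i‖ ^ 2 = 1 ∧ X = (ρ : ℂ) • Matrix.vecMulVec w (star w)}

/-- `Λ = (r_1 + ... + r_n) / (m + 1)`. -/
def lam (m : ℕ) {n : ℕ} (r : Fin n → ℝ) : ℝ := (∑ i, r i) / (m + 1)

/-- Linkages with side lengths `r`: the product of the orbits `O_{r_i}`. -/
def Linkage (m : ℕ) {n : ℕ} (r : Fin n → ℝ) : Type :=
  {e : Fin n → Mat (m + 1) // ∀ i, e i ∈ rankOneOrbit m (r i)}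

/-- Closed polygons: linkages with `e_1 + ... + e_n = Λ I`. -/
def ClosedPolygon (m : ℕ) {n : ℕ} (r : Fin n → ℝ) : Type :=
  {e : Fin n → Mat (m + 1) // (∀ i, e i ∈ rankOneOrbit m (r i)) ∧ ∑ i, e i = (lam m r : ℂ) • 1}

instance (m : ℕ) {n : ℕ} (r : Fin n → ℝ) : TopologicalSpace (Linkage m r) :=
  instTopologicalSpaceSubtype

instance (m : ℕ) {n : ℕ} (r : Fin n → ℝ) : TopologicalSpace (ClosedPolygon m r) :=
  instTopologicalSpaceSubtype

/-- Two polygons are equivalent if they differ by the diagonal conjugation action of `U(m+1)`. -/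
instance polygonSetoid (m : ℕ) {n : ℕ} (r : Fin n → ℝ) : Setoid (ClosedPolygon m r) where
  r e e' := ∃ g : U (m + 1), ∀ i, e'.1 i = conjBy g (e.1 i)
  iseqv :=
    { refl := fun e => ⟨1, fun i => by simp [conjBy_one]⟩
      symm := by
        rintro e e' ⟨g, hg⟩
        refine ⟨g⁻¹, fun i => ?_⟩
        rw [hg i, conjBy_conjBy, ← Submonoid.coe_mul, inv_mul_cancel, Submonoid.coe_one,
          conjBy_one]
      trans := by
        rintro e e' e'' ⟨g, hg⟩ ⟨h, hh⟩
        exact ⟨h * g, fun i => by rw [hh i, hg i, conjBy_conjBy, Submonoid.coe_mul]⟩ }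

/-- The moduli space `M_r` of closed polygons, with the quotient topology. -/
abbrev PolygonSpace (m : ℕ) {n : ℕ} (r : Fin n → ℝ) : Type := Quotient (polygonSetoid m r)

/-- A closed polygon is decomposable if `ℂ^(m+1)` is a nontrivial orthogonal direct sum
`V₁ ⊕ V₂` (`P` is the orthogonal projection onto `V₁`) and the edges split into two groups
that act in `V₁` and in `V₂`. Both groups are then closed in their subspaces. -/
def IsDecomposable {m n : ℕ} {r : Fin n → ℝ} (e : ClosedPolygon m r) : Prop :=
  ∃ P : Mat (m + 1), Pᴴ = P ∧ P * P = P ∧ P ≠ 0 ∧ P ≠ 1 ∧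
    ∃ I : Finset (Fin n), (∀ i ∈ I, P * e.1 i * P = e.1 i) ∧
      ∀ i ∉ I, (1 - P) * e.1 i * (1 - P) = e.1 i

/-- The diagonal `A_i = e_1 + ... + e_{i+1}`, `0 ≤ i ≤ n - 1`. -/
def diagonalA {k n : ℕ} (e : Fin n → Mat k) (i : Fin n) : Mat k := ∑ l ∈ Finset.Iic i, e l

/-! ### The torus quotient of the Grassmannian -/

/-- The matrix `diag(Λ, ..., Λ, 0, ..., 0)` with `m + 1` entries `Λ`. -/
def grassDiag (m n : ℕ) (Λ : ℝ) : Mat n :=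
  Matrix.diagonal fun i => if i.val < m + 1 then (Λ : ℂ) else 0

/-- The Grassmannian as the `U(n)`-orbit of `diag(Λ, ..., Λ, 0, ..., 0)`. -/
def grassOrbit (m n : ℕ) (Λ : ℝ) : Set (Mat n) :=
  {X | ∃ g : U n, X = conjBy g (grassDiag m n Λ)}

/-- The level set of the momentum map (the diagonal entries) of the torus of diagonal unitary
matrices acting on the Grassmannian. -/
def GrassLevel (m : ℕ) {n : ℕ} (r : Fin n → ℝ) : Type :=
  {X : Mat n // X ∈ grassOrbit m n (lam m r) ∧ ∀ j, X j j = (r j : ℂ)}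

instance (m : ℕ) {n : ℕ} (r : Fin n → ℝ) : TopologicalSpace (GrassLevel m r) :=
  instTopologicalSpaceSubtype

instance torusSetoid (m : ℕ) {n : ℕ} (r : Fin n → ℝ) : Setoid (GrassLevel m r) where
  r X Y := ∃ t : Fin n → Circle, Y.1 = conjBy (torusMat t) X.1
  iseqv :=
    { refl := fun X => ⟨1, by rw [torusMat_one, conjBy_one]⟩
      symm := by
        rintro X Y ⟨t, ht⟩
        exact ⟨t⁻¹, by
          rw [ht, conjBy_conjBy, ← torusMat_mul, inv_mul_cancel, torusMat_one, conjBy_one]⟩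
      trans := by
        rintro X Y Z ⟨t, ht⟩ ⟨s, hs⟩
        exact ⟨s * t, by rw [hs, ht, conjBy_conjBy, torusMat_mul]⟩ }

/-- The torus quotient at level `r` of the Grassmannian, with the quotient topology. -/
abbrev TorusQuotient (m : ℕ) {n : ℕ} (r : Fin n → ℝ) : Type := Quotient (torusSetoid m r)

/-- The principal upper left `k × k` block `β_k(X)`. -/
def block {n : ℕ} (k : ℕ) (hk : k ≤ n) (X : Mat n) : Mat k :=
  X.submatrix (Fin.castLE hk) (Fin.castLE hk)

/-! ### The Hamiltonians -/

lemma isHermitian_conjBy {k : ℕ} {A : Mat k} (g : Mat k) (hA : A.IsHermitian) :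
    (conjBy g A).IsHermitian := Matrix.isHermitian_mul_mul_conjTranspose g hA

lemma nthEigenvalue_conjBy {k : ℕ} (A : Mat k) (g : Mat k) (hg : gᴴ * g = 1) (j : ℕ) :
    nthEigenvalue (conjBy g A) j = nthEigenvalue A j := by
  have hback : conjBy gᴴ (conjBy g A) = A := by rw [conjBy_conjBy, hg, conjBy_one]
  have hiff : (conjBy g A).IsHermitian ↔ A.IsHermitian :=
    ⟨fun h => hback ▸ isHermitian_conjBy gᴴ h, isHermitian_conjBy g⟩
  have hchar : (conjBy g A).charpoly = A.charpoly := by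
    rw [conjBy, Matrix.charpoly_mul_comm, ← Matrix.mul_assoc, hg, Matrix.one_mul]
  unfold nthEigenvalue
  by_cases h : A.IsHermitian ∧ 1 ≤ j ∧ j ≤ k
  · have h' : (conjBy g A).IsHermitian ∧ 1 ≤ j ∧ j ≤ k := ⟨hiff.mpr h.1, h.2⟩
    rw [dif_pos h, dif_pos h']
    have : h'.1.eigenvalues₀ = h.1.eigenvalues₀ := by
      simp_rw [← List.ofFn_inj, ← Matrix.IsHermitian.sort_roots_charpoly_eq_eigenvalues₀, hchar]
    rw [this]
  · have h' : ¬ ((conjBy g A).IsHermitian ∧ 1 ≤ j ∧ j ≤ k) := by rw [hiff]; exact h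
    rw [dif_neg h, dif_neg h']

lemma diagonalA_conjBy {k n : ℕ} (g : Mat k) (e e' : Fin n → Mat k)
    (h : ∀ i, e' i = conjBy g (e i)) (i : Fin n) :
    diagonalA e' i = conjBy g (diagonalA e i) := by
  simp [diagonalA, h, conjBy, Finset.mul_sum, Finset.sum_mul]

/-- The bending Hamiltonian `λ_{ij}`: the `j`-th eigenvalue of the diagonal `A_i`
(`0 ≤ i ≤ n - 1`, `1 ≤ j ≤ m + 1`). -/
def bending {m n : ℕ} {r : Fin n → ℝ} (i : Fin n) (j : ℕ) : PolygonSpace m r → ℝ :=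
  Quotient.lift (fun e => nthEigenvalue (diagonalA e.1 i) j) (by
    rintro e e' ⟨g, hg⟩
    rw [diagonalA_conjBy _ _ _ hg i, nthEigenvalue_conjBy _ _ (unitary_conjTranspose_mul g)])

lemma block_torus {n : ℕ} (k : ℕ) (hk : k ≤ n) (X : Mat n) (t : Fin n → Circle) :
    block k hk (conjBy (torusMat t) X)
      = conjBy (torusMat fun i => t (Fin.castLE hk i)) (block k hk X) := by
  ext a b
  simp [block, conjBy, torusMat, Matrix.diagonal_conjTranspose]

lemma torusMat_unitary {n : ℕ} (t : Fin n → Circle) : (torusMat t)ᴴ * torusMat t = 1 := by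
  simp only [torusMat, Matrix.diagonal_conjTranspose, Matrix.diagonal_mul_diagonal]
  rw [← Matrix.diagonal_one]
  congr 1
  ext i
  simp [← Complex.normSq_eq_conj_mul_self]

/-- The Gel'fand–Tsetlin Hamiltonian `γ_{kj}`: the `j`-th eigenvalue of the principal
`k × k` block (`1 ≤ j ≤ k ≤ n`). -/
def gelfandTsetlin {m n : ℕ} {r : Fin n → ℝ} (k : ℕ) (hk : k ≤ n) (j : ℕ) :
    TorusQuotient m r → ℝ :=
  Quotient.lift (fun X => nthEigenvalue (block k hk X.1) j) (by
    rintro X Y ⟨t, ht⟩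
    rw [ht, block_torus, nthEigenvalue_conjBy _ _ (torusMat_unitary _)])

/-! ### Reduction of the space of `(m+1) × n` matrices -/

/-- Complex `(m+1) × n` matrices. -/
abbrev RectMat (m n : ℕ) : Type := Matrix (Fin (m + 1)) (Fin n) ℂ

/-- The symplectic form `2 Im Tr (Y^* X)`. -/
def matForm {m n : ℕ} (X Y : RectMat m n) : ℝ := 2 * (Yᴴ * X).trace.im

/-- The matrices `C_j C_j^*` built from the columns `C_j` of `N`; their sum is `N N^*`. -/
def edges {m n : ℕ} (N : RectMat m n) (j : Fin n) : Mat (m + 1) :=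
  Matrix.vecMulVec (fun i => N i j) (star fun i => N i j)

/-- The derivative at `N` of `edges` in the direction `δ`. -/
def dEdges {m n : ℕ} (N δ : RectMat m n) (j : Fin n) : Mat (m + 1) :=
  Matrix.vecMulVec (fun i => δ i j) (star fun i => N i j) +
    Matrix.vecMulVec (fun i => N i j) (star fun i => δ i j)

/-- The level set `‖C_j‖² = r_j` of the momentum map of the torus. -/
def TorusLevel (m : ℕ) {n : ℕ} (r : Fin n → ℝ) : Type :=
  {N : RectMat m n // ∀ j, ∑ i, ‖N i j‖ ^ 2 = r j}

/-- The level set `N N^* = Λ I` of the momentum map of `U(m+1)`. -/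
def UnitaryLevel (m n : ℕ) (Λ : ℝ) : Type :=
  {N : RectMat m n // N * Nᴴ = (Λ : ℂ) • 1}

/-- The common level set: `‖C_j‖² = r_j` and `N N^* = Λ I`. -/
def MatrixLevel (m : ℕ) {n : ℕ} (r : Fin n → ℝ) : Type :=
  {N : RectMat m n // (∀ j, ∑ i, ‖N i j‖ ^ 2 = r j) ∧ N * Nᴴ = (lam m r : ℂ) • 1}

instance (m : ℕ) {n : ℕ} (r : Fin n → ℝ) : TopologicalSpace (TorusLevel m r) :=
  instTopologicalSpaceSubtype

instance (m n : ℕ) (Λ : ℝ) : TopologicalSpace (UnitaryLevel m n Λ) :=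
  instTopologicalSpaceSubtype

lemma sum_edges {m n : ℕ} (N : RectMat m n) : ∑ j, edges N j = N * Nᴴ := by
  ext a b
  simp [edges, Matrix.sum_apply, Matrix.vecMulVec_apply, Matrix.mul_apply]

lemma edges_mem {m n : ℕ} (N : RectMat m n) (j : Fin n) (ρ : ℝ)
    (h : ∑ i, ‖N i j‖ ^ 2 = ρ) : edges N j ∈ rankOneOrbit m ρ := by
  have hρ : 0 ≤ ρ := h ▸ Finset.sum_nonneg fun i _ => by positivity
  rcases hρ.eq_or_lt with h0 | hpos
  · have hz : ∀ i, N i j = 0 := by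
      intro i
      have := (Finset.sum_eq_zero_iff_of_nonneg (fun i _ => by positivity)).mp (h.trans h0.symm)
        i (Finset.mem_univ i)
      simpa using this
    refine ⟨Pi.single 0 1, ?_, ?_⟩
    · rw [Finset.sum_eq_single 0] <;> simp +contextual
    · ext a b
      simp [edges, Matrix.vecMulVec_apply, hz, ← h0]
  · have hs : (Real.sqrt ρ : ℂ) ≠ 0 := by
      exact_mod_cast (Real.sqrt_pos.mpr hpos).ne'
    have hsq : (Real.sqrt ρ : ℂ) * (Real.sqrt ρ : ℂ) = (ρ : ℂ) := by
      exact_mod_cast Real.mul_self_sqrt hρ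
    refine ⟨fun i => N i j / (Real.sqrt ρ : ℂ), ?_, ?_⟩
    · simp only [norm_div, div_pow, Complex.norm_real, Real.norm_eq_abs, sq_abs,
        Real.sq_sqrt hρ, ← Finset.sum_div]
      rw [h, div_self hpos.ne']
    · ext a b
      simp only [edges, Matrix.vecMulVec_apply, Pi.star_apply, Matrix.smul_apply, smul_eq_mul,
        star_div₀, RCLike.star_def, Complex.conj_ofReal]
      rw [← hsq]
      field_simp

/-- `N ↦ (C_1 C_1^*, ..., C_n C_n^*)` from the torus level set to linkages. -/
def edgesMap {m n : ℕ} {r : Fin n → ℝ} (N : TorusLevel m r) : Linkage m r :=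
  ⟨edges N.1, fun j => edges_mem N.1 j (r j) (N.2 j)⟩

lemma isHermitian_grassDiag (m n : ℕ) (Λ : ℝ) : (grassDiag m n Λ).IsHermitian := by
  rw [grassDiag, Matrix.isHermitian_diagonal_iff]
  intro i
  split_ifs
  · simp [isSelfAdjoint_iff]
  · simp

lemma mem_grassOrbit_of_charpoly {m n : ℕ} {Λ : ℝ} {X : Mat n} (hX : X.IsHermitian)
    (h : X.charpoly = (grassDiag m n Λ).charpoly) : X ∈ grassOrbit m n Λ := by
  have hD := isHermitian_grassDiag m n Λ
  have he := (Matrix.IsHermitian.eigenvalues_eq_eigenvalues_iff hX hD).mpr h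
  have h1 := hX.spectral_theorem
  have h2 := hD.spectral_theorem
  rw [he] at h1
  refine ⟨hX.eigenvectorUnitary * hD.eigenvectorUnitary⁻¹, ?_⟩
  rw [Unitary.conjStarAlgAut_apply] at h1 h2
  have h3 : X = conjBy (hX.eigenvectorUnitary : Mat n)
      (Matrix.diagonal (RCLike.ofReal ∘ hD.eigenvalues)) := h1
  have h4 : grassDiag m n Λ = conjBy (hD.eigenvectorUnitary : Mat n)
      (Matrix.diagonal (RCLike.ofReal ∘ hD.eigenvalues)) := h2
  refine h3.trans ((?_ : _ = _).trans (congrArg _ h4.symm))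
  rw [conjBy_conjBy, ← Submonoid.coe_mul, inv_mul_cancel_right]

lemma gram_mem {m n : ℕ} (hmn : m + 1 ≤ n) {Λ : ℝ} (N : RectMat m n)
    (h : N * Nᴴ = (Λ : ℂ) • 1) : Nᴴ * N ∈ grassOrbit m n Λ := by
  refine mem_grassOrbit_of_charpoly (Matrix.isHermitian_conjTranspose_mul_self N) ?_
  have h1 := Matrix.charpoly_mul_comm_of_le Nᴴ N (by simpa using hmn)
  rw [h1, h]
  have h2 : ((Λ : ℂ) • (1 : Mat (m + 1))).charpoly
      = (Polynomial.X - Polynomial.C (Λ : ℂ)) ^ (m + 1) := by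
    rw [Matrix.smul_one_eq_diagonal, Matrix.charpoly_diagonal]
    simp
  rw [h2, grassDiag, Matrix.charpoly_diagonal]
  obtain ⟨l, rfl⟩ := Nat.exists_eq_add_of_le hmn
  rw [Fin.prod_univ_add]
  have h3 : ∀ x : Fin (m + 1), (x : ℕ) ≤ m := fun x => Nat.le_of_lt_succ x.2
  have h4 : ∀ x : Fin l, ¬ (m + 1 + (x : ℕ) ≤ m) := fun x => by omega
  simp [mul_comm, h3, h4]

/-- `N ↦ N^* N` from the `U(m+1)` level set to the Grassmannian. -/
def gramMap {m n : ℕ} (hmn : m + 1 ≤ n) {Λ : ℝ} (N : UnitaryLevel m n Λ) :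
    grassOrbit m n Λ :=
  ⟨N.1ᴴ * N.1, gram_mem hmn N.1 N.2⟩

lemma gram_diag {m n : ℕ} (N : RectMat m n) (j : Fin n) (ρ : ℝ)
    (h : ∑ i, ‖N i j‖ ^ 2 = ρ) : (Nᴴ * N) j j = (ρ : ℂ) := by
  rw [← h, Matrix.mul_apply]
  push_cast
  refine Finset.sum_congr rfl fun i _ => ?_
  rw [Matrix.conjTranspose_apply, RCLike.star_def, ← Complex.normSq_eq_conj_mul_self,
    Complex.normSq_eq_norm_sq]
  push_cast
  rfl

/-- The quotient map `π₁`: first by the torus, then by `U(m+1)`. -/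
def piOne {m n : ℕ} {r : Fin n → ℝ} (N : MatrixLevel m r) : PolygonSpace m r :=
  Quotient.mk _ ⟨edges N.1, fun j => edges_mem N.1 j (r j) (N.2.1 j),
    by rw [sum_edges, N.2.2]⟩

/-- The quotient map `π₂`: first by `U(m+1)`, then by the torus. -/
def piTwo {m n : ℕ} {r : Fin n → ℝ} (hmn : m + 1 ≤ n) (N : MatrixLevel m r) :
    TorusQuotient m r :=
  Quotient.mk _ ⟨N.1ᴴ * N.1, gram_mem hmn N.1 N.2.2,
    fun j => gram_diag N.1 j (r j) (N.2.1 j)⟩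

/-- Entrywise complex conjugation of the matrix `N`. It replaces `N^* N` by its entrywise
complex conjugate. -/
def MatrixLevel.conj {m n : ℕ} {r : Fin n → ℝ} (N : MatrixLevel m r) : MatrixLevel m r :=
  ⟨N.1.map star, by simpa using N.2.1, by
    have h : (N.1.map star) * (N.1.map star)ᴴ = (N.1 * N.1ᴴ).map star := by
      ext a b
      simp [Matrix.mul_apply]
    rw [h, N.2.2]
    ext a b
    by_cases hab : a = b <;> simp [hab]⟩

/-! ### Smooth functions, Poisson brackets and symplectic forms on the reduced spaces

The reduced spaces may be singular. As usual, the smooth functions on a symplectic quotient are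
those that come from invariant smooth functions, and the Poisson bracket of two of them comes
from the bracket of the invariant functions. -/

section smooth

attribute [local instance] Matrix.normedAddCommGroup Matrix.normedSpace

/-- `F` is a smooth `U(m+1)`-invariant function of `n` matrices whose restriction to closed
polygons descends to `f` on `M_r`. -/
def IsPolygonLift {m n : ℕ} {r : Fin n → ℝ} (F : (Fin n → Mat (m + 1)) → ℝ)
    (f : PolygonSpace m r → ℝ) : Prop :=
  ContDiff ℝ ∞ F ∧ (∀ (g : U (m + 1)) e, F (fun i => conjBy g (e i)) = F e) ∧
    ∀ e : ClosedPolygon m r, F e.1 = f (Quotient.mk _ e)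

/-- `F` is a smooth torus-invariant function of matrices whose restriction to the level set
descends to `f` on the torus quotient. -/
def IsGrassLift {m n : ℕ} {r : Fin n → ℝ} (F : Mat n → ℝ) (f : TorusQuotient m r → ℝ) : Prop :=
  ContDiff ℝ ∞ F ∧ (∀ (t : Fin n → Circle) X, F (conjBy (torusMat t) X) = F X) ∧
    ∀ X : GrassLevel m r, F X.1 = f (Quotient.mk _ X)

/-- A smooth function on `M_r`. -/
def PolygonSmooth {m n : ℕ} {r : Fin n → ℝ} (f : PolygonSpace m r → ℝ) : Prop :=
  ∃ F, IsPolygonLift F f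

/-- A smooth function on the torus quotient. -/
def GrassSmooth {m n : ℕ} {r : Fin n → ℝ} (f : TorusQuotient m r → ℝ) : Prop :=
  ∃ F, IsGrassLift F f

/-- `Φ` is a symplectomorphism, where `M_r` is reduced from the product of the orbits `O_{r_i}`
with their Kostant–Kirillov forms, and the torus quotient is reduced from the Grassmannian with
`ε` times its Kostant–Kirillov form (whose Poisson bracket is `ε⁻¹` times the Lie–Poisson
bracket). -/
structure IsSymplectomorphism {m n : ℕ} {r : Fin n → ℝ} (ε : ℝ)
    (Φ : PolygonSpace m r ≃ₜ TorusQuotient m r) : Prop where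
  /-- `Φ` identifies the smooth functions. -/
  smooth_iff : ∀ f : TorusQuotient m r → ℝ, GrassSmooth f ↔ PolygonSmooth (f ∘ Φ)
  /-- `{f ∘ Φ, h ∘ Φ} = {f, h} ∘ Φ`, computed with any choice of invariant lifts. -/
  poisson : ∀ (f h : TorusQuotient m r → ℝ) (F H : Mat n → ℝ)
    (F' H' : (Fin n → Mat (m + 1)) → ℝ),
    IsGrassLift F f → IsGrassLift H h →
    IsPolygonLift F' (f ∘ Φ) → IsPolygonLift H' (h ∘ Φ) →
    ∀ (e : ClosedPolygon m r) (X : GrassLevel m r), Φ (Quotient.mk _ e) = Quotient.mk _ X →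
      prodLieBracket F' H' e.1 = ε⁻¹ * lieBracket F H X.1
  /-- `Φ` pulls the reduced form back to the reduced form on the set of indecomposable polygons,
  where `M_r` is a manifold. The reduced forms are evaluated on velocities of curves in the
  quotients that are represented by smooth curves in the level sets. -/
  form : ∀ (e : ClosedPolygon m r), ¬ IsDecomposable e → ∀ (X : GrassLevel m r)
    (c c' : ℝ → ClosedPolygon m r) (d d' : ℝ → GrassLevel m r),
    ContDiff ℝ ∞ (fun t => (c t).1) → ContDiff ℝ ∞ (fun t => (c' t).1) →
    ContDiff ℝ ∞ (fun t => (d t).1) → ContDiff ℝ ∞ (fun t => (d' t).1) →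
    c 0 = e → c' 0 = e → d 0 = X → d' 0 = X →
    (∀ t, Φ (Quotient.mk _ (c t)) = Quotient.mk _ (d t)) →
    (∀ t, Φ (Quotient.mk _ (c' t)) = Quotient.mk _ (d' t)) →
    ∑ i, kkForm (e.1 i) (deriv (fun t => (c t).1) 0 i) (deriv (fun t => (c' t).1) 0 i) =
      ε * kkForm X.1 (deriv (fun t => (d t).1) 0) (deriv (fun t => (d' t).1) 0)

end smooth

/-- `Φ^* γ_{i+1,j} = λ_{ij}` for all `0 ≤ i ≤ n - 1` and `1 ≤ j ≤ min (i + 1) (m + 1)`; the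
functions `γ_{i+1,j}` and `λ_{ij}` with other indices vanish. -/
def PullsBackToBending {m n : ℕ} {r : Fin n → ℝ}
    (Φ : PolygonSpace m r → TorusQuotient m r) : Prop :=
  (∀ (i : Fin n) (j : ℕ), 1 ≤ j → j ≤ i + 1 → j ≤ m + 1 →
      gelfandTsetlin (i + 1) i.isLt j ∘ Φ = bending i j) ∧
    (∀ (i : Fin n) (j : ℕ), m + 1 < j → j ≤ i + 1 →
      gelfandTsetlin (m := m) (r := r) (i + 1) i.isLt j = 0) ∧
    ∀ (i : Fin n) (j : ℕ), i + 1 < j → j ≤ m + 1 → bending (m := m) (r := r) i j = 0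

/-- Reduction of the `(m+1) × n` matrices by the torus at level `r` gives the product of the
orbits `O_{r_i}` with the Kostant–Kirillov form. -/
structure TorusReduction (m : ℕ) {n : ℕ} (r : Fin n → ℝ) : Prop where
  quotient : Topology.IsQuotientMap (edgesMap : TorusLevel m r → Linkage m r)
  fibers : ∀ N N' : TorusLevel m r, edgesMap N = edgesMap N' ↔
    ∃ t : Fin n → Circle, N'.1 = N.1 * torusMat t
  form : ∀ (N : TorusLevel m r) (δ δ' : RectMat m n),
    (∀ j, (∑ i, star (N.1 i j) * δ i j).re = 0) → (∀ j, (∑ i, star (N.1 i j) * δ' i j).re = 0) →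
    ∑ j, kkForm (edges N.1 j) (dEdges N.1 δ j) (dEdges N.1 δ' j) = matForm δ δ'

/-- Reduction of the `(m+1) × n` matrices by `U(m+1)` at level `Λ I` gives the Grassmannian with
the negative of the Kostant–Kirillov form. -/
structure UnitaryReduction {m n : ℕ} (hmn : m + 1 ≤ n) (Λ : ℝ) : Prop where
  quotient : Topology.IsQuotientMap (gramMap hmn : UnitaryLevel m n Λ → grassOrbit m n Λ)
  fibers : ∀ N N' : UnitaryLevel m n Λ, gramMap hmn N = gramMap hmn N' ↔
    ∃ g : U (m + 1), N'.1 = (g : Mat (m + 1)) * N.1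
  form : ∀ (N : UnitaryLevel m n Λ) (δ δ' : RectMat m n),
    δ * N.1ᴴ + N.1 * δᴴ = 0 → δ' * N.1ᴴ + N.1 * δ'ᴴ = 0 →
    -kkForm (N.1ᴴ * N.1) (δᴴ * N.1 + N.1ᴴ * δ) (δ'ᴴ * N.1 + N.1ᴴ * δ') = matForm δ δ'

end

end PolygonDuality

namespace PolygonDuality

/-! Write `K` for the common level set of the matrices `N` with columns of squared length `r j` and
`N Nᴴ = Λ I`. Both quotients are `K / (U(m+1) × T)`, reached by reducing in stages in the two
possible orders. A product `C Cᴴ` remembers the column `C` up to a phase, so `edges` divides out the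
torus; `Nᴴ N` remembers `N` up to a left unitary factor, so the Gram map divides out `U(m+1)`
(`exists_torus_of_edges_eq`, `exists_unitary_of_gram_eq`). Hence `piOne` and `piTwo` have the same
fibres. By compactness both are quotient maps, and this gives the homeomorphism. If `M` consists of
the first `i + 1` columns, then `A_i = M Mᴴ` and the principal block is `Mᴴ M`; they have the same
nonzero spectrum, which matches the Hamiltonians.

Symplectic forms: the form on matrices descends to `kkForm` on the edges and to `-kkForm` on the
Grassmannian, the sign coming from acting on the left or on the right. To compare reduced forms, two
corresponding curves are lifted to one curve of matrices (`exists_lift`). Indecomposability is what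
makes this lift differentiable: it connects all columns through nonzero inner products, so that a
single phase remains to be fixed.

Poisson brackets are compared at all points, singular or not. The Hamiltonian fields upstairs of
invariant functions preserve both momentum maps, so their integral curves stay in `K`, where the two
pulled-back functions agree (`prodLieBracket_eq_neg_lieBracket`).

Smooth functions: near each point the maps from `K` to the two level sets have analytic local
sections. Composing with them gives local smooth extensions, which are glued by a partition of unity
and averaged over the compact group (`polygonSmooth_of_grassSmooth`,
`grassSmooth_of_polygonSmooth`).

Finally, transposition of Hermitian matrices is complex conjugation. It preserves spectra and
reverses `kkForm` and `lieBracket`; composing with it turns `Φ` into `Ψ` and `ε = -1` into `ε = 1`.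
-/

/-! ### The Kostant–Kirillov form on the two reductions -/

/-- A skew-Hermitian `ξ` with `N ξ = -δ`, for `δ` tangent to the level set `N N^* = Λ I`. -/
lemma exists_skew_mul_eq_neg {m n : ℕ} {Λ : ℝ} (hΛ : 0 < Λ) (N δ : RectMat m n)
    (hN : N * Nᴴ = (Λ : ℂ) • 1) (hδ : δ * Nᴴ + N * δᴴ = 0) :
    ∃ ξ ∈ skewAdjoint (Mat n), N * ξ = -δ := by
  have hΛ' : (Λ : ℂ) ≠ 0 := by exact_mod_cast hΛ.ne'
  have h1 : N * δᴴ = -(δ * Nᴴ) := eq_neg_of_add_eq_zero_right hδ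
  -- `N` times the first term is `-δ - Λ⁻¹ δ Nᴴ N`, by tangency; the second term cancels the error
  -- and is skew because `δ Nᴴ` is.
  refine ⟨-(Λ : ℂ)⁻¹ • (Nᴴ * δ - δᴴ * N) + ((Λ : ℂ)⁻¹ * (Λ : ℂ)⁻¹) • (Nᴴ * (δ * Nᴴ) * N), ?_, ?_⟩
  · rw [skewAdjoint.mem_iff, Matrix.star_eq_conjTranspose]
    have h2 : (δ * Nᴴ)ᴴ = -(δ * Nᴴ) := by
      rw [Matrix.conjTranspose_mul, Matrix.conjTranspose_conjTranspose, h1]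
    simp only [Matrix.conjTranspose_add, Matrix.conjTranspose_smul, Matrix.conjTranspose_sub,
      Matrix.conjTranspose_mul Nᴴ, Matrix.conjTranspose_mul δᴴ, Matrix.conjTranspose_mul _ N, h2,
      Matrix.conjTranspose_conjTranspose]
    simp only [star_neg, star_mul', star_inv₀, RCLike.star_def, Complex.conj_ofReal,
      Matrix.neg_mul, Matrix.mul_neg, smul_neg, smul_sub, Matrix.mul_assoc, neg_smul]
    abel
  · simp only [Matrix.mul_add, Matrix.mul_smul, Matrix.mul_sub, ← Matrix.mul_assoc, hN, h1,
      Matrix.smul_mul, Matrix.one_mul, Matrix.neg_mul, smul_smul, smul_sub]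
    rw [neg_mul, inv_mul_cancel₀ hΛ', mul_assoc, inv_mul_cancel₀ hΛ', mul_one]
    simp

/-- A tangent `δ` is `-N ξ` for a skew `ξ`, so the Gram matrix moves by `⁅ξ, Nᴴ N⁆`. Cycling the
trace turns `Tr (Nᴴ N ξ η)` into `Tr ((N ξ) (η Nᴴ)) = -Tr (δ δ'ᴴ)`, and the commutator yields twice
the imaginary part. -/
lemma unitaryReduction_form {m n : ℕ} {Λ : ℝ} (hΛ : 0 < Λ) (N δ δ' : RectMat m n)
    (hN : N * Nᴴ = (Λ : ℂ) • 1) (hδ : δ * Nᴴ + N * δᴴ = 0) (hδ' : δ' * Nᴴ + N * δ'ᴴ = 0) :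
    -kkForm (Nᴴ * N) (δᴴ * N + Nᴴ * δ) (δ'ᴴ * N + Nᴴ * δ') = matForm δ δ' := by
  obtain ⟨ξ, hξ, h1⟩ := exists_skew_mul_eq_neg hΛ N δ hN hδ
  obtain ⟨η, hη, h2⟩ := exists_skew_mul_eq_neg hΛ N δ' hN hδ'
  have key : ∀ ζ ∈ skewAdjoint (Mat n), ∀ v : RectMat m n, N * ζ = -v →
      ζ * Nᴴ = vᴴ ∧ vᴴ * N + Nᴴ * v = ⁅ζ, Nᴴ * N⁆ := by
    intro ζ hζ v hv
    have h3 : ζ * Nᴴ = vᴴ := by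
      have := congrArg Matrix.conjTranspose hv
      rw [Matrix.conjTranspose_mul, ← Matrix.star_eq_conjTranspose ζ,
        skewAdjoint.mem_iff.mp hζ, Matrix.conjTranspose_neg, Matrix.neg_mul] at this
      exact neg_injective this
    refine ⟨h3, ?_⟩
    rw [Ring.lie_def, ← Matrix.mul_assoc, h3, Matrix.mul_assoc, hv, Matrix.mul_neg, sub_neg_eq_add]
  obtain ⟨h1', e1⟩ := key ξ hξ δ h1
  obtain ⟨h2', e2⟩ := key η hη δ' h2
  rw [e1, e2, kkForm_lie _ _ _ hξ hη, Ring.lie_def, mul_sub, Matrix.trace_sub]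
  have t : ∀ a b : Mat n, (Nᴴ * N * (a * b)).trace = ((N * a) * (b * Nᴴ)).trace := by
    intro a b
    rw [Matrix.mul_assoc, Matrix.trace_mul_comm]
    simp only [Matrix.mul_assoc]
  rw [t, t, h1, h2, h1', h2']
  have h3 : (δ' * δᴴ).trace = star (δ * δ'ᴴ).trace := by
    rw [← Matrix.trace_conjTranspose, Matrix.conjTranspose_mul, Matrix.conjTranspose_conjTranspose]
  simp only [Matrix.neg_mul, Matrix.trace_neg, h3, matForm]
  rw [Matrix.trace_mul_comm δ'ᴴ]
  simp
  ring

/-- This is `unitaryReduction_form` for one row: the row `Cᴴ` of a column `C` has Gram matrix `C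
Cᴴ`. Passing to conjugate entries reverses the sign of the matrix form, which is why the sign here
is positive. -/
lemma kkForm_edges {m n : ℕ} (N δ δ' : RectMat m n) (j : Fin n) (ρ : ℝ) (hρ : 0 < ρ)
    (hN : ∑ i, ‖N i j‖ ^ 2 = ρ)
    (hδ : (∑ i, star (N i j) * δ i j).re = 0) (hδ' : (∑ i, star (N i j) * δ' i j).re = 0) :
    kkForm (edges N j) (dEdges N δ j) (dEdges N δ' j)
      = 2 * (∑ i, star (δ' i j) * δ i j).im := by
  have hherm : ∀ δ : RectMat m n, (∑ i, star (N i j) * δ i j).re = 0 →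
      (Matrix.of fun _ i => star (δ i j) : RectMat 0 (m + 1)) *
        (Matrix.of fun _ i => star (N i j) : RectMat 0 (m + 1))ᴴ +
      (Matrix.of fun _ i => star (N i j) : RectMat 0 (m + 1)) *
        (Matrix.of fun _ i => star (δ i j) : RectMat 0 (m + 1))ᴴ = 0 := by
    intro δ hδ
    ext a b
    have h : (∑ i, star (δ i j) * N i j) = star (∑ i, star (N i j) * δ i j) := by
      rw [star_sum]
      exact Finset.sum_congr rfl fun i _ => by rw [star_mul', star_star, mul_comm]
    simp only [Matrix.add_apply, Matrix.mul_apply, Matrix.of_apply, Matrix.conjTranspose_apply,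
      star_star, Matrix.zero_apply, h]
    apply Complex.ext
    · exact (congrArg₂ (· + ·) hδ hδ).trans (add_zero 0)
    · exact neg_add_cancel (∑ i, star (N i j) * δ i j).im
  have key := unitaryReduction_form hρ (Matrix.of fun _ i => star (N i j) : RectMat 0 (m + 1))
    (Matrix.of fun _ i => star (δ i j)) (Matrix.of fun _ i => star (δ' i j)) ?_ ?_ ?_
  · have h1 : (Matrix.of fun _ i => star (N i j) : RectMat 0 (m + 1))ᴴ *
        (Matrix.of fun _ i => star (N i j) : RectMat 0 (m + 1)) = edges N j := by
      ext a b; simp [edges, Matrix.mul_apply, Matrix.vecMulVec_apply]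
    have h2 : ∀ δ : RectMat m n, (Matrix.of fun _ i => star (δ i j) : RectMat 0 (m + 1))ᴴ *
        (Matrix.of fun _ i => star (N i j) : RectMat 0 (m + 1)) +
        (Matrix.of fun _ i => star (N i j) : RectMat 0 (m + 1))ᴴ *
        (Matrix.of fun _ i => star (δ i j) : RectMat 0 (m + 1)) = dEdges N δ j := by
      intro δ; ext a b; simp [dEdges, Matrix.mul_apply, Matrix.vecMulVec_apply]
    rw [h1, h2, h2] at key
    rw [← neg_neg (kkForm _ _ _), key, matForm, Matrix.trace_mul_comm]
    simp only [Matrix.trace, Matrix.mul_apply, Matrix.diag_apply, Nat.reduceAdd, Fin.sum_univ_one, Matrix.of_apply, Matrix.conjTranspose_apply, star_star, Complex.im_sum,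
      Finset.mul_sum, ← Finset.sum_neg_distrib]
    refine Finset.sum_congr rfl fun i _ => ?_
    simp
    ring
  · ext a b
    rw [Fin.fin_one_eq_zero a, Fin.fin_one_eq_zero b, ← hN, Matrix.mul_apply]
    push_cast
    simp only [Matrix.of_apply, Matrix.conjTranspose_apply, star_star, Matrix.smul_apply,
      Matrix.one_apply_eq, smul_eq_mul, mul_one]
    refine Finset.sum_congr rfl fun i _ => ?_
    rw [RCLike.star_def, Complex.conj_mul']
  · exact hherm δ hδ
  · exact hherm δ' hδ'



lemma torusReduction_form {m n : ℕ} {r : Fin n → ℝ} (hr : ∀ i, 0 < r i) (N : TorusLevel m r)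
    (δ δ' : RectMat m n) (hδ : ∀ j, (∑ i, star (N.1 i j) * δ i j).re = 0)
    (hδ' : ∀ j, (∑ i, star (N.1 i j) * δ' i j).re = 0) :
    ∑ j, kkForm (edges N.1 j) (dEdges N.1 δ j) (dEdges N.1 δ' j) = matForm δ δ' := by
  rw [Finset.sum_congr rfl fun j _ =>
    kkForm_edges N.1 δ δ' j (r j) (hr j) (N.2 j) (hδ j) (hδ' j)]
  simp [matForm, Matrix.trace, Matrix.mul_apply, Finset.mul_sum]

/-! ### Fibres -/

lemma edges_mul_torusMat {m n : ℕ} (N : RectMat m n) (t : Fin n → Circle) :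
    edges (N * torusMat t) = edges N := by
  ext j a b
  have h : (t j : ℂ) * star (t j : ℂ) = 1 := by
    rw [RCLike.star_def, Complex.mul_conj, Circle.normSq_coe, Complex.ofReal_one]
  simp only [edges, torusMat, Matrix.mul_diagonal, Matrix.vecMulVec_apply, Pi.star_apply, star_mul']
  linear_combination (N a j * star (N b j)) * h

lemma edges_mul_left {m n : ℕ} (g : Mat (m + 1)) (N : RectMat m n) (j : Fin n) :
    edges (g * N) j = conjBy g (edges N j) := by
  have h : (fun i => (g * N) i j) = g *ᵥ fun i => N i j := by
    ext i; simp [Matrix.mul_apply, Matrix.mulVec, dotProduct]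
  rw [edges, conjBy, edges, h, Matrix.star_mulVec, Matrix.mul_vecMulVec, Matrix.vecMulVec_mul]

/-- The phase of column `j` is the ratio of the two entries in a row where `N` does not vanish. -/
lemma exists_torus_of_edges_eq {m n : ℕ} (N N' : RectMat m n)
    (hN : ∀ j, ∃ i, N i j ≠ 0) (h : edges N = edges N') :
    ∃ t : Fin n → Circle, N' = N * torusMat t := by
  have hj : ∀ j, ∃ z : Circle, ∀ i, N' i j = N i j * z := by
    intro j
    obtain ⟨i0, hi0⟩ := hN j
    have hab : ∀ a b, N a j * star (N b j) = N' a j * star (N' b j) := fun a b => by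
      have := congrFun (congrFun (congrFun h j) a) b
      simpa [edges, Matrix.vecMulVec_apply] using this
    have hnorm : ‖N i0 j‖ = ‖N' i0 j‖ := by
      have := congrArg norm (hab i0 i0)
      simp only [norm_mul, norm_star] at this
      nlinarith [norm_nonneg (N i0 j), norm_nonneg (N' i0 j)]
    have hi0' : N' i0 j ≠ 0 := by rw [← norm_ne_zero_iff, ← hnorm, norm_ne_zero_iff]; exact hi0
    refine ⟨⟨N' i0 j / N i0 j, ?_⟩, fun i => ?_⟩
    · have : ‖N' i0 j / N i0 j‖ = 1 := by
        rw [norm_div, hnorm, div_self (norm_ne_zero_iff.mpr hi0')]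
      exact mem_sphere_zero_iff_norm.mpr this
    · change N' i j = N i j * (N' i0 j / N i0 j)
      have h1 := hab i i0
      have h2 := hab i0 i0
      have h3 : star (N' i0 j) ≠ 0 := star_ne_zero.mpr hi0'
      rw [mul_div_assoc', eq_div_iff hi0]
      apply mul_right_cancel₀ h3
      have h4 : star (N i0 j) ≠ 0 := star_ne_zero.mpr hi0
      linear_combination N i0 j * (- h1) + N i j * h2
  choose t ht using hj
  exact ⟨t, by ext i j; rw [torusMat, Matrix.mul_diagonal]; exact ht j i⟩

lemma gram_mul_left {m n : ℕ} (g : Mat (m + 1)) (hg : gᴴ * g = 1) (N : RectMat m n) :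
    (g * N)ᴴ * (g * N) = Nᴴ * N := by
  rw [Matrix.conjTranspose_mul, Matrix.mul_assoc, ← Matrix.mul_assoc gᴴ, hg, Matrix.one_mul]

/-- The unitary is `Λ⁻¹ N' Nᴴ`. Replacing `Nᴴ N` by `N'ᴴ N'` reduces both its unitarity and its
action on `N` to `N' N'ᴴ = Λ I`. -/
lemma exists_unitary_of_gram_eq {m n : ℕ} {Λ : ℝ} (hΛ : 0 < Λ) (N N' : RectMat m n)
    (hN' : N' * N'ᴴ = (Λ : ℂ) • 1) (h : Nᴴ * N = N'ᴴ * N') :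
    ∃ g : U (m + 1), N' = (g : Mat (m + 1)) * N := by
  have hΛ' : (Λ : ℂ) ≠ 0 := by exact_mod_cast hΛ.ne'
  refine ⟨⟨(Λ : ℂ)⁻¹ • (N' * Nᴴ), ?_⟩, ?_⟩
  · rw [Matrix.mem_unitaryGroup_iff, Matrix.star_eq_conjTranspose, Matrix.conjTranspose_smul,
      Matrix.conjTranspose_mul, Matrix.conjTranspose_conjTranspose, Matrix.smul_mul, Matrix.mul_smul,
      Matrix.mul_assoc, ← Matrix.mul_assoc Nᴴ, h, Matrix.mul_assoc, hN', ← Matrix.mul_assoc, hN', Matrix.smul_mul, Matrix.one_mul, smul_smul, smul_smul, smul_smul,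
      star_inv₀, RCLike.star_def, Complex.conj_ofReal, mul_assoc, mul_assoc,
      inv_mul_cancel_left₀ hΛ', inv_mul_cancel₀ hΛ', one_smul]
  · change N' = ((Λ : ℂ)⁻¹ • (N' * Nᴴ)) * N
    rw [Matrix.smul_mul, Matrix.mul_assoc, h, ← Matrix.mul_assoc, hN', Matrix.smul_mul, Matrix.one_mul, smul_smul,
      inv_mul_cancel₀ hΛ', one_smul]

/-! ### Surjectivity -/

lemma exists_edges_eq {m n : ℕ} {r : Fin n → ℝ} (hr : ∀ i, 0 < r i) (e : Fin n → Mat (m + 1))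
    (he : ∀ i, e i ∈ rankOneOrbit m (r i)) :
    ∃ N : RectMat m n, (∀ j, ∑ i, ‖N i j‖ ^ 2 = r j) ∧ edges N = e := by
  choose w hw he using he
  refine ⟨Matrix.of fun i j => (Real.sqrt (r j) : ℂ) * w j i, fun j => ?_, ?_⟩
  · simp only [Matrix.of_apply, norm_mul, mul_pow, Complex.norm_real, Real.norm_eq_abs, sq_abs,
      Real.sq_sqrt (hr j).le, ← Finset.mul_sum, hw, mul_one]
  · ext j a b
    have hsq : (Real.sqrt (r j) : ℂ) * (Real.sqrt (r j) : ℂ) = (r j : ℂ) := by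
      exact_mod_cast Real.mul_self_sqrt (hr j).le
    simp only [edges, Matrix.of_apply, he, Matrix.vecMulVec_apply, Matrix.smul_apply, Pi.star_apply,
      star_mul', RCLike.star_def, Complex.conj_ofReal, smul_eq_mul]
    linear_combination (w j a * (starRingEnd ℂ) (w j b)) * hsq

lemma exists_gram_eq {m n : ℕ} (hmn : m + 1 ≤ n) {Λ : ℝ} (hΛ : 0 < Λ) (X : Mat n)
    (hX : X ∈ grassOrbit m n Λ) :
    ∃ N : RectMat m n, N * Nᴴ = (Λ : ℂ) • 1 ∧ Nᴴ * N = X := by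
  obtain ⟨g, rfl⟩ := hX
  have hsq : (Real.sqrt Λ : ℂ) * (Real.sqrt Λ : ℂ) = (Λ : ℂ) := by
    exact_mod_cast Real.mul_self_sqrt hΛ.le
  have hgg := unitary_conjTranspose_mul g
  -- `J = √Λ [I | 0]` lies over the diagonal base point of the orbit; right multiplication by `gᴴ`
  -- carries it over the conjugate by `g`.
  let J : RectMat m n := Matrix.of fun i j => if Fin.castLE hmn i = j then (Real.sqrt Λ : ℂ) else 0
  have hJ1 : J * Jᴴ = (Λ : ℂ) • 1 := by
    ext a b
    rw [Matrix.mul_apply, Finset.sum_eq_single (Fin.castLE hmn a)]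
    · by_cases hab : a = b
      · simp [J, hab, hsq]
      · have : b ≠ a := fun h => hab h.symm
        simp [J, hab, this]
    · intro c _ hc
      simp [J, hc.symm]
    · simp
  have hJ2 : Jᴴ * J = grassDiag m n Λ := by
    ext a b
    rw [Matrix.mul_apply, grassDiag, Matrix.diagonal_apply]
    by_cases ha : a.val < m + 1
    · rw [Finset.sum_eq_single (⟨a, ha⟩ : Fin (m + 1))]
      · have h1 : Fin.castLE hmn ⟨a, ha⟩ = a := rfl
        by_cases hab : a = b
        · subst hab; simp [J, h1, hsq, ha]
        · simp [J, h1, hab]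
      · intro c _ hc
        have : Fin.castLE hmn c ≠ a := fun h => hc (Fin.ext (by simpa using congrArg Fin.val h))
        simp [J, this]
      · simp
    · rw [Finset.sum_eq_zero]
      · simp [ha]
      · intro c _
        have : Fin.castLE hmn c ≠ a := fun h => ha (by rw [← h]; exact c.2)
        simp [J, this]
  refine ⟨J * (g : Mat n)ᴴ, ?_, ?_⟩
  · rw [Matrix.conjTranspose_mul, Matrix.conjTranspose_conjTranspose, Matrix.mul_assoc,
      ← Matrix.mul_assoc _ (g : Mat n), hgg, Matrix.one_mul, hJ1]
  · rw [Matrix.conjTranspose_mul, Matrix.conjTranspose_conjTranspose, Matrix.mul_assoc,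
      ← Matrix.mul_assoc _ J, hJ2, conjBy, Matrix.mul_assoc]

lemma norm_sq_of_gram_diag {m n : ℕ} (N : RectMat m n) (j : Fin n) (ρ : ℝ)
    (h : (Nᴴ * N) j j = (ρ : ℂ)) : ∑ i, ‖N i j‖ ^ 2 = ρ := by
  have := gram_diag N j _ rfl
  rw [h] at this
  exact_mod_cast this.symm


noncomputable section

/-! ### Quotient maps -/

lemma norm_le_of_sum_sq {m n : ℕ} (N : RectMat m n) (j : Fin n) (ρ : ℝ)
    (h : ∑ i, ‖N i j‖ ^ 2 = ρ) (i : Fin (m + 1)) : ‖N i j‖ ≤ Real.sqrt ρ := by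
  apply Real.le_sqrt_of_sq_le
  rw [← h]
  exact Finset.single_le_sum (f := fun i => ‖N i j‖ ^ 2) (fun i _ => by positivity)
    (Finset.mem_univ i)

lemma isCompact_pi_closedBall {m n : ℕ} (R : Fin (m + 1) → Fin n → ℝ) :
    IsCompact {N : RectMat m n | ∀ i j, ‖N i j‖ ≤ R i j} := by
  have : {N : RectMat m n | ∀ i j, ‖N i j‖ ≤ R i j}
      = Set.univ.pi fun i => Set.univ.pi fun j => Metric.closedBall (0 : ℂ) (R i j) := by
    refine Set.ext fun N => ⟨fun h i _ j _ => mem_closedBall_zero_iff.mpr (h i j),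
      fun h i j => mem_closedBall_zero_iff.mp (h i trivial j trivial)⟩
  rw [this]
  exact isCompact_univ_pi fun i => isCompact_univ_pi fun j => isCompact_closedBall _ _

lemma continuous_entry {a b : Type*} (i : a) (j : b) :
    Continuous fun N : Matrix a b ℂ => N i j :=
  continuous_id.matrix_elem i j

lemma isClosed_torusLevel (m : ℕ) {n : ℕ} (r : Fin n → ℝ) :
    IsClosed {N : RectMat m n | ∀ j, ∑ i, ‖N i j‖ ^ 2 = r j} := by
  rw [Set.ofPred_forall]
  refine isClosed_iInter fun j => isClosed_eq ?_ continuous_const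
  exact continuous_finsetSum _ fun i _ => (continuous_entry i j).norm.pow 2

lemma isCompact_torusLevel (m : ℕ) {n : ℕ} (r : Fin n → ℝ) :
    IsCompact {N : RectMat m n | ∀ j, ∑ i, ‖N i j‖ ^ 2 = r j} :=
  (isCompact_pi_closedBall fun _ j => Real.sqrt (r j)).of_isClosed_subset
    (isClosed_torusLevel m r) fun N hN i j => norm_le_of_sum_sq N j (r j) (hN j) i

lemma continuous_mul_conjTranspose {a b : Type*} [Fintype b] :
    Continuous fun N : Matrix a b ℂ => N * Nᴴ :=
  continuous_id.matrix_mul continuous_id.matrix_conjTranspose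

lemma continuous_gram {m n : ℕ} : Continuous fun N : RectMat m n => Nᴴ * N :=
  continuous_id.matrix_conjTranspose.matrix_mul continuous_id

lemma continuous_edges {m n : ℕ} : Continuous fun N : RectMat m n => edges N := by
  refine continuous_pi fun j => Continuous.matrix_vecMulVec ?_ ?_
  · exact continuous_pi fun i => continuous_entry i j
  · exact continuous_pi fun i => continuous_star.comp (continuous_entry i j)

lemma isClosed_unitaryLevel (m n : ℕ) (Λ : ℝ) :
    IsClosed {N : RectMat m n | N * Nᴴ = (Λ : ℂ) • 1} :=
  isClosed_eq continuous_mul_conjTranspose continuous_const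

lemma row_norm_sq {m n : ℕ} {Λ : ℝ} (N : RectMat m n) (h : N * Nᴴ = (Λ : ℂ) • 1)
    (i : Fin (m + 1)) : ∑ j, ‖N i j‖ ^ 2 = Λ := by
  have h1 : (N * Nᴴ) i i = (Λ : ℂ) := by rw [h]; simp
  rw [Matrix.mul_apply] at h1
  have h2 : ((∑ j, ‖N i j‖ ^ 2 : ℝ) : ℂ) = Λ := by
    rw [← h1]
    push_cast
    exact Finset.sum_congr rfl fun j _ => (Complex.mul_conj' _).symm
  exact_mod_cast h2

lemma isCompact_unitaryLevel (m n : ℕ) (Λ : ℝ) :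
    IsCompact {N : RectMat m n | N * Nᴴ = (Λ : ℂ) • 1} := by
  refine (isCompact_pi_closedBall fun _ _ => Real.sqrt Λ).of_isClosed_subset
    (isClosed_unitaryLevel m n Λ) fun N hN i j => ?_
  apply Real.le_sqrt_of_sq_le
  rw [← row_norm_sq N hN i]
  exact Finset.single_le_sum (f := fun j => ‖N i j‖ ^ 2) (fun i _ => by positivity)
    (Finset.mem_univ j)

instance (m : ℕ) {n : ℕ} (r : Fin n → ℝ) : TopologicalSpace (MatrixLevel m r) :=
  instTopologicalSpaceSubtype

instance (m : ℕ) {n : ℕ} (r : Fin n → ℝ) : CompactSpace (TorusLevel m r) :=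
  isCompact_iff_compactSpace.mp (isCompact_torusLevel m r)

instance (m n : ℕ) (Λ : ℝ) : CompactSpace (UnitaryLevel m n Λ) :=
  isCompact_iff_compactSpace.mp (isCompact_unitaryLevel m n Λ)

instance (m : ℕ) {n : ℕ} (r : Fin n → ℝ) : CompactSpace (MatrixLevel m r) :=
  isCompact_iff_compactSpace.mp
    ((isCompact_torusLevel m r).inter_right (isClosed_unitaryLevel m n (lam m r)))

instance (m : ℕ) {n : ℕ} (r : Fin n → ℝ) : T2Space (Linkage m r) :=
  inferInstanceAs (T2Space (Subtype _))

instance (m : ℕ) {n : ℕ} (r : Fin n → ℝ) : T2Space (ClosedPolygon m r) :=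
  inferInstanceAs (T2Space (Subtype _))

instance (m : ℕ) {n : ℕ} (r : Fin n → ℝ) : T2Space (GrassLevel m r) :=
  inferInstanceAs (T2Space (Subtype _))

lemma lam_pos {m n : ℕ} (hmn : m + 1 ≤ n) {r : Fin n → ℝ} (hr : ∀ i, 0 < r i) : 0 < lam m r := by
  have : Nonempty (Fin n) := ⟨⟨0, by omega⟩⟩
  exact div_pos (Finset.sum_pos (fun i _ => hr i) Finset.univ_nonempty) (by positivity)

lemma exists_entry_ne_zero {m n : ℕ} {r : Fin n → ℝ} (hr : ∀ i, 0 < r i) {N : RectMat m n}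
    (hN : ∀ j, ∑ i, ‖N i j‖ ^ 2 = r j) (j : Fin n) : ∃ i, N i j ≠ 0 := by
  by_contra! h
  have := hN j
  simp only [h, norm_zero, ne_eq, OfNat.ofNat_ne_zero, not_false_eq_true, zero_pow,
    Finset.sum_const_zero] at this
  exact (hr j).ne this

/-- The level set is compact and the target Hausdorff, so the continuous surjection is closed and
therefore a quotient map. The same argument serves for every quotient map below. -/
theorem torusReduction (m : ℕ) {n : ℕ} {r : Fin n → ℝ} (hr : ∀ i, 0 < r i) :
    TorusReduction m r where
  quotient := by
    have hc : Continuous (edgesMap : TorusLevel m r → Linkage m r) :=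
      Continuous.subtype_mk (continuous_edges.comp continuous_subtype_val) _
    refine hc.isClosedMap.isQuotientMap hc fun e => ?_
    obtain ⟨N, h1, h2⟩ := exists_edges_eq hr e.1 e.2
    exact ⟨⟨N, h1⟩, Subtype.ext h2⟩
  fibers N N' := by
    constructor
    · exact fun h => exists_torus_of_edges_eq N.1 N'.1 (exists_entry_ne_zero hr N.2)
        (congrArg Subtype.val h)
    · rintro ⟨t, ht⟩
      exact Subtype.ext ((edges_mul_torusMat N.1 t).symm.trans (congrArg edges ht.symm))
  form := torusReduction_form hr

theorem unitaryReduction {m n : ℕ} (hmn : m + 1 ≤ n) {Λ : ℝ} (hΛ : 0 < Λ) :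
    UnitaryReduction hmn Λ where
  quotient := by
    have hc : Continuous (gramMap hmn : UnitaryLevel m n Λ → grassOrbit m n Λ) :=
      Continuous.subtype_mk (continuous_gram.comp continuous_subtype_val) _
    refine hc.isClosedMap.isQuotientMap hc fun X => ?_
    obtain ⟨N, h1, h2⟩ := exists_gram_eq hmn hΛ X.1 X.2
    exact ⟨⟨N, h1⟩, Subtype.ext h2⟩
  fibers N N' := by
    constructor
    · exact fun h => exists_unitary_of_gram_eq hΛ N.1 N'.1 N'.2 (congrArg Subtype.val h)
    · rintro ⟨g, hg⟩
      exact Subtype.ext (by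
        rw [gramMap, gramMap]
        simp only
        rw [hg, gram_mul_left _ (unitary_conjTranspose_mul g)])
  form N δ δ' hδ hδ' := unitaryReduction_form hΛ N.1 δ δ' N.2 hδ hδ'

/-! ### The common level set and the homeomorphism of the quotients. -/

section

variable {m n : ℕ} {r : Fin n → ℝ}

/-- The closed polygon of a matrix in the common level set. -/
def MatrixLevel.polygon (N : MatrixLevel m r) : ClosedPolygon m r :=
  ⟨edges N.1, fun j => edges_mem N.1 j (r j) (N.2.1 j), by rw [sum_edges, N.2.2]⟩

/-- The Gram matrix of a matrix in the common level set. -/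
def MatrixLevel.gram (hmn : m + 1 ≤ n) (N : MatrixLevel m r) : GrassLevel m r :=
  ⟨N.1ᴴ * N.1, gram_mem hmn N.1 N.2.2, fun j => gram_diag N.1 j (r j) (N.2.1 j)⟩

lemma MatrixLevel.exists_polygon_eq (hr : ∀ i, 0 < r i) (e : ClosedPolygon m r) :
    ∃ N : MatrixLevel m r, N.polygon = e := by
  obtain ⟨N, h1, h2⟩ := exists_edges_eq hr e.1 e.2.1
  exact ⟨⟨N, h1, by rw [← sum_edges, h2, e.2.2]⟩, Subtype.ext h2⟩

lemma MatrixLevel.exists_gram_eq (hmn : m + 1 ≤ n) (hr : ∀ i, 0 < r i) (X : GrassLevel m r) :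
    ∃ N : MatrixLevel m r, N.gram hmn = X := by
  obtain ⟨N, h1, h2⟩ := PolygonDuality.exists_gram_eq hmn (lam_pos hmn hr) X.1 X.2.1
  refine ⟨⟨N, fun j => norm_sq_of_gram_diag N j _ ?_, h1⟩, Subtype.ext h2⟩
  rw [h2, X.2.2]

lemma piOne_surjective (hr : ∀ i, 0 < r i) : Function.Surjective (piOne (m := m) (r := r)) := by
  intro p
  obtain ⟨e, rfl⟩ := Quotient.exists_rep p
  obtain ⟨N, rfl⟩ := MatrixLevel.exists_polygon_eq hr e
  exact ⟨N, rfl⟩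

lemma piTwo_surjective (hmn : m + 1 ≤ n) (hr : ∀ i, 0 < r i) :
    Function.Surjective (piTwo (m := m) (r := r) hmn) := by
  intro p
  obtain ⟨X, rfl⟩ := Quotient.exists_rep p
  obtain ⟨N, rfl⟩ := MatrixLevel.exists_gram_eq hmn hr X
  exact ⟨N, rfl⟩

lemma isQuotientMap_piOne (hr : ∀ i, 0 < r i) :
    Topology.IsQuotientMap (piOne (m := m) (r := r)) := by
  have hc : Continuous (MatrixLevel.polygon (m := m) (r := r)) :=
    Continuous.subtype_mk (continuous_edges.comp continuous_subtype_val) _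
  exact isQuotientMap_quotient_mk'.comp
    (hc.isClosedMap.isQuotientMap hc (MatrixLevel.exists_polygon_eq hr))

lemma isQuotientMap_piTwo (hmn : m + 1 ≤ n) (hr : ∀ i, 0 < r i) :
    Topology.IsQuotientMap (piTwo (m := m) (r := r) hmn) := by
  have hc : Continuous (MatrixLevel.gram (m := m) (r := r) hmn) :=
    Continuous.subtype_mk (continuous_gram.comp continuous_subtype_val) _
  exact isQuotientMap_quotient_mk'.comp
    (hc.isClosedMap.isQuotientMap hc (MatrixLevel.exists_gram_eq hmn hr))

lemma gram_mul_torusMat (N : RectMat m n) (t : Fin n → Circle) :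
    (N * torusMat t)ᴴ * (N * torusMat t) = conjBy (torusMat t⁻¹) (Nᴴ * N) := by
  have h : (torusMat t⁻¹) = (torusMat t)ᴴ := by
    simp only [torusMat, Matrix.diagonal_conjTranspose]
    congr 1
    ext i
    exact Circle.coe_inv_eq_conj (t i)
  rw [conjBy, h, Matrix.conjTranspose_mul, Matrix.conjTranspose_conjTranspose]
  simp only [Matrix.mul_assoc]

/-- Together with `piTwo_eq_iff`: the fibres of both maps are the orbits of `U(m+1) × T`, whichever
factor is divided out first. -/
lemma piOne_eq_iff (hr : ∀ i, 0 < r i) (N N' : MatrixLevel m r) :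
    piOne N = piOne N' ↔ ∃ (g : U (m + 1)) (t : Fin n → Circle),
      N'.1 = (g : Mat (m + 1)) * N.1 * torusMat t := by
  constructor
  · intro h
    obtain ⟨g, hg⟩ : ∃ g : U (m + 1), ∀ i, edges N'.1 i = conjBy g (edges N.1 i) :=
      Quotient.exact h
    obtain ⟨t, ht⟩ := exists_torus_of_edges_eq ((g : Mat (m + 1)) * N.1) N'.1 (fun j => by
      obtain ⟨i, hi⟩ := exists_entry_ne_zero hr N'.2.1 j
      by_contra! h0
      have h1 := hg j
      rw [← edges_mul_left] at h1
      have h2 := congrFun (congrFun h1 i) i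
      simp [edges, Matrix.vecMulVec_apply, h0] at h2
      exact hi h2) (funext fun i => by rw [hg i, edges_mul_left])
    exact ⟨g, t, ht⟩
  · rintro ⟨g, t, h⟩
    refine Quotient.sound ⟨g, fun i => ?_⟩
    change edges N'.1 i = conjBy g (edges N.1 i)
    rw [h, edges_mul_torusMat, edges_mul_left]

lemma piTwo_eq_iff (hmn : m + 1 ≤ n) (hr : ∀ i, 0 < r i) (N N' : MatrixLevel m r) :
    piTwo hmn N = piTwo hmn N' ↔ ∃ (g : U (m + 1)) (t : Fin n → Circle),
      N'.1 = (g : Mat (m + 1)) * N.1 * torusMat t := by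
  constructor
  · intro h
    obtain ⟨t, ht⟩ : ∃ t : Fin n → Circle,
        N'.1ᴴ * N'.1 = conjBy (torusMat t) (N.1ᴴ * N.1) := Quotient.exact h
    rw [← inv_inv t, ← gram_mul_torusMat] at ht
    obtain ⟨g, hg⟩ := exists_unitary_of_gram_eq (lam_pos hmn hr) (N.1 * torusMat t⁻¹) N'.1
      N'.2.2 ht.symm
    exact ⟨g, t⁻¹, by rw [hg, Matrix.mul_assoc]⟩
  · rintro ⟨g, t, h⟩
    refine Quotient.sound ⟨t⁻¹, ?_⟩
    change N'.1ᴴ * N'.1 = conjBy (torusMat t⁻¹) (N.1ᴴ * N.1)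
    rw [h, gram_mul_torusMat, gram_mul_left _ (unitary_conjTranspose_mul g)]

/-- Two quotient maps on one space with the same fibres: each factors continuously through the
other. -/
theorem exists_duality_homeomorph (hmn : m + 1 ≤ n) (hr : ∀ i, 0 < r i) :
    ∃ Φ : PolygonSpace m r ≃ₜ TorusQuotient m r, ∀ N, Φ (piOne N) = piTwo hmn N := by
  have q1 := isQuotientMap_piOne (m := m) hr
  have q2 := isQuotientMap_piTwo hmn hr
  have h12 : ∀ N N', piOne N = piOne N' → piTwo hmn N = piTwo hmn N' := fun N N' h => by
    rwa [piTwo_eq_iff hmn hr, ← piOne_eq_iff hr]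
  have h21 : ∀ N N', piTwo hmn N = piTwo hmn N' → piOne N = piOne N' := fun N N' h => by
    rwa [piOne_eq_iff hr, ← piTwo_eq_iff hmn hr]
  choose s hs using piOne_surjective (m := m) hr
  choose s' hs' using piTwo_surjective (m := m) hmn hr
  have e1 : ∀ N, piTwo hmn (s (piOne N)) = piTwo hmn N := fun N => h12 _ _ (hs _)
  have e2 : ∀ N, piOne (s' (piTwo hmn N)) = piOne N := fun N => h21 _ _ (hs' _)
  refine ⟨{ toFun := fun p => piTwo hmn (s p)
            invFun := fun x => piOne (s' x)
            left_inv := fun p => (e2 _).trans (hs p)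
            right_inv := fun x => (e1 _).trans (hs' x)
            continuous_toFun := ?_
            continuous_invFun := ?_ }, e1⟩
  · rw [q1.continuous_iff]
    exact q2.continuous.congr fun N => (e1 N).symm
  · rw [q2.continuous_iff]
    exact q1.continuous.congr fun N => (e2 N).symm

end


/-! ### The Hamiltonians -/

-- The characteristic polynomials differ by the factor `X ^ (b - a)`. As `M Mᴴ` is positive
-- semidefinite, the extra zeros may be appended at the end without spoiling the decreasing order,
-- and a sorted list is determined by its multiset.
open scoped ComplexOrder in
lemma eigenvalues₀_gram_append {a b : ℕ} (M : Matrix (Fin a) (Fin b) ℂ) (hab : a ≤ b) :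
    List.ofFn (Matrix.isHermitian_conjTranspose_mul_self M).eigenvalues₀
      = List.ofFn (Matrix.isHermitian_mul_conjTranspose_self M).eigenvalues₀
        ++ List.replicate (b - a) 0 := by
  have hA := Matrix.isHermitian_mul_conjTranspose_self M
  have hB := Matrix.isHermitian_conjTranspose_mul_self M
  have hpos : ∀ x ∈ List.ofFn hA.eigenvalues₀, 0 ≤ x := by
    intro x hx
    obtain ⟨i, rfl⟩ := (List.mem_ofFn' _ _).mp hx
    have h := (Matrix.posSemidef_self_mul_conjTranspose M).eigenvalues_nonneg
    have h2 := h (Fintype.equivOfCardEq (Fintype.card_fin _) i)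
    simpa [Matrix.IsHermitian.eigenvalues] using h2
  have hch := Matrix.charpoly_mul_comm_of_le Mᴴ M (by simpa using hab)
  rw [Fintype.card_fin, Fintype.card_fin] at hch
  have hroots : (Mᴴ * M).charpoly.roots
      = Multiset.replicate (b - a) 0 + (M * Mᴴ).charpoly.roots := by
    rw [hch, Polynomial.roots_mul (mul_ne_zero (pow_ne_zero _ Polynomial.X_ne_zero)
      (Matrix.charpoly_monic _).ne_zero), Polynomial.roots_pow, Polynomial.roots_X,
      Multiset.nsmul_singleton]
  have h1 := hA.sort_roots_charpoly_eq_eigenvalues₀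
  have h2 := hB.sort_roots_charpoly_eq_eigenvalues₀
  rw [← h2]
  refine List.Perm.eq_of_pairwise' (r := (· ≥ ·)) (Multiset.pairwise_sort _ _) ?_ ?_
  · rw [List.pairwise_append]
    refine ⟨?_, ?_, ?_⟩
    · rw [← h1]; exact Multiset.pairwise_sort _ _
    · exact List.pairwise_replicate.mpr (Or.inr le_rfl)
    · intro x hx y hy
      rw [List.eq_of_mem_replicate hy]
      exact hpos x hx
  · rw [← Multiset.coe_eq_coe, Multiset.sort_eq, hroots, ← h1]
    simp [add_comm, ← Multiset.coe_add, ← Multiset.coe_replicate]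

lemma nthEigenvalue_eq_getElem {k : ℕ} (A : Mat k) (hA : A.IsHermitian) (j : ℕ) (h1 : 1 ≤ j)
    (h2 : j ≤ k) : nthEigenvalue A j = (List.ofFn hA.eigenvalues₀)[j - 1]'(by simp; omega) := by
  rw [nthEigenvalue, dif_pos ⟨hA, h1, h2⟩, List.getElem_ofFn]

lemma nthEigenvalue_eq_zero {k : ℕ} (A : Mat k) (j : ℕ) (h : k < j) : nthEigenvalue A j = 0 := by
  rw [nthEigenvalue, dif_neg]
  omega

lemma nthEigenvalue_mul_conjTranspose_of_le {a b : ℕ} (M : Matrix (Fin a) (Fin b) ℂ) (hab : a ≤ b)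
    (j : ℕ) : nthEigenvalue (Mᴴ * M) j = nthEigenvalue (M * Mᴴ) j := by
  by_cases h1 : 1 ≤ j
  · by_cases h2 : j ≤ b
    · rw [nthEigenvalue_eq_getElem _ (Matrix.isHermitian_conjTranspose_mul_self M) j h1 h2]
      simp only [eigenvalues₀_gram_append M hab, List.getElem_append, List.getElem_replicate]
      split_ifs with h3
      · rw [List.length_ofFn, Fintype.card_fin] at h3
        rw [nthEigenvalue_eq_getElem _ (Matrix.isHermitian_mul_conjTranspose_self M) j h1
          (by omega)]
      -- For `a < j ≤ b` the left side is a genuine zero eigenvalue and the right side is the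
      -- default value of `nthEigenvalue`.
      · rw [List.length_ofFn, Fintype.card_fin] at h3
        rw [nthEigenvalue_eq_zero _ _ (by omega)]
    · rw [nthEigenvalue_eq_zero _ _ (by omega), nthEigenvalue_eq_zero _ _ (by omega)]
  · rw [nthEigenvalue, nthEigenvalue, dif_neg (fun h => h1 h.2.1), dif_neg (fun h => h1 h.2.1)]

/-- No range is imposed on `j`: past the size of the smaller product both sides are zero. The
vanishing of the surplus Hamiltonians comes from this. -/
lemma nthEigenvalue_mul_conjTranspose {a b : ℕ} (M : Matrix (Fin a) (Fin b) ℂ) (j : ℕ) :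
    nthEigenvalue (Mᴴ * M) j = nthEigenvalue (M * Mᴴ) j := by
  rcases le_total a b with hab | hab
  · exact nthEigenvalue_mul_conjTranspose_of_le M hab j
  · have := nthEigenvalue_mul_conjTranspose_of_le Mᴴ hab j
    rw [Matrix.conjTranspose_conjTranspose] at this
    exact this.symm

lemma nthEigenvalue_transpose {k : ℕ} (A : Mat k) (j : ℕ) :
    nthEigenvalue Aᵀ j = nthEigenvalue A j := by
  have hiff : Aᵀ.IsHermitian ↔ A.IsHermitian := Matrix.isHermitian_transpose_iff
  unfold nthEigenvalue
  by_cases h : A.IsHermitian ∧ 1 ≤ j ∧ j ≤ k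
  · have h' : Aᵀ.IsHermitian ∧ 1 ≤ j ∧ j ≤ k := ⟨hiff.mpr h.1, h.2⟩
    rw [dif_pos h, dif_pos h']
    have : h'.1.eigenvalues₀ = h.1.eigenvalues₀ := by
      simp_rw [← List.ofFn_inj, ← Matrix.IsHermitian.sort_roots_charpoly_eq_eigenvalues₀,
        Matrix.charpoly_transpose]
    rw [this]
  · have h' : ¬ (Aᵀ.IsHermitian ∧ 1 ≤ j ∧ j ≤ k) := by rw [hiff]; exact h
    rw [dif_neg h, dif_neg h']

/-- The first `k` columns of `N`. -/
def firstCols {m n : ℕ} (k : ℕ) (hk : k ≤ n) (N : RectMat m n) :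
    Matrix (Fin (m + 1)) (Fin k) ℂ :=
  N.submatrix id (Fin.castLE hk)

/-- With `diagonalA_edges` below: the Gel'fand–Tsetlin block and the polygon diagonal are the two
products of one matrix with its adjoint. -/
lemma block_gram {m n : ℕ} (k : ℕ) (hk : k ≤ n) (N : RectMat m n) :
    block k hk (Nᴴ * N) = (firstCols k hk N)ᴴ * firstCols k hk N := by
  ext a b
  simp [block, firstCols, Matrix.mul_apply]

lemma diagonalA_edges {m n : ℕ} (N : RectMat m n) (i : Fin n) :
    diagonalA (edges N) i
      = firstCols (i + 1) i.isLt N * (firstCols (i + 1) i.isLt N)ᴴ := by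
  have h : Finset.Iic i = Finset.univ.map (Fin.castLEEmb (n := i + 1) (m := n) i.isLt) := by
    ext l
    simp only [Finset.mem_Iic, Finset.mem_map, Finset.mem_univ, true_and, Fin.castLEEmb_apply]
    constructor
    · intro hl
      exact ⟨⟨l, Nat.lt_succ_of_le hl⟩, rfl⟩
    · rintro ⟨x, rfl⟩
      exact Nat.le_of_lt_succ x.2
  ext a b
  rw [diagonalA, h, Finset.sum_map]
  simp [firstCols, Matrix.mul_apply, Matrix.sum_apply, edges, Matrix.vecMulVec_apply]

section

variable {m n : ℕ} {r : Fin n → ℝ}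

lemma bending_piOne (N : MatrixLevel m r) (i : Fin n) (j : ℕ) :
    bending i j (piOne N)
      = nthEigenvalue (firstCols (i + 1) i.isLt N.1 * (firstCols (i + 1) i.isLt N.1)ᴴ) j := by
  rw [← diagonalA_edges]
  rfl

lemma gelfandTsetlin_piTwo (hmn : m + 1 ≤ n) (N : MatrixLevel m r) (i : Fin n) (j : ℕ) :
    gelfandTsetlin (i + 1) i.isLt j (piTwo hmn N)
      = nthEigenvalue (firstCols (i + 1) i.isLt N.1 * (firstCols (i + 1) i.isLt N.1)ᴴ) j := by
  rw [← nthEigenvalue_mul_conjTranspose, ← block_gram]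
  rfl

/-- Conjugating the entries of `N` transposes `M Mᴴ` and so leaves its spectrum unchanged. -/
lemma gelfandTsetlin_piTwo_conj (hmn : m + 1 ≤ n) (N : MatrixLevel m r) (i : Fin n) (j : ℕ) :
    gelfandTsetlin (i + 1) i.isLt j (piTwo hmn N.conj)
      = nthEigenvalue (firstCols (i + 1) i.isLt N.1 * (firstCols (i + 1) i.isLt N.1)ᴴ) j := by
  rw [gelfandTsetlin_piTwo, ← nthEigenvalue_transpose]
  congr 1
  ext a b
  simp [firstCols, MatrixLevel.conj, Matrix.mul_apply, mul_comm]

/-- The two vanishing statements do not involve `Φ`: passing to the other product makes the index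
exceed the size of the matrix. -/
lemma pullsBackToBending (hmn : m + 1 ≤ n) (hr : ∀ i, 0 < r i)
    (Φ : PolygonSpace m r → TorusQuotient m r)
    (h : ∀ N (i : Fin n) j, gelfandTsetlin (i + 1) i.isLt j (Φ (piOne N)) = bending i j (piOne N)) :
    PullsBackToBending Φ := by
  refine ⟨fun i j _ _ _ => funext fun p => ?_, fun i j hj _ => funext fun x => ?_,
    fun i j hj _ => funext fun p => ?_⟩
  · obtain ⟨N, rfl⟩ := piOne_surjective hr p
    exact h N i j
  · obtain ⟨N, rfl⟩ := piTwo_surjective hmn hr x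
    rw [gelfandTsetlin_piTwo]
    exact nthEigenvalue_eq_zero _ _ hj
  · obtain ⟨N, rfl⟩ := piOne_surjective hr p
    rw [bending_piOne, ← nthEigenvalue_mul_conjTranspose]
    exact nthEigenvalue_eq_zero _ _ hj

end


/-! ### The reduced symplectic forms -/

lemma edges_conjTranspose {m n : ℕ} (N : RectMat m n) (j : Fin n) : (edges N j)ᴴ = edges N j := by
  ext a b
  simp [edges, Matrix.vecMulVec_apply, mul_comm]

lemma trace_edges {m n : ℕ} (N : RectMat m n) (j : Fin n) :
    (edges N j).trace = ((∑ i, ‖N i j‖ ^ 2 : ℝ) : ℂ) := by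
  push_cast
  simp only [edges, Matrix.trace, Matrix.diag_apply, Matrix.vecMulVec_apply, Pi.star_apply]
  exact Finset.sum_congr rfl fun i _ => Complex.mul_conj' _

lemma edges_mul_edges {m n : ℕ} (N : RectMat m n) (i j : Fin n) (h : (Nᴴ * N) i j = 0) :
    edges N i * edges N j = 0 := by
  have h2 : (star fun k => N k i) ⬝ᵥ (fun k => N k j) = 0 := by
    rw [← h, Matrix.mul_apply]
    rfl
  rw [edges, edges, Matrix.vecMulVec_mul_vecMulVec, h2]
  simp

section

variable {m n : ℕ} {r : Fin n → ℝ}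

/-- If the columns split into two nonempty mutually orthogonal groups, then the polygon
is decomposable. -/
lemma isDecomposable_of_orthogonal (hmn : m + 1 ≤ n) (hr : ∀ i, 0 < r i) (N : MatrixLevel m r)
    (I : Finset (Fin n)) (h1 : I.Nonempty) (h2 : Iᶜ.Nonempty)
    (h : ∀ i ∈ I, ∀ j ∉ I, (N.1ᴴ * N.1) j i = 0) : IsDecomposable N.polygon := by
  have hΛ : (lam m r : ℂ) ≠ 0 := by exact_mod_cast (lam_pos hmn hr).ne'
  set A := ∑ i ∈ I, edges N.1 i with hA
  set B := ∑ i ∈ Iᶜ, edges N.1 i with hB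
  have hAB : A + B = (lam m r : ℂ) • 1 := by
    rw [hA, hB, Finset.sum_add_sum_compl, sum_edges, N.2.2]
  have h' : ∀ i ∈ I, ∀ j ∉ I, (N.1ᴴ * N.1) i j = 0 := fun i hi j hj => by
    rw [← (Matrix.isHermitian_conjTranspose_mul_self N.1).apply, h i hi j hj, star_zero]
  have hAj : ∀ j ∉ I, A * edges N.1 j = 0 ∧ edges N.1 j * A = 0 := fun j hj => by
    rw [hA, Finset.sum_mul, Finset.mul_sum]
    exact ⟨Finset.sum_eq_zero fun i hi => edges_mul_edges _ _ _ (h' i hi j hj),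
      Finset.sum_eq_zero fun i hi => edges_mul_edges _ _ _ (h i hi j hj)⟩
  have hBi : ∀ i ∈ I, B * edges N.1 i = 0 ∧ edges N.1 i * B = 0 := fun i hi => by
    rw [hB, Finset.sum_mul, Finset.mul_sum]
    exact ⟨Finset.sum_eq_zero fun j hj =>
        edges_mul_edges _ _ _ (h i hi j (Finset.mem_compl.mp hj)),
      Finset.sum_eq_zero fun j hj => edges_mul_edges _ _ _ (h' i hi j (Finset.mem_compl.mp hj))⟩
  -- `B` kills the edges of `I` and `A + B = Λ I`, so `A` acts on them as the scalar `Λ`. Hence `Λ⁻¹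
  -- A` is the projection sought.
  have hAi : ∀ i ∈ I, A * edges N.1 i = (lam m r : ℂ) • edges N.1 i ∧
      edges N.1 i * A = (lam m r : ℂ) • edges N.1 i := fun i hi => by
    rw [eq_sub_of_add_eq hAB, sub_mul, mul_sub, (hBi i hi).1, (hBi i hi).2]
    simp
  -- The trace is a nonempty sum of the positive `r i`. Applied to `I` and to its complement, this
  -- excludes the projections `0` and `1`.
  have htr : ∀ J : Finset (Fin n), J.Nonempty → ∑ i ∈ J, edges N.1 i ≠ 0 := by
    intro J hJ h0
    have h3 := congrArg Matrix.trace h0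
    rw [Matrix.trace_sum, Matrix.trace_zero] at h3
    simp only [trace_edges, N.2.1] at h3
    have h4 : (∑ i ∈ J, r i) = 0 := by exact_mod_cast h3
    exact (Finset.sum_pos (fun i _ => hr i) hJ).ne' h4
  refine ⟨(lam m r : ℂ)⁻¹ • A, ?_, ?_, ?_, ?_, I, ?_, ?_⟩
  · rw [Matrix.conjTranspose_smul, hA, Matrix.conjTranspose_sum, star_inv₀, Complex.star_def,
      Complex.conj_ofReal]
    simp only [edges_conjTranspose]
  · have hAA : A * A = (lam m r : ℂ) • A := by
      conv_lhs => enter [2]; rw [hA]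
      rw [Finset.mul_sum, Finset.sum_congr rfl fun i hi => (hAi i hi).1, ← Finset.smul_sum]
    rw [smul_mul_smul_comm, hAA, smul_smul, mul_assoc, inv_mul_cancel₀ hΛ, mul_one]
  · exact smul_ne_zero (inv_ne_zero hΛ) (htr I h1)
  · intro h3
    apply htr _ h2
    have h4 : A = (lam m r : ℂ) • 1 := by
      rw [← h3, smul_smul, mul_inv_cancel₀ hΛ, one_smul]
    rw [h4] at hAB
    exact left_eq_add.mp hAB.symm
  · intro i hi
    change _ * edges N.1 i * _ = edges N.1 i
    rw [smul_mul_assoc, (hAi i hi).1, smul_smul, inv_mul_cancel₀ hΛ, one_smul, mul_smul_comm,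
      (hAi i hi).2, smul_smul, inv_mul_cancel₀ hΛ, one_smul]
  · intro j hj
    change _ * edges N.1 j * _ = edges N.1 j
    rw [sub_mul, one_mul, smul_mul_assoc, (hAj j hj).1, smul_zero, sub_zero, mul_sub, mul_one,
      mul_smul_comm, (hAj j hj).2, smul_zero, sub_zero]

end

/-! ### Common lifts of curves and comparison of the reduced forms. -/

section smooth

attribute [local instance] Matrix.normedAddCommGroup Matrix.normedSpace

lemma hasDerivAt_matrix {a b : Type*} [Fintype a] [Fintype b] {f : ℝ → Matrix a b ℂ}
    {f' : Matrix a b ℂ} {t : ℝ} :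
    HasDerivAt f f' t ↔ ∀ i j, HasDerivAt (fun t => f t i j) (f' i j) t :=
  hasDerivAt_pi.trans (forall_congr' fun _ => hasDerivAt_pi)

lemma HasDerivAt.edges {m n : ℕ} {N : ℝ → RectMat m n} {δ : RectMat m n} {t : ℝ}
    (h : HasDerivAt N δ t) :
    HasDerivAt (fun t => PolygonDuality.edges (N t)) (dEdges (N t) δ) t := by
  refine hasDerivAt_pi.mpr fun j => hasDerivAt_matrix.mpr fun a b => ?_
  have := (hasDerivAt_matrix.mp h a j).mul (hasDerivAt_matrix.mp h b j).star
  exact this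

lemma HasDerivAt.matrix_mul {a b c : Type*} [Fintype a] [Fintype b] [Fintype c]
    {f : ℝ → Matrix a b ℂ} {g : ℝ → Matrix b c ℂ} {f' : Matrix a b ℂ} {g' : Matrix b c ℂ} {t : ℝ}
    (hf : HasDerivAt f f' t) (hg : HasDerivAt g g' t) :
    HasDerivAt (fun t => f t * g t) (f' * g t + f t * g') t := by
  refine hasDerivAt_matrix.mpr fun i k => ?_
  simp only [Matrix.mul_apply, Matrix.add_apply, ← Finset.sum_add_distrib]
  exact HasDerivAt.fun_sum fun j _ => (hasDerivAt_matrix.mp hf i j).mul (hasDerivAt_matrix.mp hg j k)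

lemma HasDerivAt.conjTranspose {a b : Type*} [Fintype a] [Fintype b]
    {f : ℝ → Matrix a b ℂ} {f' : Matrix a b ℂ} {t : ℝ}
    (hf : HasDerivAt f f' t) : HasDerivAt (fun t => (f t)ᴴ) f'ᴴ t :=
  hasDerivAt_matrix.mpr fun i j => (hasDerivAt_matrix.mp hf j i).star

lemma HasDerivAt.gram {m n : ℕ} {N : ℝ → RectMat m n} {δ : RectMat m n} {t : ℝ}
    (h : HasDerivAt N δ t) :
    HasDerivAt (fun t => (N t)ᴴ * N t) (δᴴ * N t + (N t)ᴴ * δ) t :=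
  HasDerivAt.matrix_mul (HasDerivAt.conjTranspose h) h

variable {m n : ℕ} {r : Fin n → ℝ}

lemma sum_dEdges (N δ : RectMat m n) : ∑ j, dEdges N δ j = δ * Nᴴ + N * δᴴ := by
  ext a b
  simp [dEdges, Matrix.sum_apply, Matrix.vecMulVec_apply, Matrix.mul_apply,
    Finset.sum_add_distrib]

/-- Velocities of curves in the two level sets that have a common lift. -/
lemma deriv_of_lift (N : MatrixLevel m r) (c : ℝ → ClosedPolygon m r) (d : ℝ → GrassLevel m r)
    (M : ℝ → RectMat m n) (δ : RectMat m n) (hM : HasDerivAt M δ 0) (h0 : M 0 = N.1)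
    (hc : ∀ t, edges (M t) = (c t).1) (hd : ∀ t, (M t)ᴴ * M t = (d t).1) :
    deriv (fun t => (c t).1) 0 = dEdges N.1 δ ∧
      deriv (fun t => (d t).1) 0 = δᴴ * N.1 + N.1ᴴ * δ ∧
      (∀ j, (∑ i, star (N.1 i j) * δ i j).re = 0) ∧ δ * N.1ᴴ + N.1 * δᴴ = 0 := by
  have h1 := HasDerivAt.edges hM
  have h2 := HasDerivAt.gram hM
  -- The sum of the edges and the diagonal of the Gram matrix are constant along the curves;
  -- differentiating them gives the two tangency conditions on `δ`.
  have h3 : HasDerivAt (fun t => ∑ j, edges (M t) j) (∑ j, dEdges (M 0) δ j) 0 :=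
    HasDerivAt.fun_sum fun j _ => hasDerivAt_pi.mp h1 j
  rw [h0] at h1 h2 h3
  simp only [hc, hd, (c _).2.2, sum_dEdges] at h1 h2 h3
  refine ⟨h1.deriv, h2.deriv, fun j => ?_, h3.unique (hasDerivAt_const _ _)⟩
  have h4 := hasDerivAt_matrix.mp h2 j j
  simp only [(d _).2.2] at h4
  have h5 := congrArg Complex.re (h4.unique (hasDerivAt_const _ _))
  rw [Matrix.add_apply, Matrix.mul_apply, Matrix.mul_apply, Complex.add_re] at h5
  have h6 : (∑ i, δᴴ j i * N.1 i j) = star (∑ i, star (N.1 i j) * δ i j) := by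
    rw [star_sum]
    exact Finset.sum_congr rfl fun i _ => by
      rw [star_mul', star_star, mul_comm, Matrix.conjTranspose_apply]
  have h7 : (star (∑ i, star (N.1 i j) * δ i j)).re = (∑ i, star (N.1 i j) * δ i j).re := rfl
  have h8 : (∑ i, N.1ᴴ j i * δ i j) = ∑ i, star (N.1 i j) * δ i j := rfl
  rw [h6, h7, h8, Complex.zero_re] at h5
  linarith

/-- Curves in the two level sets with corresponding classes, starting at an indecomposable
polygon, have a common lift that is differentiable at the starting point. -/
lemma exists_lift (hmn : m + 1 ≤ n) (hr : ∀ i, 0 < r i) (N : MatrixLevel m r)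
    (hN : ¬ IsDecomposable N.polygon) (c : ℝ → ClosedPolygon m r) (d : ℝ → GrassLevel m r)
    (hc : DifferentiableAt ℝ (fun t => (c t).1) 0) (hd : DifferentiableAt ℝ (fun t => (d t).1) 0)
    (hc0 : c 0 = N.polygon) (hd0 : d 0 = N.gram hmn)
    (h : ∀ t, ∃ M : MatrixLevel m r, M.polygon = c t ∧ M.gram hmn = d t) :
    ∃ (M : ℝ → RectMat m n) (δ : RectMat m n), HasDerivAt M δ 0 ∧ M 0 = N.1 ∧
      (∀ t, edges (M t) = (c t).1) ∧ ∀ t, (M t)ᴴ * M t = (d t).1 := by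
  have hcd : ∀ j a b, DifferentiableAt ℝ (fun t => (c t).1 j a b) 0 := fun j a b =>
    (hasDerivAt_matrix.mp (hasDerivAt_pi.mp hc.hasDerivAt j) a b).differentiableAt
  have hdd : ∀ a b, DifferentiableAt ℝ (fun t => (d t).1 a b) 0 := fun a b =>
    (hasDerivAt_matrix.mp hd.hasDerivAt a b).differentiableAt
  -- These lifts are chosen point by point, without any continuity in `t`. Near an indecomposable
  -- polygon the remaining freedom is one common phase.
  choose M' hMc hMd using h
  have hMc' : ∀ t j a b, (c t).1 j a b = (M' t).1 a j * star ((M' t).1 b j) := fun t j a b => by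
    rw [← hMc t]; rfl
  let j0 : Fin n := ⟨0, by omega⟩
  obtain ⟨i0, hi0⟩ := exists_entry_ne_zero hr N.2.1 j0
  -- normalisation of the phase
  let w : ℂ := N.1 i0 j0 / ‖N.1 i0 j0‖
  have hw : ‖w‖ = 1 := by simp [w, hi0]
  -- Rotates the entry `(i0, j0)` to the phase it has in `N`. The value `1` is harmless, since that
  -- entry is nonzero for `t` near `0`.
  let z : ℝ → ℂ := fun t => if (M' t).1 i0 j0 = 0 then 1 else
    star ((M' t).1 i0 j0) / ‖(M' t).1 i0 j0‖ * w
  have hz : ∀ t, z t * star (z t) = 1 := by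
    intro t
    have : ‖z t‖ = 1 := by
      simp only [z]
      split_ifs with h
      · simp
      · simp [hw, h]
    rw [Complex.star_def, Complex.mul_conj', this]
    simp
  let M : ℝ → RectMat m n := fun t => z t • (M' t).1
  have hM1 : ∀ t, edges (M t) = (c t).1 := fun t => by
    ext j a b
    rw [hMc']
    simp only [edges, M, Matrix.vecMulVec_apply, Matrix.smul_apply, Pi.star_apply, smul_eq_mul,
      star_mul']
    linear_combination ((M' t).1 a j * star ((M' t).1 b j)) * hz t
  have hM2 : ∀ t, (M t)ᴴ * M t = (d t).1 := fun t => by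
    rw [← hMd t]
    simp only [M, Matrix.conjTranspose_smul, Matrix.smul_mul, Matrix.mul_smul, smul_smul]
    rw [hz t, one_smul]
    rfl
  have hM1' : ∀ t j a b, (c t).1 j a b = M t a j * star (M t b j) := fun t j a b => by
    rw [← hM1 t]; rfl
  have hc0' : ∀ j a b, (c 0).1 j a b = N.1 a j * star (N.1 b j) := fun j a b => by
    rw [hc0]; rfl
  let Good : Fin n → Prop := fun j =>
    ∀ i, DifferentiableAt ℝ (fun t => M t i j) 0 ∧ M 0 i j = N.1 i j
  -- With its entry in row `i0` of fixed phase `w`, column `j0` is a smooth expression in its own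
  -- edge: column `i0` of the edge, divided by the square root of a positive diagonal entry, times
  -- `w`.
  have hgood0 : Good j0 := by
    have hre : ∀ t, ((c t).1 j0 i0 i0).re = ‖(M' t).1 i0 j0‖ ^ 2 := fun t => by
      rw [hMc', Complex.star_def, Complex.mul_conj']
      norm_cast
    have hre0 : ((c 0).1 j0 i0 i0).re = ‖N.1 i0 j0‖ ^ 2 := by
      rw [hc0', Complex.star_def, Complex.mul_conj']
      norm_cast
    have hpos : 0 < ((c 0).1 j0 i0 i0).re := by rw [hre0]; positivity
    have hdre : DifferentiableAt ℝ (fun t => ((c t).1 j0 i0 i0).re) 0 :=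
      Complex.reCLM.differentiableAt.comp 0 (hcd j0 i0 i0)
    have hform : ∀ t i, 0 < ((c t).1 j0 i0 i0).re →
        M t i j0 = (c t).1 j0 i i0 / (Real.sqrt ((c t).1 j0 i0 i0).re : ℂ) * w := by
      intro t i ht
      have hne : (M' t).1 i0 j0 ≠ 0 := fun h => by
        rw [hre t, h] at ht; simp at ht
      rw [hre t, Real.sqrt_sq (norm_nonneg _), hMc']
      simp only [M, z, if_neg hne, Matrix.smul_apply, smul_eq_mul]
      ring
    have hev : ∀ᶠ t in nhds (0 : ℝ), 0 < ((c t).1 j0 i0 i0).re :=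
      hdre.continuousAt.eventually (lt_mem_nhds hpos)
    intro i
    constructor
    · have h2 : DifferentiableAt ℝ (fun t => (Real.sqrt ((c t).1 j0 i0 i0).re : ℂ)) 0 :=
        Complex.ofRealCLM.differentiableAt.comp (0 : ℝ) (hdre.sqrt hpos.ne')
      have h3 : DifferentiableAt ℝ (fun t => (c t).1 j0 i i0 /
          (Real.sqrt ((c t).1 j0 i0 i0).re : ℂ) * w) 0 :=
        ((hcd j0 i i0).div h2 (by exact_mod_cast (Real.sqrt_pos.mpr hpos).ne')).mul_const w
      exact h3.congr_of_eventuallyEq (hev.mono fun t ht => hform t i ht)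
    · rw [hform 0 i hpos, hre0, Real.sqrt_sq (norm_nonneg _), hc0']
      have hn : (‖N.1 i0 j0‖ : ℂ) ≠ 0 := by exact_mod_cast norm_ne_zero_iff.mpr hi0
      have h4 : star (N.1 i0 j0) * N.1 i0 j0 = (‖N.1 i0 j0‖ : ℂ) ^ 2 := Complex.conj_mul' _
      simp only [w]
      field_simp
      linear_combination N.1 i j0 * h4
  -- From `C_j (C_jᴴ C_i) = (C_j C_jᴴ) C_i`, column `j` is the edge `c_j` applied to column `i`,
  -- divided by a Gram entry that is nonzero near `t = 0`.
  have hstep : ∀ i j, Good i → (N.1ᴴ * N.1) j i ≠ 0 → Good j := by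
    intro i j hi hij
    have hd0' : (d 0).1 j i = (N.1ᴴ * N.1) j i := by rw [hd0]; rfl
    have hform : ∀ t a, M t a j * (d t).1 j i = ∑ b, (c t).1 j a b * M t b i := by
      intro t a
      rw [← hM2 t, Matrix.mul_apply, Finset.mul_sum]
      refine Finset.sum_congr rfl fun b _ => ?_
      rw [hM1', Matrix.conjTranspose_apply, mul_assoc]
    have hev : ∀ᶠ t in nhds (0 : ℝ), (d t).1 j i ≠ 0 :=
      (hdd j i).continuousAt.eventually_ne (by rwa [hd0'])
    intro a
    constructor
    · have h2 : DifferentiableAt ℝ (fun t => (∑ b, (c t).1 j a b * M t b i) / (d t).1 j i) 0 :=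
        (DifferentiableAt.fun_sum fun b _ => (hcd j a b).mul (hi b).1).div (hdd j i)
          (by rwa [hd0'])
      exact h2.congr_of_eventuallyEq (hev.mono fun t ht => by
        simp only
        rw [eq_div_iff ht, hform])
    · apply mul_right_cancel₀ hij
      rw [← hd0', hform, hd0', Matrix.mul_apply, Finset.mul_sum]
      refine Finset.sum_congr rfl fun b _ => ?_
      rw [hc0', (hi b).2, Matrix.conjTranspose_apply, mul_assoc]
  -- Otherwise the good columns would be orthogonal to all the others, and the polygon would
  -- decompose.
  have hall : ∀ j, Good j := by
    classical
    by_contra! hne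
    obtain ⟨j, hj⟩ := hne
    refine hN (isDecomposable_of_orthogonal hmn hr N (Finset.univ.filter Good) ⟨j0, by simpa⟩
      ⟨j, by simpa⟩ fun i hi k hk => ?_)
    by_contra h0
    rw [Finset.mem_filter] at hi hk
    exact hk ⟨Finset.mem_univ _, hstep i k hi.2 h0⟩
  refine ⟨M, Matrix.of fun i j => deriv (fun t => M t i j) 0, ?_, ?_, hM1, hM2⟩
  · exact hasDerivAt_matrix.mpr fun i j => (hall j i).1.hasDerivAt
  · ext i j
    exact (hall j i).2

/-- Corresponding classes have representatives coming from a common matrix. -/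
lemma exists_common_lift (hmn : m + 1 ≤ n) (hr : ∀ i, 0 < r i)
    {Φ : PolygonSpace m r ≃ₜ TorusQuotient m r} (hΦ : ∀ N, Φ (piOne N) = piTwo hmn N)
    (e : ClosedPolygon m r) (X : GrassLevel m r) (h : Φ (Quotient.mk _ e) = Quotient.mk _ X) :
    ∃ N : MatrixLevel m r, N.polygon = e ∧ N.gram hmn = X := by
  obtain ⟨N, rfl⟩ := MatrixLevel.exists_polygon_eq hr e
  obtain ⟨t, ht⟩ : ∃ t : Fin n → Circle, X.1 = conjBy (torusMat t) (N.1ᴴ * N.1) :=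
    Quotient.exact ((hΦ N).symm.trans h)
  rw [← inv_inv t, ← gram_mul_torusMat] at ht
  have h1 : edges (N.1 * torusMat t⁻¹) = edges N.1 := edges_mul_torusMat _ _
  refine ⟨⟨N.1 * torusMat t⁻¹, fun j => norm_sq_of_gram_diag _ j _ ?_, ?_⟩, Subtype.ext h1,
    Subtype.ext ht.symm⟩
  · rw [← ht, X.2.2]
  · rw [← sum_edges, h1, sum_edges, N.2.2]

/-- Both sides equal the matrix form on the velocities `δ`, `δ'` of the common lifts, by the two
reduction formulas. -/
lemma reduced_form_eq (hmn : m + 1 ≤ n) (hr : ∀ i, 0 < r i)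
    {Φ : PolygonSpace m r ≃ₜ TorusQuotient m r} (hΦ : ∀ N, Φ (piOne N) = piTwo hmn N)
    (e : ClosedPolygon m r) (he : ¬ IsDecomposable e) (X : GrassLevel m r)
    (c c' : ℝ → ClosedPolygon m r) (d d' : ℝ → GrassLevel m r)
    (hc : ContDiff ℝ ∞ (fun t => (c t).1)) (hc' : ContDiff ℝ ∞ (fun t => (c' t).1))
    (hd : ContDiff ℝ ∞ (fun t => (d t).1)) (hd' : ContDiff ℝ ∞ (fun t => (d' t).1))
    (hc0 : c 0 = e) (hc0' : c' 0 = e) (hd0 : d 0 = X) (hd0' : d' 0 = X)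
    (h : ∀ t, Φ (Quotient.mk _ (c t)) = Quotient.mk _ (d t))
    (h' : ∀ t, Φ (Quotient.mk _ (c' t)) = Quotient.mk _ (d' t)) :
    ∑ i, kkForm (e.1 i) (deriv (fun t => (c t).1) 0 i) (deriv (fun t => (c' t).1) 0 i) =
      -1 * kkForm X.1 (deriv (fun t => (d t).1) 0) (deriv (fun t => (d' t).1) 0) := by
  obtain ⟨N, rfl, rfl⟩ := exists_common_lift hmn hr hΦ e X (by rw [← hc0, ← hd0, h])
  have hinf : (∞ : WithTop ℕ∞) ≠ 0 := by simp
  obtain ⟨M, δ, hM, hM0, hMc, hMd⟩ := exists_lift hmn hr N he c d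
    (hc.differentiable hinf).differentiableAt (hd.differentiable hinf).differentiableAt hc0 hd0
    fun t => exists_common_lift hmn hr hΦ _ _ (h t)
  obtain ⟨M', δ', hM', hM0', hMc', hMd'⟩ := exists_lift hmn hr N he c' d'
    (hc'.differentiable hinf).differentiableAt (hd'.differentiable hinf).differentiableAt hc0' hd0'
    fun t => exists_common_lift hmn hr hΦ _ _ (h' t)
  obtain ⟨e1, e2, e3, e4⟩ := deriv_of_lift N c d M δ hM hM0 hMc hMd
  obtain ⟨f1, f2, f3, f4⟩ := deriv_of_lift N c' d' M' δ' hM' hM0' hMc' hMd'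
  rw [e1, e2, f1, f2, neg_one_mul]
  exact (torusReduction_form hr ⟨N.1, N.2.1⟩ δ δ' e3 f3).trans
    (unitaryReduction_form (lam_pos hmn hr) N.1 δ δ' N.2.2 e4 f4).symm

end smooth


/-! ### Poisson brackets -/

section smooth

attribute [local instance] Matrix.normedAddCommGroup Matrix.normedSpace

lemma contDiff_matrix {E : Type*} [NormedAddCommGroup E] [NormedSpace ℝ E] {a b : Type*}
    [Fintype a] [Fintype b] {k : WithTop ℕ∞} {f : E → Matrix a b ℂ} :
    ContDiff ℝ k f ↔ ∀ i j, ContDiff ℝ k fun x => f x i j :=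
  contDiff_pi.trans (forall_congr' fun _ => contDiff_pi)

lemma contDiffAt_matrix {E : Type*} [NormedAddCommGroup E] [NormedSpace ℝ E] {a b : Type*}
    [Fintype a] [Fintype b] {k : WithTop ℕ∞} {f : E → Matrix a b ℂ} {x : E} :
    ContDiffAt ℝ k f x ↔ ∀ i j, ContDiffAt ℝ k (fun x => f x i j) x :=
  contDiffAt_pi.trans (forall_congr' fun _ => contDiffAt_pi)

lemma ContDiffAt.matrix_mul {E : Type*} [NormedAddCommGroup E] [NormedSpace ℝ E]
    {a b c : Type*} [Fintype a] [Fintype b] [Fintype c] {k : WithTop ℕ∞} {x : E}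
    {f : E → Matrix a b ℂ} {g : E → Matrix b c ℂ} (hf : ContDiffAt ℝ k f x)
    (hg : ContDiffAt ℝ k g x) : ContDiffAt ℝ k (fun x => f x * g x) x := by
  refine contDiffAt_matrix.mpr fun i l => ?_
  simp only [Matrix.mul_apply]
  exact ContDiffAt.sum fun j _ => (contDiffAt_matrix.mp hf i j).mul (contDiffAt_matrix.mp hg j l)

lemma ContDiff.matrix_mul {E : Type*} [NormedAddCommGroup E] [NormedSpace ℝ E]
    {a b c : Type*} [Fintype a] [Fintype b] [Fintype c] {k : WithTop ℕ∞}
    {f : E → Matrix a b ℂ} {g : E → Matrix b c ℂ} (hf : ContDiff ℝ k f)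
    (hg : ContDiff ℝ k g) : ContDiff ℝ k (fun x => f x * g x) :=
  contDiff_iff_contDiffAt.mpr fun _ => ContDiffAt.matrix_mul hf.contDiffAt hg.contDiffAt

lemma contDiff_star {k : WithTop ℕ∞} : ContDiff ℝ k (star : ℂ → ℂ) :=
  Complex.conjCLE.contDiff

lemma contDiff_entry {a b : Type*} [Fintype a] [Fintype b] {k : WithTop ℕ∞} (i : a) (j : b) :
    ContDiff ℝ k fun N : Matrix a b ℂ => N i j :=
  contDiff_matrix.mp contDiff_id i j

lemma contDiff_conjTranspose {a b : Type*} [Fintype a] [Fintype b] {k : WithTop ℕ∞} :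
    ContDiff ℝ k fun N : Matrix a b ℂ => Nᴴ :=
  contDiff_matrix.mpr fun i j => contDiff_star.comp (contDiff_entry j i)

lemma contDiff_gram {m n : ℕ} {k : WithTop ℕ∞} : ContDiff ℝ k fun N : RectMat m n => Nᴴ * N :=
  ContDiff.matrix_mul contDiff_conjTranspose contDiff_id

lemma contDiff_edges {m n : ℕ} {k : WithTop ℕ∞} : ContDiff ℝ k fun N : RectMat m n => edges N :=
  contDiff_pi.mpr fun j => contDiff_matrix.mpr fun a b =>
    (contDiff_entry a j).mul (contDiff_star.comp (contDiff_entry b j))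

lemma contDiff_grad {E : Type*} [NormedAddCommGroup E] [NormedSpace ℝ E] {k : ℕ}
    {l : WithTop ℕ∞} (L : E → Mat k →ₗ[ℝ] ℝ) (hL : ∀ Y, ContDiff ℝ l fun x => L x Y) :
    ContDiff ℝ l fun x => grad (L x) := by
  refine contDiff_matrix.mpr fun a b => ?_
  simp only [grad, Matrix.smul_apply, Matrix.of_apply, smul_eq_mul]
  have h : ∀ Y, ContDiff ℝ l fun x => ((L x Y : ℝ) : ℂ) := fun Y =>
    Complex.ofRealCLM.contDiff.comp (hL Y)
  exact contDiff_const.mul (contDiff_const.mul ((h _).add (contDiff_const.mul (h _))))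

variable {m n : ℕ} {r : Fin n → ℝ}

/-- A vector field whose flow preserves the momentum maps has integral curves in the common
level set. -/
lemma exists_integral_curve (V : RectMat m n → RectMat m n) (hV : ContDiff ℝ 1 V)
    (h1 : ∀ M, V M * Mᴴ + M * (V M)ᴴ = 0) (h2 : ∀ M j, ((V M)ᴴ * M + Mᴴ * V M) j j = 0)
    (N : MatrixLevel m r) :
    ∃ α : ℝ → RectMat m n, α 0 = N.1 ∧ HasDerivAt α (V N.1) 0 ∧
      ∀ᶠ t in nhds 0, ∃ M : MatrixLevel m r, M.1 = α t := by
  have : CompleteSpace (RectMat m n) := FiniteDimensional.complete ℝ _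
  obtain ⟨α, h0, ε, hε, hα⟩ := ContDiffAt.exists_forall_mem_closedBall_exists_eq_forall_mem_Ioo_hasDerivAt₀
    (hV.contDiffAt (x := N.1)) 0
  rw [zero_sub, zero_add] at hα
  have hmem : (0 : ℝ) ∈ Set.Ioo (-ε) ε := ⟨by linarith, hε⟩
  have hconst : ∀ {G : Type} [NormedAddCommGroup G] [NormedSpace ℝ G] (Q : ℝ → G),
      (∀ t ∈ Set.Ioo (-ε) ε, HasDerivAt Q 0 t) → ∀ t ∈ Set.Ioo (-ε) ε, Q t = Q 0 := by
    intro G _ _ Q hQ t ht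
    exact isOpen_Ioo.is_const_of_deriv_eq_zero isPreconnected_Ioo
      (fun s hs => (hQ s hs).differentiableAt.differentiableWithinAt)
      (fun s hs => (hQ s hs).deriv) ht hmem
  refine ⟨α, h0, h0 ▸ hα 0 hmem, ?_⟩
  filter_upwards [isOpen_Ioo.mem_nhds hmem] with t ht
  -- The hypotheses on `V` say that both momentum maps have zero derivative along every integral
  -- curve, so they are constant on the interval.
  have e1 : α t * (α t)ᴴ = α 0 * (α 0)ᴴ := by
    refine hconst (fun t => α t * (α t)ᴴ) (fun s hs => ?_) t ht
    have := HasDerivAt.matrix_mul (hα s hs) (HasDerivAt.conjTranspose (hα s hs))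
    rwa [h1] at this
  have e2 : ∀ j, ((α t)ᴴ * α t) j j = ((α 0)ᴴ * α 0) j j := by
    intro j
    refine hconst (fun t => ((α t)ᴴ * α t) j j) (fun s hs => ?_) t ht
    have := hasDerivAt_matrix.mp (HasDerivAt.gram (hα s hs)) j j
    rwa [h2] at this
  rw [h0] at e1 e2
  refine ⟨⟨α t, fun j => norm_sq_of_gram_diag _ j _ ?_, ?_⟩, rfl⟩
  · rw [e2, gram_diag N.1 j _ (N.2.1 j)]
  · rw [e1, N.2.2]

/-- Functions that agree on the common level set have the same derivative along vector fields
that preserve the momentum maps. -/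
lemma fderiv_edges_eq_fderiv_gram (F : Mat n → ℝ) (F' : (Fin n → Mat (m + 1)) → ℝ)
    (hF : Differentiable ℝ F) (hF' : Differentiable ℝ F')
    (h : ∀ M : MatrixLevel m r, F' (edges M.1) = F (M.1ᴴ * M.1))
    (V : RectMat m n → RectMat m n) (hV : ContDiff ℝ 1 V)
    (h1 : ∀ M, V M * Mᴴ + M * (V M)ᴴ = 0) (h2 : ∀ M j, ((V M)ᴴ * M + Mᴴ * V M) j j = 0)
    (N : MatrixLevel m r) :
    fderiv ℝ F' (edges N.1) (dEdges N.1 (V N.1))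
      = fderiv ℝ F (N.1ᴴ * N.1) ((V N.1)ᴴ * N.1 + N.1ᴴ * V N.1) := by
  -- The functions agree only on the level set, which may be singular at `N`. A vector satisfying
  -- the linearised equations is not enough there; an actual curve inside the set is needed.
  obtain ⟨α, h0, hα, hev⟩ := exists_integral_curve V hV h1 h2 N
  have d1 := HasDerivAt.edges hα
  have d2 := HasDerivAt.gram hα
  rw [h0] at d1 d2
  have d1' : HasDerivAt (fun t => F' (edges (α t)))
      (fderiv ℝ F' (edges N.1) (dEdges N.1 (V N.1))) 0 := by
    refine HasFDerivAt.comp_hasDerivAt (0 : ℝ) (l := F') ?_ d1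
    rw [h0]
    exact (hF' _).hasFDerivAt
  have d2' : HasDerivAt (fun t => F ((α t)ᴴ * α t))
      (fderiv ℝ F (N.1ᴴ * N.1) ((V N.1)ᴴ * N.1 + N.1ᴴ * V N.1)) 0 := by
    refine HasFDerivAt.comp_hasDerivAt (0 : ℝ) (l := F) ?_ d2
    rw [h0]
    exact (hF _).hasFDerivAt
  refine d1'.unique (d2'.congr_of_eventuallyEq ?_)
  filter_upwards [hev] with t ht
  obtain ⟨M, hM⟩ := ht
  rw [← hM]
  exact h M

/-- The unitary one-parameter group generated by `i P`, `P` a projection. -/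
def projRot {k : ℕ} (P : Mat k) (s : ℝ) : Mat k :=
  1 + (Complex.exp (s * Complex.I) - 1) • P

lemma hasDerivAt_conjBy_projRot {k : ℕ} (P X : Mat k) (hP : Pᴴ = P) :
    HasDerivAt (fun s => conjBy (projRot P s) X) ⁅Complex.I • P, X⁆ 0 := by
  have h1 : HasDerivAt (fun s : ℝ => Complex.exp (s * Complex.I) - 1) Complex.I 0 := by
    have : HasDerivAt (fun s : ℝ => Complex.exp (s * Complex.I))
        (Complex.exp ((0 : ℝ) * Complex.I) * (1 * Complex.I)) 0 :=
      (((hasDerivAt_id (0 : ℝ)).ofReal_comp).mul_const Complex.I).cexp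
    simpa using this.sub_const 1
  have h2 : HasDerivAt (projRot P) (Complex.I • P) 0 := by
    refine hasDerivAt_matrix.mpr fun i j => ?_
    simp only [projRot, Matrix.add_apply, Matrix.smul_apply, smul_eq_mul]
    exact (h1.mul_const _).const_add _
  have h3 := HasDerivAt.matrix_mul (HasDerivAt.matrix_mul h2 (hasDerivAt_const _ X))
    (HasDerivAt.conjTranspose h2)
  have h4 : projRot P 0 = 1 := by simp [projRot]
  rw [h4] at h3
  have h5 : (Complex.I • P * X + 1 * 0) * 1ᴴ + 1 * X * (Complex.I • P)ᴴ = ⁅Complex.I • P, X⁆ := by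
    rw [Matrix.conjTranspose_smul, hP, Ring.lie_def]
    simp [sub_eq_add_neg]
  rwa [h5] at h3

lemma projRot_mem_unitary {k : ℕ} (P : Mat k) (hP : Pᴴ = P) (hP2 : P * P = P) (s : ℝ) :
    projRot P s ∈ Matrix.unitaryGroup (Fin k) ℂ := by
  have h : Complex.exp (s * Complex.I) * star (Complex.exp (s * Complex.I)) = 1 := by
    rw [Complex.star_def, Complex.mul_conj', Complex.norm_exp_ofReal_mul_I]
    simp
  rw [Matrix.mem_unitaryGroup_iff, Matrix.star_eq_conjTranspose, projRot,
    Matrix.conjTranspose_add, Matrix.conjTranspose_smul, hP, Matrix.conjTranspose_one,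
    add_mul, mul_add, mul_add, smul_mul_smul_comm, hP2]
  simp only [one_mul, mul_one]
  rw [add_assoc, ← add_smul, ← add_smul]
  rw [show star (Complex.exp (s * Complex.I) - 1) + (Complex.exp (s * Complex.I) - 1 +
    (Complex.exp (s * Complex.I) - 1) * star (Complex.exp (s * Complex.I) - 1)) = 0 by
      rw [star_sub, star_one]
      linear_combination h, zero_smul, add_zero]

lemma projRot_single (j : Fin n) (s : ℝ) :
    projRot (Matrix.single j j (1 : ℂ)) s = torusMat (Pi.mulSingle j (Circle.exp s)) := by
  ext a b
  rw [projRot, torusMat, Matrix.diagonal_apply, Matrix.add_apply, Matrix.smul_apply,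
    Matrix.one_apply, Matrix.single_apply, Pi.mulSingle_apply]
  by_cases hab : a = b
  · subst hab
    by_cases ha : a = j
    · subst ha; simp [Circle.coe_exp]
    · have : j ≠ a := fun h => ha h.symm
      simp [ha, this]
  · have : ¬ (j = a ∧ j = b) := fun h => hab (h.1.symm.trans h.2)
    simp [hab, this]

lemma lie_isHermitian {k : ℕ} {X ξ : Mat k} (hX : X.IsHermitian) (hξ : ξ ∈ skewAdjoint (Mat k)) :
    ⁅ξ, X⁆.IsHermitian := by
  have h := skewAdjoint.mem_iff.mp hξ
  rw [Matrix.star_eq_conjTranspose] at h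
  rw [Matrix.IsHermitian, Ring.lie_def, Matrix.conjTranspose_sub, Matrix.conjTranspose_mul,
    Matrix.conjTranspose_mul, h, hX]
  simp only [Matrix.mul_neg, Matrix.neg_mul]
  abel

lemma I_smul_mem_skewAdjoint {k : ℕ} {P : Mat k} (hP : Pᴴ = P) :
    Complex.I • P ∈ skewAdjoint (Mat k) := by
  rw [skewAdjoint.mem_iff, Matrix.star_eq_conjTranspose, Matrix.conjTranspose_smul, hP]
  simp

lemma lie_antisymm {k : ℕ} (A B : Mat k) : ⁅A, B⁆ = -⁅B, A⁆ := by
  rw [Ring.lie_def, Ring.lie_def, neg_sub]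

/-- Rewrites the derivative along the rotation generated by `i P` as the pairing of `P` with a
commutator, which is how invariance becomes a statement about momentum maps. -/
lemma trace_grad_lie_projection {k : ℕ} {X ξ P : Mat k} :
    (ξ * ⁅Complex.I • P, X⁆).trace.im = (P * ⁅X, ξ⁆).trace.re := by
  have h : (ξ * ⁅Complex.I • P, X⁆).trace = Complex.I * (P * ⁅X, ξ⁆).trace := by
    rw [← trace_mul_lie_right X ξ, lie_antisymm ξ, Matrix.mul_neg, Matrix.trace_neg,
      trace_mul_lie_right X, lie_antisymm ξ X, Matrix.mul_neg, Matrix.trace_neg, neg_neg,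
      Matrix.smul_mul, Matrix.trace_smul, smul_eq_mul]
  rw [h]
  simp

/-- The rank-one projections onto eigenvectors read off the eigenvalues. Unitary invariance
therefore needs to be tested only on the one-parameter groups `projRot P`. -/
lemma eq_zero_of_trace_projection {k : ℕ} {A : Mat k} (hA : A.IsHermitian)
    (h : ∀ P : Mat k, Pᴴ = P → P * P = P → (P * A).trace.re = 0) : A = 0 := by
  rw [← hA.eigenvalues_eq_zero_iff]
  funext i
  rw [hA.eigenvalues_eq i, Pi.zero_apply]
  set v : Fin k → ℂ := ⇑(hA.eigenvectorBasis i) with hv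
  have hnorm : star v ⬝ᵥ v = 1 := by
    have h1 := hA.eigenvectorBasis.orthonormal.1 i
    have h2 := inner_self_eq_norm_sq_to_K (𝕜 := ℂ) (hA.eigenvectorBasis i)
    rw [h1, EuclideanSpace.inner_eq_star_dotProduct] at h2
    rw [dotProduct_comm]
    simpa using h2
  have h3 := h (Matrix.vecMulVec v (star v)) (by simp [Matrix.conjTranspose_vecMulVec]) (by
    rw [Matrix.vecMulVec_mul_vecMulVec, hnorm, one_smul])
  rw [Matrix.vecMulVec_mul, Matrix.trace_vecMulVec] at h3
  rw [Matrix.dotProduct_mulVec, dotProduct_comm]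
  exact h3

/-- The momentum map of the torus Poisson commutes with torus-invariant functions. -/
lemma diag_lie_grad_eq_zero (H : Mat n → ℝ) (hH : Differentiable ℝ H)
    (hinv : ∀ (t : Fin n → Circle) X, H (conjBy (torusMat t) X) = H X) (X : Mat n)
    (hX : X.IsHermitian) (j : Fin n) :
    ⁅X, grad (fderiv ℝ H X).toLinearMap⁆ j j = 0 := by
  set ξ := grad (fderiv ℝ H X).toLinearMap with hξ
  have hP : (Matrix.single j j (1 : ℂ))ᴴ = Matrix.single j j (1 : ℂ) := by simp
  have h1 := hasDerivAt_conjBy_projRot (Matrix.single j j (1 : ℂ)) X hP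
  have h2 : HasDerivAt (fun s => H (conjBy (projRot (Matrix.single j j (1 : ℂ)) s) X))
      (fderiv ℝ H X ⁅Complex.I • Matrix.single j j (1 : ℂ), X⁆) 0 := by
    refine HasFDerivAt.comp_hasDerivAt (0 : ℝ) (l := H) ?_ h1
    have h4 : conjBy (projRot (Matrix.single j j (1 : ℂ)) 0) X = X := by simp [projRot, conjBy]
    rw [h4]
    exact (hH X).hasFDerivAt
  simp only [projRot_single, hinv] at h2
  have h3 : (ξ * ⁅Complex.I • Matrix.single j j (1 : ℂ), X⁆).trace.im = 0 := by
    rw [hξ, grad_spec _ _ (lie_isHermitian hX (I_smul_mem_skewAdjoint hP))]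
    exact h2.unique (hasDerivAt_const _ _)
  rw [trace_grad_lie_projection] at h3
  have h5 : ⁅X, ξ⁆.IsHermitian := by
    rw [lie_antisymm]
    exact (lie_isHermitian hX (grad_mem _)).neg
  have h6 : (Matrix.single j j (1 : ℂ) * ⁅X, ξ⁆).trace = ⁅X, ξ⁆ j j := by
    rw [Matrix.trace_single_mul, one_smul]
  rw [h6] at h3
  rw [← h5.coe_re_apply_self j]
  simp [h3]

lemma partialGrad_spec (F : (Fin n → Mat (m + 1)) → ℝ) (e Y : Fin n → Mat (m + 1))
    (hY : ∀ j, (Y j).IsHermitian) :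
    fderiv ℝ F e Y = ∑ j, (partialGrad F e j * Y j).trace.im := by
  have h : Y = ∑ j, Pi.single j (Y j) := (Finset.univ_sum_single Y).symm
  conv_lhs => rw [h, map_sum]
  refine Finset.sum_congr rfl fun j _ => ?_
  rw [partialGrad, grad_spec _ _ (hY j)]
  rfl

/-- The momentum map of the unitary group Poisson commutes with unitarily invariant functions. -/
lemma sum_lie_partialGrad_eq_zero (F : (Fin n → Mat (m + 1)) → ℝ) (hF : Differentiable ℝ F)
    (hinv : ∀ (g : U (m + 1)) e, F (fun i => conjBy g (e i)) = F e) (e : Fin n → Mat (m + 1))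
    (he : ∀ j, (e j).IsHermitian) :
    ∑ j, ⁅partialGrad F e j, e j⁆ = 0 := by
  refine eq_zero_of_trace_projection ?_ fun P hP hP2 => ?_
  · rw [Matrix.IsHermitian, Matrix.conjTranspose_sum]
    exact Finset.sum_congr rfl fun j _ => lie_isHermitian (he j) (grad_mem _)
  have h1 : HasDerivAt (fun s i => conjBy (projRot P s) (e i)) (fun i => ⁅Complex.I • P, e i⁆) 0 :=
    hasDerivAt_pi.mpr fun i => hasDerivAt_conjBy_projRot P (e i) hP
  have h2 : HasDerivAt (fun s => F fun i => conjBy (projRot P s) (e i))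
      (fderiv ℝ F e fun i => ⁅Complex.I • P, e i⁆) 0 := by
    refine HasFDerivAt.comp_hasDerivAt (0 : ℝ) (l := F) ?_ h1
    have h4 : (fun i => conjBy (projRot P 0) (e i)) = e := by
      funext i; simp [projRot, conjBy]
    rw [h4]
    exact (hF e).hasFDerivAt
  have h3 : (fun s => F fun i => conjBy (projRot P s) (e i)) = fun _ => F e :=
    funext fun s => hinv ⟨_, projRot_mem_unitary P hP hP2 s⟩ e
  rw [h3] at h2
  have h5 := h2.unique (hasDerivAt_const _ _)
  rw [partialGrad_spec _ _ _ fun j => lie_isHermitian (he j) (I_smul_mem_skewAdjoint hP)] at h5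
  simp only [trace_grad_lie_projection] at h5
  rw [Finset.mul_sum, Matrix.trace_sum, Complex.re_sum, ← neg_eq_zero, ← Finset.sum_neg_distrib,
    ← h5]
  refine Finset.sum_congr rfl fun j _ => ?_
  rw [lie_antisymm, Matrix.mul_neg, Matrix.trace_neg, Complex.neg_re, neg_neg]

/-- The Hamiltonian vector field of `H (Nᴴ N)`. -/
def gramField (H : Mat n → ℝ) (M : RectMat m n) : RectMat m n :=
  M * grad (fderiv ℝ H (Mᴴ * M)).toLinearMap

/-- The Hamiltonian vector field of `F (edges N)`. -/
def edgesField (F : (Fin n → Mat (m + 1)) → ℝ) (M : RectMat m n) : RectMat m n :=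
  Matrix.of fun i j => (partialGrad F (edges M) j *ᵥ fun a => M a j) i

lemma contDiff_fderiv_apply {E : Type*} [NormedAddCommGroup E] [NormedSpace ℝ E] {F : E → ℝ}
    (hF : ContDiff ℝ ∞ F) (Y : E) : ContDiff ℝ 1 fun x => fderiv ℝ F x Y :=
  ((contDiff_infty.mp hF 2).fderiv_right (m := 1) (by norm_num)).clm_apply contDiff_const

lemma contDiff_gramField (H : Mat n → ℝ) (hH : ContDiff ℝ ∞ H) :
    ContDiff ℝ 1 (gramField (m := m) H) := by
  refine ContDiff.matrix_mul contDiff_id (contDiff_grad _ fun Y => ?_)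
  exact (contDiff_fderiv_apply hH Y).comp contDiff_gram

lemma contDiff_edgesField (F : (Fin n → Mat (m + 1)) → ℝ) (hF : ContDiff ℝ ∞ F) :
    ContDiff ℝ 1 (edgesField F) := by
  refine contDiff_matrix.mpr fun i j => ?_
  have h2 : ContDiff ℝ 1 fun M : RectMat m n => partialGrad F (edges M) j :=
    contDiff_grad _ fun Y => (contDiff_fderiv_apply hF _).comp contDiff_edges
  simp only [edgesField, Matrix.of_apply, Matrix.mulVec, dotProduct]
  exact ContDiff.sum fun a _ => (contDiff_matrix.mp h2 i a).mul (contDiff_entry a j)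

lemma grad_conjTranspose {k : ℕ} (L : Mat k →ₗ[ℝ] ℝ) : (grad L)ᴴ = -grad L :=
  skewAdjoint.mem_iff.mp (grad_mem L)

lemma dgram_gramField (H : Mat n → ℝ) (M : RectMat m n) :
    (gramField H M)ᴴ * M + Mᴴ * gramField H M
      = ⁅Mᴴ * M, grad (fderiv ℝ H (Mᴴ * M)).toLinearMap⁆ := by
  rw [gramField, Matrix.conjTranspose_mul, grad_conjTranspose, Ring.lie_def, Matrix.neg_mul,
    Matrix.neg_mul]
  simp only [Matrix.mul_assoc]
  abel

/-- Here the gradient multiplies from the left, in `gramField` from the right. So the commutator has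
the opposite order to that in `dgram_gramField`, and this is the source of the relative sign of the
two brackets. -/
lemma dEdges_edgesField (F : (Fin n → Mat (m + 1)) → ℝ) (M : RectMat m n) (j : Fin n) :
    dEdges M (edgesField F M) j = ⁅partialGrad F (edges M) j, edges M j⁆ := by
  have h1 : (fun i => edgesField F M i j) = partialGrad F (edges M) j *ᵥ fun a => M a j := rfl
  rw [dEdges, h1, edges, Ring.lie_def, Matrix.mul_vecMulVec, Matrix.vecMulVec_mul,
    Matrix.star_mulVec]
  have h2 : (partialGrad F (edges M) j)ᴴ = -partialGrad F (edges M) j := grad_conjTranspose _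
  rw [h2, Matrix.vecMul_neg, Matrix.vecMulVec_neg, sub_eq_add_neg]

lemma trace_dEdges (M δ : RectMat m n) (j : Fin n) :
    (dEdges M δ j).trace = (δᴴ * M + Mᴴ * δ) j j := by
  simp only [dEdges, Matrix.trace, Matrix.diag_apply, Matrix.add_apply, Matrix.vecMulVec_apply,
    Matrix.mul_apply, Matrix.conjTranspose_apply, Pi.star_apply, ← Finset.sum_add_distrib]
  exact Finset.sum_congr rfl fun i _ => by ring

lemma edges_isHermitian (N : RectMat m n) (j : Fin n) : (edges N j).IsHermitian :=
  edges_conjTranspose N j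

lemma dEdges_isHermitian (N δ : RectMat m n) (j : Fin n) : (dEdges N δ j).IsHermitian := by
  ext a b
  simp [dEdges, Matrix.vecMulVec_apply]
  ring

/-- Let `v` be the Hamiltonian field of `H (Nᴴ N)` and `u` that of `F' (edges N)`. Differentiating
`F' ∘ edges = F ∘ gram` along `v` gives `2 Im Tr (vᴴ u) = -{F, H}`; differentiating `H' ∘ edges = H
∘ gram` along `u` gives `-{F', H'} = -2 Im Tr (vᴴ u)`. Since the two fields come from opposite
sides, the brackets depend only on the functions on the level set. -/
theorem prodLieBracket_eq_neg_lieBracket (F H : Mat n → ℝ) (F' H' : (Fin n → Mat (m + 1)) → ℝ)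
    (hF : ContDiff ℝ ∞ F) (hH : ContDiff ℝ ∞ H) (hF' : ContDiff ℝ ∞ F') (hH' : ContDiff ℝ ∞ H')
    (hHinv : ∀ (t : Fin n → Circle) X, H (conjBy (torusMat t) X) = H X)
    (hFinv : ∀ (g : U (m + 1)) e, F' (fun i => conjBy g (e i)) = F' e)
    (hFF : ∀ M : MatrixLevel m r, F' (edges M.1) = F (M.1ᴴ * M.1))
    (hHH : ∀ M : MatrixLevel m r, H' (edges M.1) = H (M.1ᴴ * M.1)) (N : MatrixLevel m r) :
    prodLieBracket F' H' (edges N.1) = -lieBracket F H (N.1ᴴ * N.1) := by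
  have hinf : (∞ : WithTop ℕ∞) ≠ 0 := by simp
  have dF := hF.differentiable hinf
  have dH := hH.differentiable hinf
  have dF' := hF'.differentiable hinf
  have dH' := hH'.differentiable hinf
  -- `v` preserves `N Nᴴ` because the gradient is skew, and the column norms because `H` is torus
  -- invariant.
  have k1 := fderiv_edges_eq_fderiv_gram F F' dF dF' hFF (gramField H) (contDiff_gramField H hH)
    (fun M => by
      rw [gramField, Matrix.conjTranspose_mul, grad_conjTranspose]
      simp [Matrix.mul_assoc])
    (fun M j => by
      rw [dgram_gramField]
      exact diag_lie_grad_eq_zero H dH hHinv _ (Matrix.isHermitian_conjTranspose_mul_self M) j) N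
  -- Dually, `u` preserves `N Nᴴ` because `F'` is unitarily invariant, and the column norms because
  -- commutators have trace zero.
  have k2 := fderiv_edges_eq_fderiv_gram H H' dH dH' hHH (edgesField F') (contDiff_edgesField F' hF')
    (fun M => by
      rw [← sum_dEdges]
      simp only [dEdges_edgesField]
      exact sum_lie_partialGrad_eq_zero F' dF' hFinv _ (edges_isHermitian M))
    (fun M j => by
      rw [← trace_dEdges, dEdges_edgesField, Ring.lie_def, Matrix.trace_sub, Matrix.trace_mul_comm,
        sub_self]) N
  have hgh : ∀ δ : RectMat m n, (δᴴ * N.1 + N.1ᴴ * δ).IsHermitian := fun δ => by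
    rw [Matrix.IsHermitian, Matrix.conjTranspose_add, Matrix.conjTranspose_mul,
      Matrix.conjTranspose_mul, Matrix.conjTranspose_conjTranspose,
      Matrix.conjTranspose_conjTranspose, add_comm]
  have gs : ∀ (G : Mat n → ℝ) (Y : Mat n), Y.IsHermitian → fderiv ℝ G (N.1ᴴ * N.1) Y
      = (grad (fderiv ℝ G (N.1ᴴ * N.1)).toLinearMap * Y).trace.im := fun G Y hY =>
    (grad_spec _ _ hY).symm
  rw [partialGrad_spec _ _ _ (dEdges_isHermitian _ _), gs F _ (hgh _)] at k1
  rw [partialGrad_spec _ _ _ (dEdges_isHermitian _ _), gs H _ (hgh _)] at k2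
  -- the two brackets, and the symplectic pairing of the two Hamiltonian vector fields
  have b1 : (grad (fderiv ℝ F (N.1ᴴ * N.1)).toLinearMap *
      ((gramField H N.1)ᴴ * N.1 + N.1ᴴ * gramField H N.1)).trace.im
      = -lieBracket F H (N.1ᴴ * N.1) := by
    rw [dgram_gramField, lieBracket, trace_mul_lie_right,
      lie_antisymm (grad (fderiv ℝ F _).toLinearMap), Matrix.mul_neg,
      Matrix.trace_neg, Complex.neg_im, neg_neg]
  have b2 : ∑ j, (partialGrad H' (edges N.1) j * dEdges N.1 (edgesField F' N.1) j).trace.im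
      = -prodLieBracket F' H' (edges N.1) := by
    rw [prodLieBracket, ← Finset.sum_neg_distrib]
    refine Finset.sum_congr rfl fun j _ => ?_
    rw [dEdges_edgesField, ← trace_mul_lie_right,
      lie_antisymm (partialGrad H' _ _), Matrix.mul_neg, Matrix.trace_neg,
      Complex.neg_im]
  set v := gramField H N.1 with hv
  set u := edgesField F' N.1 with hu
  have b3 : ∑ j, (partialGrad F' (edges N.1) j * dEdges N.1 v j).trace.im
      = 2 * (vᴴ * u).trace.im := by
    have hj : ∀ j, (partialGrad F' (edges N.1) j * dEdges N.1 v j).trace.im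
        = 2 * ((vᴴ * u) j j).im := by
      intro j
      set η := partialGrad F' (edges N.1) j with hη
      have hη' : ηᴴ = -η := grad_conjTranspose _
      have hz : (vᴴ * u) j j = (star fun i => v i j) ⬝ᵥ (η *ᵥ fun i => N.1 i j) := rfl
      have h1 : (η * dEdges N.1 v j).trace = (vᴴ * u) j j - star ((vᴴ * u) j j) := by
        rw [hz, dEdges, mul_add, Matrix.mul_vecMulVec, Matrix.mul_vecMulVec, Matrix.trace_add,
          Matrix.trace_vecMulVec, Matrix.trace_vecMulVec, add_comm, dotProduct_comm, sub_eq_add_neg]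
        congr 1
        rw [← Matrix.star_dotProduct, Matrix.star_mulVec, hη', Matrix.vecMul_neg, neg_dotProduct,
          neg_neg, ← Matrix.dotProduct_mulVec, dotProduct_comm]
      rw [h1, Complex.sub_im, Complex.star_def, Complex.conj_im]
      ring
    rw [Finset.sum_congr rfl fun j _ => hj j, ← Finset.mul_sum, Matrix.trace, Complex.im_sum]
    rfl
  have b4 : (grad (fderiv ℝ H (N.1ᴴ * N.1)).toLinearMap * (uᴴ * N.1 + N.1ᴴ * u)).trace.im
      = -(2 * (vᴴ * u).trace.im) := by
    set ξ := grad (fderiv ℝ H (N.1ᴴ * N.1)).toLinearMap with hξ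
    have hξ' : ξᴴ = -ξ := grad_conjTranspose _
    have hvN : v = N.1 * ξ := rfl
    have h1 : (ξ * (uᴴ * N.1)).trace = star (vᴴ * u).trace := by
      rw [← Matrix.trace_conjTranspose, Matrix.conjTranspose_mul, Matrix.conjTranspose_conjTranspose,
        hvN, Matrix.trace_mul_comm, Matrix.mul_assoc]
    have h2 : (ξ * (N.1ᴴ * u)).trace = -(vᴴ * u).trace := by
      rw [hvN, Matrix.conjTranspose_mul, hξ', Matrix.neg_mul, Matrix.neg_mul, Matrix.trace_neg,
        neg_neg, Matrix.mul_assoc]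
    rw [Matrix.mul_add, Matrix.trace_add, h1, h2, Complex.add_im, Complex.star_def,
      Complex.conj_im, Complex.neg_im]
    ring
  rw [b2, b4] at k2
  rw [b1, b3] at k1
  linarith

end smooth


/-! ### Averaging and gluing smooth functions -/

section generic

open MeasureTheory Topology

/-- Differentiation under the integral sign. The derivative is an integral of the same kind with
values in `E →L[ℝ] F`, so the induction on `l` quantifies over the target space. The parameter
enters through `ι` into a normed space, so that joint smoothness makes sense; compactness supplies
the dominating constant. -/
lemma contDiff_integral_of_compact {K E M : Type} [TopologicalSpace K] [CompactSpace K]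
    [SecondCountableTopology K] [MeasurableSpace K] [BorelSpace K] (μ : Measure K)
    [IsFiniteMeasure μ] [NormedAddCommGroup E] [NormedSpace ℝ E] [FiniteDimensional ℝ E]
    [NormedAddCommGroup M] [NormedSpace ℝ M] (ι : K → M) (hι : Continuous ι) (l : ℕ) :
    ∀ (F : Type) [NormedAddCommGroup F] [NormedSpace ℝ F] (Ψ : M × E → F), ContDiff ℝ ∞ Ψ →
      ContDiff ℝ l fun x => ∫ k, Ψ (ι k, x) ∂μ := by
  have key : ∀ (F : Type) [NormedAddCommGroup F] [NormedSpace ℝ F] (Ψ : M × E → F),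
      ContDiff ℝ ∞ Ψ → ∀ x, HasFDerivAt (fun x => ∫ k, Ψ (ι k, x) ∂μ)
        (∫ k, (fderiv ℝ Ψ (ι k, x)).comp (ContinuousLinearMap.inr ℝ M E) ∂μ) x := by
    intro F _ _ Ψ hΨ x
    have hinf : (∞ : WithTop ℕ∞) ≠ 0 := by simp
    have hc : ∀ x, Continuous fun k => Ψ (ι k, x) := fun x =>
      hΨ.continuous.comp (hι.prodMk continuous_const)
    have hd : Continuous fun p : K × E =>
        (fderiv ℝ Ψ (ι p.1, p.2)).comp (ContinuousLinearMap.inr ℝ M E) :=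
      ((hΨ.continuous_fderiv hinf).comp
        ((hι.comp continuous_fst).prodMk continuous_snd)).clm_comp continuous_const
    have hcomp : IsCompact ((Set.univ : Set K) ×ˢ Metric.closedBall x 1) :=
      isCompact_univ.prod (isCompact_closedBall x 1)
    obtain ⟨C, hC⟩ := hcomp.exists_bound_of_continuousOn hd.continuousOn
    refine hasFDerivAt_integral_of_dominated_of_fderiv_le (bound := fun _ => C)
      (Metric.closedBall_mem_nhds x one_pos) (.of_forall fun y => (hc y).aestronglyMeasurable)
      ((hc x).integrable_of_hasCompactSupport (HasCompactSupport.of_compactSpace _))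
      (hd.comp (continuous_id.prodMk continuous_const)).aestronglyMeasurable
      (.of_forall fun k y hy => hC (k, y) ⟨trivial, hy⟩) (integrable_const C)
      (.of_forall fun k y _ => ?_)
    have h1 : HasFDerivAt (fun y : E => (ι k, y)) (ContinuousLinearMap.inr ℝ M E) y :=
      hasFDerivAt_prodMk_right (ι k) y
    exact ((hΨ.differentiable hinf _).hasFDerivAt).comp y h1
  induction l with
  | zero =>
    intro F _ _ Ψ hΨ
    rw [Nat.cast_zero, contDiff_zero, continuous_iff_continuousAt]
    exact fun x => (key F Ψ hΨ x).continuousAt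
  | succ l ih =>
    intro F _ _ Ψ hΨ
    rw [Nat.cast_succ, contDiff_succ_iff_hasFDerivAt]
    refine ⟨_, ih (E →L[ℝ] F) (fun p => (fderiv ℝ Ψ p).comp (ContinuousLinearMap.inr ℝ M E)) ?_,
      key F Ψ hΨ⟩
    exact (contDiff_infty_iff_fderiv.mp hΨ).2.clm_comp contDiff_const

/-- Averaging over a compact group. -/
lemma exists_invariant_average {K E M : Type} [Group K] [TopologicalSpace K] [CompactSpace K]
    [IsTopologicalGroup K] [SecondCountableTopology K] [T2Space K]
    [NormedAddCommGroup E] [NormedSpace ℝ E] [FiniteDimensional ℝ E]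
    [NormedAddCommGroup M] [NormedSpace ℝ M] (ι : K → M) (hι : Continuous ι) (A : M × E → E)
    (hA : ContDiff ℝ ∞ A) (hmul : ∀ g h x, A (ι g, A (ι h, x)) = A (ι (g * h), x))
    (G : E → ℝ) (hG : ContDiff ℝ ∞ G) :
    ∃ F : E → ℝ, ContDiff ℝ ∞ F ∧ (∀ g x, F (A (ι g, x)) = F x) ∧
      ∀ x c, (∀ g, G (A (ι g, x)) = c) → F x = c := by
  let _ : MeasurableSpace K := borel K
  have : BorelSpace K := ⟨rfl⟩
  let μ : Measure K := Measure.haarMeasure ⊤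
  have : IsProbabilityMeasure μ :=
    ⟨Measure.haarMeasure_self (K₀ := (⊤ : TopologicalSpace.PositiveCompacts K))⟩
  -- The inverse turns the translation of `x` by `h` into a left translation of `g`, under which
  -- Haar measure is invariant.
  refine ⟨fun x => ∫ g, G (A (ι g⁻¹, x)) ∂μ, contDiff_infty.mpr fun l => ?_, fun h x => ?_,
    fun x c hc => ?_⟩
  · exact contDiff_integral_of_compact μ (fun g => ι g⁻¹) (hι.comp continuous_inv) l ℝ
      (fun p => G (A p)) (hG.comp hA)
  · have h1 : ∀ g : K, G (A (ι g⁻¹, A (ι h, x))) = (fun g => G (A (ι g⁻¹, x))) (h⁻¹ * g) := by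
      intro g
      simp only [hmul, mul_inv_rev, inv_inv]
    simp only [h1]
    exact integral_mul_left_eq_self (μ := μ) (fun g => G (A (ι g⁻¹, x))) h⁻¹
  · simp only [hc]
    simp

open Manifold in
/-- A function on a closed set that locally extends to smooth functions extends to a smooth
function. -/
lemma exists_contDiff_extension {E : Type} [NormedAddCommGroup E] [NormedSpace ℝ E]
    [FiniteDimensional ℝ E] {Z : Set E} (hZ : IsClosed Z) (f : Z → ℝ)
    (h : ∀ x ∈ Z, ∃ G : E → ℝ, ∀ᶠ y in 𝓝 x, ContDiffAt ℝ ∞ G y ∧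
      ∀ hy : y ∈ Z, G y = f ⟨y, hy⟩) :
    ∃ G : E → ℝ, ContDiff ℝ ∞ G ∧ ∀ z : Z, G z = f z := by
  -- The constraint at a point is a single value on `Z` and is empty off `Z`. Both are convex, so a
  -- partition of unity glues local solutions.
  obtain ⟨g, hg⟩ := exists_contMDiffMap_forall_mem_convex_of_local (I := 𝓘(ℝ, E)) (n := (⊤ : ℕ∞))
    (t := fun x : E => {c : ℝ | ∀ hx : x ∈ Z, c = f ⟨x, hx⟩})
    (fun x => by
      intro a ha b hb s t _ _ hst hx
      rw [ha hx, hb hx, ← add_smul, hst, one_smul])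
    (fun x => by
      by_cases hx : x ∈ Z
      · obtain ⟨G, hG⟩ := h x hx
        exact ⟨_, hG, G, fun y hy => hy.1.contMDiffAt.contMDiffWithinAt, fun y hy => hy.2⟩
      · exact ⟨Zᶜ, hZ.isOpen_compl.mem_nhds hx, fun _ => 0, contMDiffOn_const,
          fun y hy hy' => absurd hy' hy⟩)
  exact ⟨g, g.contMDiff.contDiff, fun z => hg z z.2⟩

/-- The inverse function theorem at a point where the derivative is a nonzero multiple of the
identity. -/
lemma exists_local_inverse {E : Type} [NormedAddCommGroup E] [NormedSpace ℝ E]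
    [CompleteSpace E] (f : E → E) (a : E) (c : ℝ) (hc : c ≠ 0) (hf : ContDiff ℝ ω f)
    (h : ∀ v, HasDerivAt (fun t : ℝ => f (a + t • v)) (c • v) 0) :
    ∃ R : E → E, ContDiffAt ℝ ω R (f a) ∧ R (f a) = a ∧ (∀ᶠ y in 𝓝 (f a), f (R y) = y) ∧
      ∀ᶠ x in 𝓝 a, R (f x) = x := by
  let e : E ≃L[ℝ] E := ContinuousLinearEquiv.smulLeft (Units.mk0 c hc)
  have hd : DifferentiableAt ℝ f a := hf.differentiable (by simp) a
  have he : HasFDerivAt f (e : E →L[ℝ] E) a := by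
    have h1 : fderiv ℝ f a = (e : E →L[ℝ] E) := by
      ext v
      have h2 : HasDerivAt (fun t : ℝ => f (a + t • v)) (fderiv ℝ f a v) 0 := by
        have h3 : HasDerivAt (fun t : ℝ => a + t • v) v 0 := by
          simpa using ((hasDerivAt_id (0 : ℝ)).smul_const v).const_add a
        refine HasFDerivAt.comp_hasDerivAt (0 : ℝ) (l := f) ?_ h3
        simpa using hd.hasFDerivAt
      exact h2.unique (h v)
    rw [← h1]
    exact hd.hasFDerivAt
  have hω : (ω : WithTop ℕ∞) ≠ 0 := by simp
  exact ⟨hf.contDiffAt.localInverse he hω, hf.contDiffAt.to_localInverse he hω,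
    hf.contDiffAt.localInverse_apply_image he hω,
    (hf.contDiffAt.hasStrictFDerivAt' he hω).eventually_right_inverse,
    (hf.contDiffAt.hasStrictFDerivAt' he hω).eventually_left_inverse⟩

end generic


/-! ### Smooth functions on the two quotients -/

instance (k : ℕ) : CompactSpace (U k) := by
  have hcl : IsClosed {g : Mat k | g ∈ Matrix.unitaryGroup (Fin k) ℂ} := by
    simp only [Matrix.mem_unitaryGroup_iff]
    exact isClosed_eq (continuous_id.matrix_mul continuous_id.matrix_conjTranspose)
      continuous_const
  have hcomp : IsCompact {N : Mat k | ∀ i j, ‖N i j‖ ≤ 1} := by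
    have : {N : Mat k | ∀ i j, ‖N i j‖ ≤ 1}
        = Set.univ.pi fun _ => Set.univ.pi fun _ => Metric.closedBall (0 : ℂ) 1 :=
      Set.ext fun N => ⟨fun h i _ j _ => mem_closedBall_zero_iff.mpr (h i j),
        fun h i j => mem_closedBall_zero_iff.mp (h i trivial j trivial)⟩
    rw [this]
    exact isCompact_univ_pi fun i => isCompact_univ_pi fun j => isCompact_closedBall _ _
  exact isCompact_iff_compactSpace.mp (hcomp.of_isClosed_subset hcl fun g hg i j =>
    entry_norm_bound_of_unitary hg i j)

instance (k : ℕ) : SecondCountableTopology (U k) :=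
  have : SecondCountableTopology (Mat k) :=
    inferInstanceAs (SecondCountableTopology (Fin k → Fin k → ℂ))
  TopologicalSpace.Subtype.secondCountableTopology _

lemma MatrixLevel.continuous_val {m n : ℕ} {r : Fin n → ℝ} :
    Continuous fun N : MatrixLevel m r => N.1 :=
  continuous_subtype_val

lemma continuous_unitary_coe (k : ℕ) : Continuous fun g : U k => (g : Mat k) :=
  continuous_subtype_val

lemma continuous_circle_coe (n : ℕ) : Continuous fun (t : Fin n → Circle) i => (t i : ℂ) :=
  continuous_pi fun i => continuous_subtype_val.comp (continuous_apply i)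

section smooth

attribute [local instance] Matrix.normedAddCommGroup Matrix.normedSpace

open Topology

lemma ContDiff.conjBy {E : Type*} [NormedAddCommGroup E] [NormedSpace ℝ E] {k : ℕ}
    {l : WithTop ℕ∞} {f g : E → Mat k} (hf : ContDiff ℝ l f) (hg : ContDiff ℝ l g) :
    ContDiff ℝ l fun x => PolygonDuality.conjBy (f x) (g x) :=
  ContDiff.matrix_mul (ContDiff.matrix_mul hf hg) (contDiff_conjTranspose.comp hf)

lemma exists_unitary_average {k n : ℕ} (G : (Fin n → Mat k) → ℝ) (hG : ContDiff ℝ ∞ G) :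
    ∃ F : (Fin n → Mat k) → ℝ, ContDiff ℝ ∞ F ∧
      (∀ (g : U k) e, F (fun i => conjBy g (e i)) = F e) ∧
      ∀ e c, (∀ g : U k, G (fun i => conjBy g (e i)) = c) → F e = c := by
  have hA : ContDiff ℝ ∞ fun p : Mat k × (Fin n → Mat k) => fun i => conjBy p.1 (p.2 i) :=
    contDiff_pi.mpr fun i => ContDiff.conjBy (f := fun p : Mat k × (Fin n → Mat k) => p.1)
      (g := fun p => p.2 i) contDiff_fst ((contDiff_apply ℝ (Mat k) i).comp contDiff_snd)
  have hmul : ∀ (g h : U k) (x : Fin n → Mat k),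
      (fun i => conjBy g (conjBy h (x i))) = fun i => conjBy (g * h : U k) (x i) := fun g h x => by
    simp only [conjBy_conjBy, Submonoid.coe_mul]
  obtain ⟨F, h1, h2, h3⟩ := exists_invariant_average (K := U k) (E := Fin n → Mat k)
    (M := Mat k) (fun g => (g : Mat k)) (continuous_unitary_coe k)
    (fun p i => conjBy p.1 (p.2 i)) hA hmul G hG
  exact ⟨F, h1, h2, h3⟩

lemma contDiff_diagonal {n : ℕ} {l : WithTop ℕ∞} :
    ContDiff ℝ l fun z : Fin n → ℂ => (Matrix.diagonal z : Mat n) := by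
  refine contDiff_matrix.mpr fun i j => ?_
  by_cases hij : i = j
  · subst hij
    simp only [Matrix.diagonal_apply_eq]
    exact contDiff_apply ℝ ℂ i
  · simp only [Matrix.diagonal_apply_ne _ hij]
    exact contDiff_const

lemma exists_torus_average {n : ℕ} (G : Mat n → ℝ) (hG : ContDiff ℝ ∞ G) :
    ∃ F : Mat n → ℝ, ContDiff ℝ ∞ F ∧
      (∀ (t : Fin n → Circle) X, F (conjBy (torusMat t) X) = F X) ∧
      ∀ X c, (∀ t : Fin n → Circle, G (conjBy (torusMat t) X) = c) → F X = c := by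
  have hA : ContDiff ℝ ∞ fun p : (Fin n → ℂ) × Mat n => conjBy (Matrix.diagonal p.1) p.2 :=
    ContDiff.conjBy (f := fun p : (Fin n → ℂ) × Mat n => Matrix.diagonal p.1)
      (g := fun p => p.2) (contDiff_diagonal.comp contDiff_fst) contDiff_snd
  have hmul : ∀ (g h : Fin n → Circle) (x : Mat n),
      conjBy (torusMat g) (conjBy (torusMat h) x) = conjBy (torusMat (g * h)) x := fun g h x => by
    rw [conjBy_conjBy, torusMat_mul]
  obtain ⟨F, h1, h2, h3⟩ := exists_invariant_average (K := Fin n → Circle) (E := Mat n)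
    (M := Fin n → ℂ) (fun t i => (t i : ℂ)) (continuous_circle_coe n)
    (fun p => conjBy (Matrix.diagonal p.1) p.2) hA hmul G hG
  exact ⟨F, h1, h2, h3⟩

variable {m n : ℕ} {r : Fin n → ℝ}

/-- The set is the continuous image of the compact common level set. -/
lemma isClosed_range_edges (hr : ∀ i, 0 < r i) :
    IsClosed {e : Fin n → Mat (m + 1) |
      (∀ i, e i ∈ rankOneOrbit m (r i)) ∧ ∑ i, e i = (lam m r : ℂ) • 1} := by
  have h : {e : Fin n → Mat (m + 1) | (∀ i, e i ∈ rankOneOrbit m (r i)) ∧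
      ∑ i, e i = (lam m r : ℂ) • 1} = Set.range fun N : MatrixLevel m r => edges N.1 := by
    ext e
    constructor
    · intro he
      obtain ⟨N, hN⟩ := MatrixLevel.exists_polygon_eq hr ⟨e, he⟩
      exact ⟨N, congrArg Subtype.val hN⟩
    · rintro ⟨N, rfl⟩
      exact N.polygon.2
  rw [h]
  exact (isCompact_range (X := MatrixLevel m r) (continuous_edges.comp MatrixLevel.continuous_val)).isClosed

lemma isClosed_range_gram (hmn : m + 1 ≤ n) (hr : ∀ i, 0 < r i) :
    IsClosed {X : Mat n | X ∈ grassOrbit m n (lam m r) ∧ ∀ j, X j j = (r j : ℂ)} := by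
  have h : {X : Mat n | X ∈ grassOrbit m n (lam m r) ∧ ∀ j, X j j = (r j : ℂ)}
      = Set.range fun N : MatrixLevel m r => N.1ᴴ * N.1 := by
    ext X
    constructor
    · intro hX
      obtain ⟨N, hN⟩ := MatrixLevel.exists_gram_eq hmn hr ⟨X, hX⟩
      exact ⟨N, congrArg Subtype.val hN⟩
    · rintro ⟨N, rfl⟩
      exact (N.gram hmn).2
  rw [h]
  exact (isCompact_range (X := MatrixLevel m r) (continuous_gram.comp MatrixLevel.continuous_val)).isClosed

/-- An analytic local section of the map from the common level set to closed polygons. -/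
lemma exists_section_edges (hr : ∀ i, 0 < r i) (e : ClosedPolygon m r) :
    ∃ σ : (Fin n → Mat (m + 1)) → RectMat m n, ContDiffAt ℝ ω σ e.1 ∧
      ∀ᶠ y in 𝓝 e.1, ∀ p : ClosedPolygon m r, p.1 = y →
        ∃ M : MatrixLevel m r, M.1 = σ y ∧ M.polygon = p := by
  obtain ⟨N, rfl⟩ := MatrixLevel.exists_polygon_eq hr e
  choose i0 hi0 using exists_entry_ne_zero hr N.2.1
  have hent : ∀ (M : MatrixLevel m r) j a b,
      M.polygon.1 j a b = M.1 a j * star (M.1 b j) := fun _ _ _ _ => rfl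
  have hre : ∀ (M : MatrixLevel m r) j a, (M.polygon.1 j a a).re = ‖M.1 a j‖ ^ 2 := by
    intro M j a
    rw [hent, Complex.star_def, Complex.mul_conj']
    norm_cast
  have hsm : ∀ j a b, ContDiff ℝ ω fun y : Fin n → Mat (m + 1) => y j a b := fun j a b =>
    (contDiff_entry a b).comp (contDiff_apply ℝ (Mat (m + 1)) j)
  have hsre : ∀ j, ContDiff ℝ ω fun y : Fin n → Mat (m + 1) => (y j (i0 j) (i0 j)).re := fun j =>
    Complex.reCLM.contDiff.comp (hsm j _ _)
  have hpos : ∀ j, 0 < (N.polygon.1 j (i0 j) (i0 j)).re := fun j => by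
    rw [hre]
    have := hi0 j
    positivity
  -- Each column is recovered from its edge with the phase that makes its entry in row `i0 j`
  -- positive. The columns may be rotated independently, as only the edges are prescribed.
  refine ⟨fun y => Matrix.of fun i j => y j i (i0 j) / (Real.sqrt (y j (i0 j) (i0 j)).re : ℂ),
    ?_, ?_⟩
  · refine contDiffAt_matrix.mpr fun i j => ?_
    simp only [Matrix.of_apply, div_eq_mul_inv]
    refine (hsm j i (i0 j)).contDiffAt.mul (ContDiffAt.inv ?_ (by
      exact_mod_cast (Real.sqrt_pos.mpr (hpos j)).ne'))
    exact Complex.ofRealCLM.contDiff.contDiffAt.comp _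
      ((hsre j).contDiffAt.sqrt (hpos j).ne')
  · have hev : ∀ᶠ y in 𝓝 N.polygon.1, ∀ j, 0 < (y j (i0 j) (i0 j)).re :=
      Filter.eventually_all.mpr fun j =>
        (hsre j).continuous.continuousAt.eventually (lt_mem_nhds (hpos j))
    filter_upwards [hev] with y hy p hp
    subst hp
    obtain ⟨M, rfl⟩ := MatrixLevel.exists_polygon_eq hr p
    set σ : RectMat m n := Matrix.of fun i j =>
      M.polygon.1 j i (i0 j) / (Real.sqrt (M.polygon.1 j (i0 j) (i0 j)).re : ℂ) with hσ
    have hσ' : ∀ i j, σ i j = M.1 i j * star (M.1 (i0 j) j) / (‖M.1 (i0 j) j‖ : ℂ) := by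
      intro i j
      rw [hσ, Matrix.of_apply, hre, Real.sqrt_sq (norm_nonneg _), hent]
    have hedge : edges σ = edges M.1 := by
      ext j a b
      have h1 := hy j
      rw [hre] at h1
      have h2 : (‖M.1 (i0 j) j‖ : ℂ) ≠ 0 := by
        intro h0
        have : ‖M.1 (i0 j) j‖ = 0 := by exact_mod_cast h0
        rw [this] at h1
        norm_num at h1
      have h3 : M.1 (i0 j) j * star (M.1 (i0 j) j) = (‖M.1 (i0 j) j‖ : ℂ) ^ 2 :=
        Complex.mul_conj' _
      simp only [edges, Matrix.vecMulVec_apply, Pi.star_apply, hσ', star_div₀, star_mul', star_star]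
      rw [show star (‖M.1 (i0 j) j‖ : ℂ) = (‖M.1 (i0 j) j‖ : ℂ) from Complex.conj_ofReal _]
      field_simp
      linear_combination (M.1 a j * star (M.1 b j)) * h3
    refine ⟨⟨σ, fun j => ?_, ?_⟩, rfl, Subtype.ext hedge⟩
    · have h4 := congrArg Matrix.trace (congrFun hedge j)
      rw [trace_edges, trace_edges, M.2.1] at h4
      exact_mod_cast h4
    · rw [← sum_edges, hedge, sum_edges, M.2.2]

lemma contDiff_det {k : ℕ} {l : WithTop ℕ∞} : ContDiff ℝ l fun A : Mat k => A.det := by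
  simp only [Matrix.det_apply']
  exact ContDiff.sum fun s _ => contDiff_const.mul
    (contDiff_prod fun i _ => contDiff_entry _ _)

lemma contDiffAt_inv {k : ℕ} {l : WithTop ℕ∞} {A : Mat k} (hA : A.det ≠ 0) :
    ContDiffAt ℝ l (fun A : Mat k => A⁻¹) A := by
  have hadj : ContDiff ℝ l fun A : Mat k => A.adjugate := by
    refine contDiff_matrix.mpr fun i j => ?_
    simp only [Matrix.adjugate_apply]
    refine contDiff_det.comp (contDiff_matrix.mpr fun a b => ?_)
    simp only [Matrix.updateRow_apply]
    split_ifs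
    · exact contDiff_const
    · exact contDiff_entry a b
  simp only [Matrix.inv_def, Ring.inverse_eq_inv']
  refine contDiffAt_matrix.mpr fun i j => ?_
  simp only [Matrix.smul_apply, smul_eq_mul]
  exact (contDiff_det.contDiffAt.inv hA).mul (contDiff_matrix.mp hadj i j).contDiffAt

/-- An analytic Hermitian square root near `c² I`. -/
lemma exists_sqrt (k : ℕ) {c : ℝ} (hc : c ≠ 0) :
    ∃ R : Mat k → Mat k, ContDiffAt ℝ ω R (((c : ℂ) • 1) * ((c : ℂ) • 1)) ∧
      R (((c : ℂ) • 1) * ((c : ℂ) • 1)) = (c : ℂ) • 1 ∧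
      ∀ᶠ S in 𝓝 (((c : ℂ) • (1 : Mat k)) * ((c : ℂ) • 1)), R S * R S = S ∧
        (S.IsHermitian → (R S).IsHermitian) := by
  have : CompleteSpace (Mat k) := FiniteDimensional.complete ℝ _
  -- Squaring has derivative `v ↦ 2 c v` at the scalar matrix `c I`, so the inverse function theorem
  -- applies.
  obtain ⟨R, h1, h2, h3, h4⟩ := exists_local_inverse (fun B : Mat k => B * B) ((c : ℂ) • 1)
    (2 * c) (by simpa) (ContDiff.matrix_mul contDiff_id contDiff_id) (fun v => by
      have h3 : HasDerivAt (fun t : ℝ => (c : ℂ) • (1 : Mat k) + t • v) v 0 := by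
        have h := ((hasDerivAt_id (0 : ℝ)).smul_const v).const_add ((c : ℂ) • (1 : Mat k))
        rw [one_smul] at h
        exact h
      have h4 := HasDerivAt.matrix_mul h3 h3
      have h5 : v * ((c : ℂ) • (1 : Mat k) + (0 : ℝ) • v) + ((c : ℂ) • (1 : Mat k) + (0 : ℝ) • v) * v
          = (2 * c) • v := by
        ext i j
        simp
        ring
      rwa [h5] at h4)
  refine ⟨R, h1, h2, ?_⟩
  -- For Hermitian `S` the adjoint of `R S` is another root of `S` near `c I`; local uniqueness
  -- makes it equal to `R S`.
  have h5 : Filter.Tendsto (fun S => (R S)ᴴ) (𝓝 (((c : ℂ) • (1 : Mat k)) * ((c : ℂ) • 1)))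
      (𝓝 ((c : ℂ) • 1)) := by
    have h6 : ContinuousAt (fun S => (R S)ᴴ) (((c : ℂ) • (1 : Mat k)) * ((c : ℂ) • 1)) :=
      (contDiff_conjTranspose (k := 0)).continuous.continuousAt.comp h1.continuousAt
    have h7 := h6.tendsto
    rw [h2] at h7
    simpa using h7
  filter_upwards [h3, h5.eventually h4] with S hS hS'
  refine ⟨hS, fun hH => ?_⟩
  rw [← Matrix.conjTranspose_mul, hS, hH] at hS'
  exact hS'.symm

/-- An analytic local section of the map from the common level set to the level set in the
Grassmannian. -/
lemma exists_section_gram (hmn : m + 1 ≤ n) (hr : ∀ i, 0 < r i) (X : GrassLevel m r) :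
    ∃ σ : Mat n → RectMat m n, ContDiffAt ℝ ω σ X.1 ∧
      ∀ᶠ y in 𝓝 X.1, ∀ Y : GrassLevel m r, Y.1 = y →
        ∃ M : MatrixLevel m r, M.1 = σ y ∧ M.gram hmn = Y := by
  obtain ⟨N, rfl⟩ := MatrixLevel.exists_gram_eq hmn hr X
  have hΛ := lam_pos hmn hr
  obtain ⟨R, h1, h2, h3⟩ := exists_sqrt (m + 1) hΛ.ne'
  have hS0 : N.1 * (N.gram hmn).1 * N.1ᴴ
      = ((lam m r : ℂ) • (1 : Mat (m + 1))) * ((lam m r : ℂ) • 1) := by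
    change N.1 * (N.1ᴴ * N.1) * N.1ᴴ = _
    rw [← Matrix.mul_assoc, N.2.2, Matrix.mul_assoc, N.2.2]
  have hS : ContDiff ℝ ω fun X : Mat n => N.1 * X * N.1ᴴ :=
    ContDiff.matrix_mul (ContDiff.matrix_mul contDiff_const contDiff_id) contDiff_const
  rw [← hS0] at h1 h2 h3
  have hRS : ContDiffAt ℝ ω (fun X : Mat n => R (N.1 * X * N.1ᴴ)) (N.gram hmn).1 :=
    ContDiffAt.comp (N.gram hmn).1 h1 hS.contDiffAt
  have hdet : (R (N.1 * (N.gram hmn).1 * N.1ᴴ)).det ≠ 0 := by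
    rw [h2, Matrix.det_smul, Matrix.det_one, mul_one]
    exact pow_ne_zero _ (by exact_mod_cast hΛ.ne')
  have hinv : ContDiffAt ℝ ω (fun X : Mat n => (R (N.1 * X * N.1ᴴ))⁻¹) (N.gram hmn).1 :=
    ContDiffAt.comp (N.gram hmn).1 (contDiffAt_inv hdet) hRS
  -- At a nearby `Y = Mᴴ M` put `A = N Mᴴ`. The formula reads `(A Aᴴ)^(-1/2) A M`: the unitary
  -- factor of the polar decomposition of `A`, applied to `M`. It depends on `Y` alone and has Gram
  -- matrix `Y`. At the base point `N X Nᴴ` is `Λ² I`, where the square root is available.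
  refine ⟨fun X => (R (N.1 * X * N.1ᴴ))⁻¹ * (N.1 * X),
    ContDiffAt.matrix_mul hinv (ContDiff.matrix_mul contDiff_const contDiff_id).contDiffAt, ?_⟩
  have hdet' : ∀ᶠ X in 𝓝 (N.gram hmn).1, (R (N.1 * X * N.1ᴴ)).det ≠ 0 :=
    ((contDiff_det (l := 0)).continuous.continuousAt.comp
      hRS.continuousAt).eventually_ne hdet
  filter_upwards [hdet', hS.continuous.continuousAt.eventually h3] with y hy1 hy2 Y hY
  subst hY
  obtain ⟨M, rfl⟩ := MatrixLevel.exists_gram_eq hmn hr Y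
  obtain ⟨hsq, hherm⟩ := hy2
  have hA : N.1 * (M.gram hmn).1 = N.1 * M.1ᴴ * M.1 := (Matrix.mul_assoc _ _ _).symm
  have hAA : N.1 * (M.gram hmn).1 * N.1ᴴ = (N.1 * M.1ᴴ) * (N.1 * M.1ᴴ)ᴴ := by
    rw [hA, Matrix.conjTranspose_mul, Matrix.conjTranspose_conjTranspose]
    simp only [Matrix.mul_assoc]
  have hH := hherm (by rw [hAA]; exact Matrix.isHermitian_mul_conjTranspose_self _)
  rw [hAA] at hsq
  set B := R (N.1 * (M.gram hmn).1 * N.1ᴴ) with hB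
  rw [← hAA, ← hB, hAA] at hsq
  set A := N.1 * M.1ᴴ with hAdef
  have hu : IsUnit B.det := isUnit_iff_ne_zero.mpr hy1
  have hW : (B⁻¹ * A) * (B⁻¹ * A)ᴴ = 1 := by
    rw [Matrix.conjTranspose_mul, Matrix.conjTranspose_nonsing_inv, hH, Matrix.mul_assoc,
      ← Matrix.mul_assoc A, ← hsq, Matrix.mul_assoc B, Matrix.mul_nonsing_inv _ hu,
      Matrix.mul_one, Matrix.nonsing_inv_mul _ hu]
  have hW' : (B⁻¹ * A)ᴴ * (B⁻¹ * A) = 1 := mul_eq_one_comm.mp hW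
  have hσ : B⁻¹ * (N.1 * (M.gram hmn).1) = (B⁻¹ * A) * M.1 := by
    rw [hA]
    exact (Matrix.mul_assoc _ _ _).symm
  have hgram : ((B⁻¹ * A) * M.1)ᴴ * ((B⁻¹ * A) * M.1) = M.1ᴴ * M.1 := gram_mul_left _ hW' _
  refine ⟨⟨(B⁻¹ * A) * M.1, fun j => norm_sq_of_gram_diag _ j _ ?_, ?_⟩, hσ.symm,
    Subtype.ext hgram⟩
  · rw [hgram, gram_diag M.1 j _ (M.2.1 j)]
  · rw [Matrix.conjTranspose_mul, Matrix.mul_assoc, ← Matrix.mul_assoc M.1, M.2.2,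
      Matrix.smul_mul, Matrix.one_mul, Matrix.mul_smul, hW]

/-- Locally `F ∘ gram ∘ σ` extends the function, with `σ` a section of the edge map. Gluing gives a
smooth extension, and averaging makes it invariant without changing it on closed polygons. -/
theorem polygonSmooth_of_grassSmooth (hmn : m + 1 ≤ n) (hr : ∀ i, 0 < r i)
    {Φ : PolygonSpace m r ≃ₜ TorusQuotient m r} (hΦ : ∀ N, Φ (piOne N) = piTwo hmn N)
    {f : TorusQuotient m r → ℝ} (hf : GrassSmooth f) : PolygonSmooth (f ∘ Φ) := by
  obtain ⟨F, hF, -, hFf⟩ := hf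
  obtain ⟨G, hG, hGf⟩ := exists_contDiff_extension (isClosed_range_edges (m := m) hr)
    (fun e => f (Φ (Quotient.mk _ ⟨e.1, e.2⟩))) (fun e he => by
      obtain ⟨σ, h1, h2⟩ := exists_section_edges hr ⟨e, he⟩
      refine ⟨fun y => F ((σ y)ᴴ * σ y), ?_⟩
      -- Analyticity at a point persists in a neighbourhood, whereas `ContDiffAt ℝ ∞` at a point
      -- need not; hence sections of class `ω`.
      filter_upwards [h1.eventually (by simp), h2] with y hy1 hy2
      refine ⟨hF.contDiffAt.comp y (contDiff_gram.contDiffAt.comp y (hy1.of_le le_top)),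
        fun hy => ?_⟩
      obtain ⟨M, hM1, hM2⟩ := hy2 ⟨y, hy⟩ rfl
      rw [← hM1, ← hM2]
      exact (hFf (M.gram hmn)).trans (congrArg f (hΦ M).symm))
  obtain ⟨F', h1, h2, h3⟩ := exists_unitary_average G hG
  -- The average keeps the value at `e` since every conjugate of `e` is a closed polygon of the same
  -- class, where `G` takes that value.
  refine ⟨F', h1, h2, fun e => h3 _ _ fun g => ?_⟩
  obtain ⟨N, rfl⟩ := MatrixLevel.exists_polygon_eq hr e
  have hgN : ((g : Mat (m + 1)) * N.1) * ((g : Mat (m + 1)) * N.1)ᴴ = (lam m r : ℂ) • 1 := by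
    rw [Matrix.conjTranspose_mul, Matrix.mul_assoc, ← Matrix.mul_assoc N.1, N.2.2,
      Matrix.smul_mul, Matrix.one_mul, Matrix.mul_smul, unitary_mul_conjTranspose]
  let gN : MatrixLevel m r := ⟨(g : Mat (m + 1)) * N.1, fun j => norm_sq_of_gram_diag _ j _ (by
    rw [gram_mul_left _ (unitary_conjTranspose_mul g), gram_diag N.1 j _ (N.2.1 j)]), hgN⟩
  have he : (fun i => conjBy g (N.polygon.1 i)) = gN.polygon.1 :=
    funext fun i => (edges_mul_left _ N.1 i).symm
  rw [he]
  refine (hGf ⟨gN.polygon.1, gN.polygon.2⟩).trans (congrArg (f ∘ Φ) ?_)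
  exact Quotient.sound ⟨g⁻¹, fun i => by
    change edges N.1 i = conjBy _ (edges ((g : Mat (m + 1)) * N.1) i)
    rw [edges_mul_left, conjBy_conjBy, ← Submonoid.coe_mul, inv_mul_cancel, Submonoid.coe_one,
      conjBy_one]⟩

theorem grassSmooth_of_polygonSmooth (hmn : m + 1 ≤ n) (hr : ∀ i, 0 < r i)
    {Φ : PolygonSpace m r ≃ₜ TorusQuotient m r} (hΦ : ∀ N, Φ (piOne N) = piTwo hmn N)
    {f : TorusQuotient m r → ℝ} (hf : PolygonSmooth (f ∘ Φ)) : GrassSmooth f := by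
  obtain ⟨F, hF, -, hFf⟩ := hf
  obtain ⟨G, hG, hGf⟩ := exists_contDiff_extension (isClosed_range_gram hmn hr)
    (fun X => f (Quotient.mk _ ⟨X.1, X.2⟩)) (fun X hX => by
      obtain ⟨σ, h1, h2⟩ := exists_section_gram hmn hr ⟨X, hX⟩
      refine ⟨fun y => F (edges (σ y)), ?_⟩
      filter_upwards [h1.eventually (by simp), h2] with y hy1 hy2
      refine ⟨hF.contDiffAt.comp y (contDiff_edges.contDiffAt.comp y (hy1.of_le le_top)),
        fun hy => ?_⟩
      obtain ⟨M, hM1, hM2⟩ := hy2 ⟨y, hy⟩ rfl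
      rw [← hM1, ← hM2]
      exact (hFf M.polygon).trans (congrArg f (hΦ M)))
  obtain ⟨F', h1, h2, h3⟩ := exists_torus_average G hG
  refine ⟨F', h1, h2, fun X => h3 _ _ fun t => ?_⟩
  obtain ⟨N, rfl⟩ := MatrixLevel.exists_gram_eq hmn hr X
  have hedge : edges (N.1 * torusMat t⁻¹) = edges N.1 := edges_mul_torusMat _ _
  let Nt : MatrixLevel m r := ⟨N.1 * torusMat t⁻¹, fun j => by
    have h4 := congrArg Matrix.trace (congrFun hedge j)
    rw [trace_edges, trace_edges, N.2.1] at h4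
    exact_mod_cast h4, by rw [← sum_edges, hedge, sum_edges, N.2.2]⟩
  have he : conjBy (torusMat t) (N.gram hmn).1 = (Nt.gram hmn).1 := by
    change _ = (N.1 * torusMat t⁻¹)ᴴ * (N.1 * torusMat t⁻¹)
    rw [gram_mul_torusMat, inv_inv]
    rfl
  rw [he]
  refine (hGf ⟨(Nt.gram hmn).1, (Nt.gram hmn).2⟩).trans (congrArg f ?_)
  refine Quotient.sound ⟨t⁻¹, ?_⟩
  change (N.gram hmn).1 = conjBy _ (Nt.gram hmn).1
  rw [← he, conjBy_conjBy, ← torusMat_mul, inv_mul_cancel, torusMat_one, conjBy_one]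

end smooth


/-! ### The transposition of the torus quotient -/

section

variable {m n : ℕ} {r : Fin n → ℝ}

lemma MatrixLevel.gram_conj (hmn : m + 1 ≤ n) (N : MatrixLevel m r) :
    (N.conj.gram hmn).1 = (N.gram hmn).1ᵀ := by
  ext a b
  simp [MatrixLevel.gram, MatrixLevel.conj, Matrix.mul_apply, mul_comm]

lemma transpose_mem_grassLevel (hmn : m + 1 ≤ n) (hr : ∀ i, 0 < r i) (X : GrassLevel m r) :
    X.1ᵀ ∈ grassOrbit m n (lam m r) ∧ ∀ j, X.1ᵀ j j = (r j : ℂ) := by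
  obtain ⟨N, rfl⟩ := MatrixLevel.exists_gram_eq hmn hr X
  rw [← MatrixLevel.gram_conj]
  exact (N.conj.gram hmn).2

/-- Transposition of the level set in the Grassmannian. -/
def GrassLevel.transpose (hmn : m + 1 ≤ n) (hr : ∀ i, 0 < r i) (X : GrassLevel m r) :
    GrassLevel m r :=
  ⟨X.1ᵀ, transpose_mem_grassLevel hmn hr X⟩

lemma transpose_conjBy_torusMat (t : Fin n → Circle) (X : Mat n) :
    (conjBy (torusMat t) X)ᵀ = conjBy (torusMat t⁻¹) Xᵀ := by
  have h : ∀ a, ((t⁻¹ a : Circle) : ℂ) = star (t a : ℂ) := fun a => Circle.coe_inv_eq_conj (t a)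
  ext a b
  simp only [conjBy, torusMat, Matrix.transpose_apply, Matrix.diagonal_conjTranspose,
    Matrix.mul_diagonal, Matrix.diagonal_mul, Pi.star_apply, h, star_star]
  ring

lemma GrassLevel.transpose_rel (hmn : m + 1 ≤ n) (hr : ∀ i, 0 < r i) {X Y : GrassLevel m r}
    (h : X ≈ Y) : X.transpose hmn hr ≈ Y.transpose hmn hr := by
  obtain ⟨t, ht⟩ := h
  exact ⟨t⁻¹, (congrArg Matrix.transpose ht).trans (transpose_conjBy_torusMat t X.1)⟩

/-- Transposition of the torus quotient. -/
def transposeHomeomorph (hmn : m + 1 ≤ n) (hr : ∀ i, 0 < r i) :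
    TorusQuotient m r ≃ₜ TorusQuotient m r :=
  have hc : Continuous (Quotient.map (GrassLevel.transpose hmn hr)
      fun _ _ h => GrassLevel.transpose_rel hmn hr h : TorusQuotient m r → TorusQuotient m r) := by
    refine Continuous.quotient_map' ?_ _
    exact Continuous.subtype_mk continuous_subtype_val.matrix_transpose _
  have hinv : Function.Involutive (Quotient.map (GrassLevel.transpose hmn hr)
      fun _ _ h => GrassLevel.transpose_rel hmn hr h : TorusQuotient m r → TorusQuotient m r) := by
    intro x
    obtain ⟨X, rfl⟩ := Quotient.exists_rep x
    rfl
  { toFun := _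
    invFun := _
    left_inv := hinv
    right_inv := hinv
    continuous_toFun := hc
    continuous_invFun := hc }

lemma transposeHomeomorph_mk (hmn : m + 1 ≤ n) (hr : ∀ i, 0 < r i) (X : GrassLevel m r) :
    transposeHomeomorph hmn hr (Quotient.mk _ X) = Quotient.mk _ (X.transpose hmn hr) := rfl

lemma transposeHomeomorph_transposeHomeomorph (hmn : m + 1 ≤ n) (hr : ∀ i, 0 < r i)
    (x : TorusQuotient m r) :
    transposeHomeomorph hmn hr (transposeHomeomorph hmn hr x) = x :=
  (transposeHomeomorph hmn hr).left_inv x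

lemma transposeHomeomorph_piTwo (hmn : m + 1 ≤ n) (hr : ∀ i, 0 < r i) (N : MatrixLevel m r) :
    transposeHomeomorph hmn hr (piTwo hmn N) = piTwo hmn N.conj :=
  congrArg (Quotient.mk _) (Subtype.ext (MatrixLevel.gram_conj hmn N).symm :
    (N.gram hmn).transpose hmn hr = N.conj.gram hmn)

end

/-- The sign is put on `A` because for skew-Hermitian `A` the matrix `-Aᵀ` is the entrywise
conjugate, again skew-Hermitian. So transposition carries orbit tangent vectors to orbit tangent
vectors. -/
lemma transpose_lie {k : ℕ} (A B : Mat k) : ⁅A, B⁆ᵀ = ⁅-Aᵀ, Bᵀ⁆ := by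
  rw [Ring.lie_def, Ring.lie_def, Matrix.transpose_sub, Matrix.transpose_mul, Matrix.transpose_mul,
    Matrix.neg_mul, Matrix.mul_neg]
  abel

lemma neg_transpose_mem_skewAdjoint {k : ℕ} {A : Mat k} (hA : A ∈ skewAdjoint (Mat k)) :
    -Aᵀ ∈ skewAdjoint (Mat k) := by
  rw [skewAdjoint.mem_iff, Matrix.star_eq_conjTranspose] at hA ⊢
  rw [Matrix.conjTranspose_neg, show Aᵀᴴ = Aᴴᵀ from rfl, hA, Matrix.transpose_neg]

/-- Transposition reverses commutators and preserves traces, so it is antisymplectic. -/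
lemma kkForm_transpose {k : ℕ} (X v w : Mat k) : kkForm Xᵀ vᵀ wᵀ = -kkForm X v w := by
  have key : ∀ X v w : Mat k, (∃ p : Mat k × Mat k, p.1 ∈ skewAdjoint (Mat k) ∧
      p.2 ∈ skewAdjoint (Mat k) ∧ v = ⁅p.1, X⁆ ∧ w = ⁅p.2, X⁆) →
      ∃ p : Mat k × Mat k, p.1 ∈ skewAdjoint (Mat k) ∧
      p.2 ∈ skewAdjoint (Mat k) ∧ vᵀ = ⁅p.1, Xᵀ⁆ ∧ wᵀ = ⁅p.2, Xᵀ⁆ := by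
    rintro X v w ⟨⟨ξ, η⟩, hξ, hη, rfl, rfl⟩
    exact ⟨(-ξᵀ, -ηᵀ), neg_transpose_mem_skewAdjoint hξ, neg_transpose_mem_skewAdjoint hη,
      transpose_lie _ _, transpose_lie _ _⟩
  by_cases h : ∃ p : Mat k × Mat k, p.1 ∈ skewAdjoint (Mat k) ∧
      p.2 ∈ skewAdjoint (Mat k) ∧ v = ⁅p.1, X⁆ ∧ w = ⁅p.2, X⁆
  · obtain ⟨⟨ξ, η⟩, hξ, hη, rfl, rfl⟩ := h
    dsimp only at hξ hη ⊢
    rw [transpose_lie, transpose_lie, kkForm_lie _ _ _ (neg_transpose_mem_skewAdjoint hξ)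
      (neg_transpose_mem_skewAdjoint hη), kkForm_lie _ _ _ hξ hη]
    have h1 : ⁅-ξᵀ, -ηᵀ⁆ = -⁅ξ, η⁆ᵀ := by
      rw [transpose_lie, Ring.lie_def, Ring.lie_def]
      simp only [Matrix.neg_mul, Matrix.mul_neg, neg_neg]
      abel
    rw [h1, Matrix.mul_neg, Matrix.trace_neg, ← Matrix.transpose_mul, Matrix.trace_transpose,
      Matrix.trace_mul_comm, Complex.neg_im]
  -- Off the tangent vectors both forms take the default value `0`; being tangent is invariant under
  -- transposition.
  · have h' : ¬ ∃ p : Mat k × Mat k, p.1 ∈ skewAdjoint (Mat k) ∧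
        p.2 ∈ skewAdjoint (Mat k) ∧ vᵀ = ⁅p.1, Xᵀ⁆ ∧ wᵀ = ⁅p.2, Xᵀ⁆ := fun h0 => h (by
      simpa only [Matrix.transpose_transpose] using key _ _ _ h0)
    rw [kkForm, kkForm, dif_neg h, dif_neg h', neg_zero]

lemma grad_transpose {k : ℕ} (L L' : Mat k →ₗ[ℝ] ℝ) (h : ∀ Y, L' Y = L Yᵀ) :
    grad L' = (grad L)ᵀ := by
  ext a b
  simp only [grad, Matrix.transpose_apply, Matrix.smul_apply, Matrix.of_apply, h,
    Matrix.transpose_add, Matrix.transpose_sub, Matrix.transpose_single]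

section smooth

attribute [local instance] Matrix.normedAddCommGroup Matrix.normedSpace

lemma contDiff_transpose {k : ℕ} {l : WithTop ℕ∞} : ContDiff ℝ l fun X : Mat k => Xᵀ :=
  contDiff_matrix.mpr fun i j => contDiff_entry j i

lemma HasDerivAt.transpose {k : ℕ} {f : ℝ → Mat k} {f' : Mat k} {t : ℝ}
    (h : HasDerivAt f f' t) : HasDerivAt (fun t => (f t)ᵀ) f'ᵀ t :=
  hasDerivAt_matrix.mpr fun i j => hasDerivAt_matrix.mp h j i

lemma fderiv_comp_transpose {k : ℕ} (F : Mat k → ℝ) (hF : Differentiable ℝ F) (X Y : Mat k) :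
    fderiv ℝ (fun X => F Xᵀ) X Y = fderiv ℝ F Xᵀ Yᵀ := by
  have h1 : HasDerivAt (fun t : ℝ => X + t • Y) Y 0 := by
    have h := ((hasDerivAt_id (0 : ℝ)).smul_const Y).const_add X
    rw [one_smul] at h
    exact h
  have hd : DifferentiableAt ℝ (fun X => F Xᵀ) X :=
    (hF _).comp X ((contDiff_transpose (l := 1)).differentiable one_ne_zero X)
  have h2 : HasDerivAt (fun t : ℝ => F (X + t • Y)ᵀ) (fderiv ℝ (fun X => F Xᵀ) X Y) 0 := by
    refine HasFDerivAt.comp_hasDerivAt (0 : ℝ) (l := fun X => F Xᵀ) ?_ h1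
    rw [zero_smul, add_zero]
    exact hd.hasFDerivAt
  have h3 : HasDerivAt (fun t : ℝ => F (X + t • Y)ᵀ) (fderiv ℝ F Xᵀ Yᵀ) 0 := by
    refine HasFDerivAt.comp_hasDerivAt (0 : ℝ) (l := F) ?_ (HasDerivAt.transpose h1)
    rw [zero_smul, add_zero]
    exact (hF _).hasFDerivAt
  exact h2.unique h3

lemma lieBracket_transpose {k : ℕ} (F H : Mat k → ℝ) (hF : Differentiable ℝ F)
    (hH : Differentiable ℝ H) (X : Mat k) :
    lieBracket (fun X => F Xᵀ) (fun X => H Xᵀ) Xᵀ = -lieBracket F H X := by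
  rw [lieBracket, lieBracket,
    grad_transpose (fderiv ℝ F X).toLinearMap _ fun Y => fderiv_comp_transpose F hF Xᵀ Y,
    grad_transpose (fderiv ℝ H X).toLinearMap _ fun Y => fderiv_comp_transpose H hH Xᵀ Y]
  set ξ := grad (fderiv ℝ F X).toLinearMap
  set η := grad (fderiv ℝ H X).toLinearMap
  have h1 : ⁅ξᵀ, ηᵀ⁆ = -⁅ξ, η⁆ᵀ := by
    rw [transpose_lie, Ring.lie_def, Ring.lie_def]
    simp only [Matrix.neg_mul, Matrix.mul_neg]
    abel
  rw [h1, Matrix.mul_neg, Matrix.trace_neg, ← Matrix.transpose_mul, Matrix.trace_transpose,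
    Matrix.trace_mul_comm, Complex.neg_im]

variable {m n : ℕ} {r : Fin n → ℝ}

lemma IsGrassLift.transpose (hmn : m + 1 ≤ n) (hr : ∀ i, 0 < r i) {F : Mat n → ℝ}
    {f : TorusQuotient m r → ℝ} (h : IsGrassLift F f) :
    IsGrassLift (fun X => F Xᵀ) (f ∘ transposeHomeomorph hmn hr) := by
  obtain ⟨h1, h2, h3⟩ := h
  refine ⟨h1.comp contDiff_transpose, fun t X => ?_, fun X => h3 (X.transpose hmn hr)⟩
  exact (congrArg F (transpose_conjBy_torusMat t X)).trans (h2 _ _)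

lemma comp_transposeHomeomorph_comp (hmn : m + 1 ≤ n) (hr : ∀ i, 0 < r i)
    (f : TorusQuotient m r → ℝ) :
    (f ∘ transposeHomeomorph hmn hr) ∘ transposeHomeomorph hmn hr = f :=
  funext fun x => congrArg f (transposeHomeomorph_transposeHomeomorph hmn hr x)

/-! ### The two symplectomorphisms. -/

theorem isSymplectomorphism_duality (hmn : m + 1 ≤ n) (hr : ∀ i, 0 < r i)
    {Φ : PolygonSpace m r ≃ₜ TorusQuotient m r} (hΦ : ∀ N, Φ (piOne N) = piTwo hmn N) :
    IsSymplectomorphism (-1) Φ where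
  smooth_iff _ := ⟨polygonSmooth_of_grassSmooth hmn hr hΦ, grassSmooth_of_polygonSmooth hmn hr hΦ⟩
  poisson f h F H F' H' hF hH hF' hH' e X heX := by
    obtain ⟨N, rfl, rfl⟩ := exists_common_lift hmn hr hΦ e X heX
    -- Lifts of `f` and of `f ∘ Φ` pull back to the same function on the common level set.
    have hcompat : ∀ (f : TorusQuotient m r → ℝ) F F', IsGrassLift F f → IsPolygonLift F' (f ∘ Φ) →
        ∀ M : MatrixLevel m r, F' (edges M.1) = F (M.1ᴴ * M.1) := fun f F F' hF hF' M =>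
      (hF'.2.2 M.polygon).trans ((congrArg f (hΦ M)).trans (hF.2.2 (M.gram hmn)).symm)
    have := prodLieBracket_eq_neg_lieBracket F H F' H' hF.1 hH.1 hF'.1 hH'.1 hH.2.1 hF'.2.1
      (hcompat f F F' hF hF') (hcompat h H H' hH hH') N
    rw [inv_neg, inv_one, neg_one_mul]
    exact this
  form := reduced_form_eq hmn hr hΦ

/-- The duality and the transposition each reverse the sign of forms and brackets, so the composite
preserves it. Statements about the composite become statements about `Φ` at the transposed matrix,
transposition being an involution. -/
theorem IsSymplectomorphism.trans_transpose (hmn : m + 1 ≤ n) (hr : ∀ i, 0 < r i)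
    {Φ : PolygonSpace m r ≃ₜ TorusQuotient m r} (hΦ : IsSymplectomorphism (-1) Φ) :
    IsSymplectomorphism 1 (Φ.trans (transposeHomeomorph hmn hr)) := by
  have hmk : ∀ (e : ClosedPolygon m r) (X : GrassLevel m r),
      Φ.trans (transposeHomeomorph hmn hr) (Quotient.mk _ e) = Quotient.mk _ X →
      Φ (Quotient.mk _ e) = Quotient.mk _ (X.transpose hmn hr) := fun e X h => by
    rw [← transposeHomeomorph_mk, ← h]
    exact (transposeHomeomorph_transposeHomeomorph hmn hr _).symm
  have hinf : (∞ : WithTop ℕ∞) ≠ 0 := by simp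
  refine ⟨fun f => ?_, fun f h F H F' H' hF hH hF' hH' e X heX => ?_,
    fun e he X c c' d d' hc hc' hd hd' hc0 hc0' hd0 hd0' h h' => ?_⟩
  · refine Iff.trans ⟨?_, ?_⟩ (hΦ.smooth_iff (f ∘ transposeHomeomorph hmn hr))
    · exact fun ⟨F, hF⟩ => ⟨_, hF.transpose hmn hr⟩
    · rintro ⟨F, hF⟩
      have := hF.transpose hmn hr
      rw [comp_transposeHomeomorph_comp] at this
      exact ⟨_, this⟩
  · have h1 := hΦ.poisson _ _ _ _ F' H' (hF.transpose hmn hr) (hH.transpose hmn hr) hF' hH' e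
      (X.transpose hmn hr) (hmk e X heX)
    rw [h1, GrassLevel.transpose, lieBracket_transpose F H (hF.1.differentiable hinf)
      (hH.1.differentiable hinf)]
    norm_num
  · have h1 := hΦ.form e he (X.transpose hmn hr) c c' (fun t => (d t).transpose hmn hr)
      (fun t => (d' t).transpose hmn hr) hc hc' (contDiff_transpose.comp hd)
      (contDiff_transpose.comp hd') hc0 hc0' (by simp only [hd0]) (by simp only [hd0'])
      (fun t => hmk _ _ (h t)) (fun t => hmk _ _ (h' t))
    have h2 : ∀ d : ℝ → GrassLevel m r, ContDiff ℝ ∞ (fun t => (d t).1) →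
        deriv (fun t => ((d t).transpose hmn hr).1) 0 = (deriv (fun t => (d t).1) 0)ᵀ := fun d hd =>
      (HasDerivAt.transpose (hd.differentiable hinf 0).hasDerivAt).deriv
    rw [h1, h2 d hd, h2 d' hd', GrassLevel.transpose, kkForm_transpose]
    ring

end smooth

end

end PolygonDuality

theorem mainTheorem7 (m n : ℕ) (hmn : m + 1 ≤ n) (r : Fin n → ℝ) (hr : ∀ i, 0 < r i) :
    PolygonDuality.TorusReduction m r ∧
    PolygonDuality.UnitaryReduction hmn (PolygonDuality.lam m r) ∧
    Function.Surjective (PolygonDuality.piOne (m := m) (r := r)) ∧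
    Function.Surjective (PolygonDuality.piTwo (m := m) (r := r) hmn) ∧
    (∃ Φ : PolygonDuality.PolygonSpace m r ≃ₜ PolygonDuality.TorusQuotient m r,
      (∀ N, Φ (PolygonDuality.piOne N) = PolygonDuality.piTwo hmn N) ∧
      PolygonDuality.IsSymplectomorphism (-1) Φ ∧
      PolygonDuality.PullsBackToBending Φ) ∧
    (∃ Ψ : PolygonDuality.PolygonSpace m r ≃ₜ PolygonDuality.TorusQuotient m r,
      (∀ N, Ψ (PolygonDuality.piOne N) = PolygonDuality.piTwo hmn N.conj) ∧
      PolygonDuality.IsSymplectomorphism 1 Ψ ∧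
      PolygonDuality.PullsBackToBending Ψ) := by
  open PolygonDuality in
  obtain ⟨Φ, hΦ⟩ := exists_duality_homeomorph hmn hr
  have hsymp := isSymplectomorphism_duality hmn hr hΦ
  have hΨ : ∀ N, Φ.trans (transposeHomeomorph hmn hr) (piOne N) = piTwo hmn N.conj := fun N =>
    (congrArg (transposeHomeomorph hmn hr) (hΦ N)).trans (transposeHomeomorph_piTwo hmn hr N)
  exact ⟨torusReduction m hr, unitaryReduction hmn (lam_pos hmn hr), piOne_surjective hr,
    piTwo_surjective hmn hr,
    ⟨Φ, hΦ, hsymp, pullsBackToBending hmn hr Φ fun N i j => by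
      rw [hΦ, gelfandTsetlin_piTwo, bending_piOne]⟩,
    ⟨Φ.trans (transposeHomeomorph hmn hr), hΨ, hsymp.trans_transpose hmn hr,
      pullsBackToBending hmn hr _ fun N i j => by
        rw [hΨ, gelfandTsetlin_piTwo_conj, bending_piOne]⟩⟩
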